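/- **Model.** Let $R,d,N\in\mathbb N$. An $R$-dimensional array has $M_r$ sensors with real grid positions $k^{(r)}_1,\dots,k^{(r)}_{M_r}$ in mode $r$ ($r=1,\dots,R$), and $M=\prod_r M_r$. Let $\mu_i^{(r)}\in(-\pi,\pi)$ be the frequencies of $d$ sources with pairwise distinct vectors $\boldsymbol\mu_i=(\mu_i^{(1)},\dots,\mu_i^{(R)})$. Let $A\in\mathbb C^{M\times d}$ have columns $a^{(1)}(\mu^{(1)}_i)\otimes\dots\otimes a^{(R)}(\mu^{(R)}_i)$ with $a^{(r)}(\mu)=(e^{jk^{(r)}_m\mu})_m$. Let $S=\Psi S_0$ with $S_0\in\mathbb R^{d\times N}$, $\Psi=\mathrm{diag}(e^{j\varphi_i})$, and $X=AS+W$ with noise $W\in\mathbb C^{M\times N}$. In mode $r$ let $J_1^{(r)},J_2^{(r)}$ be selection matrices, each selecting $M_r^{\rm sel}$ of the $M_r$ sensors, $\tilde J_k^{(r)}=I\otimes J_k^{(r)}\otimes I$, $\lambda_i^{(r)}=e^{j\mu_i^{(r)}}$, $\Lambda^{(r)}=\mathrm{diag}(\lambda^{(r)}_i)$, $\omega_i^{(r)}=\tan(\mu_i^{(r)}/2)$,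 $\Omega^{(r)}=\mathrm{diag}(\omega_i^{(r)})$, and assume shift invariance $\tilde J_1^{(r)}A\Lambda^{(r)}=\tilde J_2^{(r)}A$ for all $r$. **Preprocessing.** Let $\Pi$ denote exchange matrices (of the sizes required, subscripted where needed), $Q_{2n}=\frac1{\sqrt2}\begin{bmatrix}I_n&jI_n\\\Pi_n&-j\Pi_n\end{bmatrix}$. Put $X^{\rm nc}=\begin{bmatrix}X\\\Pi X^*\end{bmatrix}$, $A^{\rm nc}=\begin{bmatrix}A\\\Pi A^*\Psi^*\Psi^*\end{bmatrix}$, $W^{\rm nc}=\begin{bmatrix}W\\\Pi W^*\end{bmatrix}$, the forward-backward averages (FBA) $\tilde X=[X^{\rm nc},\ \Pi_{2M}(X^{\rm nc})^*\Pi_N]$, $\tilde W=[W^{\rm nc},\ \Pi_{2M}(W^{\rm nc})^*\Pi_N]$, the real-valued transform $\varphi(Z)=Q_{2M}^HZQ_{2N}$, $\mathcal J_1^{(r)}=\mathrm{blkdiag}(\tilde J_1^{(r)},\Pi\tilde J_2^{(r)}\Pi)$, $\mathcal J_2^{(r)}=\mathrm{blkdiag}(\tilde J_2^{(r)},\Pi\tilde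 J_1^{(r)}\Pi)$, and $K_1^{(r)}=2\,\mathrm{Re}(Q^H\mathcal J_2^{(r)}Q)$, $K_2^{(r)}=2\,\mathrm{Im}(Q^H\mathcal J_2^{(r)}Q)$ with the left and right matrices $Q$ of orders $2M_r^{\rm sel}M/M_r$ and $2M$. Subscript $0$ means $W=0$. Let $\nu=\|W^{\rm nc}\|_F$. Assume $\operatorname{rank}X^{\rm nc}_0=d$ and $\operatorname{rank}(\mathcal J_1^{(r)}A^{\rm nc})=d$ for all $r$. **Algorithms.** A *joint eigendecomposition* of a family of $d\times d$ matrices $G^{(r)}$ is an invertible $T$ with unit-norm columns whose energy $\sum_r\sum_{i\ne l}|(T^{-1}G^{(r)}T)_{il}|^2$ is minimal among all such $T$ up to a fixed factor $c\ge1$; its eigenvalues are $(T^{-1}G^{(r)}T)_{ii}$. *NC Standard ESPRIT with FBA*: $\hat U_s$ consists of $d$ dominant left singular vectors of $\tilde X$, $\hat\Gamma^{(r)}=(\mathcal J_1^{(r)}\hat U_s)^+\mathcal J_2^{(r)}\hat U_s$, and $\hat\mu_i^{(r)}=\arg\hat\lambda_i^{(r)}$ with the eigenvalues $\hat\lambda_i^{(r)}$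 of a joint eigendecomposition of $(\hat\Gamma^{(r)})_r$ over $\mathbb C$. *NC Standard ESPRIT*: the same with $X^{\rm nc}$ in place of $\tilde X$. *NC Unitary ESPRIT*: $\hat E_s$ consists of $d$ dominant left singular vectors of the real matrix $\varphi(\tilde X)$, $\hat\Upsilon^{(r)}=(K_1^{(r)}\hat E_s)^+K_2^{(r)}\hat E_s$, and $\hat\mu_i^{(r)}=2\arctan\hat\omega_i^{(r)}$ with the eigenvalues $\hat\omega_i^{(r)}$ of a joint eigendecomposition of $(\hat\Upsilon^{(r)})_r$ over $\mathbb R$. **Theorem.** (i) The noise-free matrices have SVDs $\tilde X_0=U_s\Sigma V_s^H$, $\varphi(\tilde X_0)=E_s\Sigma'W_s^T$ (the latter real) with $\Sigma,\Sigma'\in\mathbb R^{d\times d}$ diagonal and positive, $[U_s\ U_n]$ unitary, $[E_s\ E_n]$ orthogonal, and there are an invertible complex $Q$ and an invertible real $V$ with $(\mathcal J_1^{(r)}U_s)^+\mathcal J_2^{(r)}U_s=Q\Lambda^{(r)}Q^{-1}$ and $(K_1^{(r)}E_s)^+K_2^{(r)}E_s=V\Omega^{(r)}V^{-1}$ for all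 $r$. (ii) For every such choice let $q_i,\bar q_i$ be the $i$-th columns of $Q,V$, let $p_i^T,\bar p_i^T$ be the $i$-th rows of $Q^{-1},V^{-1}$, and set $\Delta U_s=U_nU_n^H\tilde WV_s\Sigma^{-1}$, $\Delta E_s=E_nE_n^T\varphi(\tilde W)W_s\Sigma'^{-1}$. Then for all $i,r$ and all $W$ the first-order errors coincide: $$\bar p_i^T(K_1^{(r)}E_s)^+\big(K_2^{(r)}-\omega^{(r)}_iK_1^{(r)}\big)\Delta E_s\,\bar q_i\,\frac{2}{(\omega_i^{(r)})^2+1}=\mathrm{Im}\Big\{p_i^T(\mathcal J_1^{(r)}U_s)^+\big[\mathcal J_2^{(r)}/\lambda_i^{(r)}-\mathcal J_1^{(r)}\big]\Delta U_s\,q_i\Big\}=:L_i^{(r)}(W).$$ (iii) This is the first-order error of the actual estimates of R-D NC Unitary ESPRIT, of R-D NC Standard ESPRIT with FBA, and of R-D NC Standard ESPRIT without FBA: for each of the three algorithms there are $\varepsilon>0$ and $C$ such that for every noise matrix $W$ with $\nu<\varepsilon$ the algorithm has an output, and every output satisfies, after one relabelling of the sources common to all modes, $$\big|\hat\mu_i^{(r)}-\mu_i^{(r)}-L_i^{(r)}(W)\big|\le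 C\,\nu^2\qquad\text{for all } i,r.$$ Thus the algorithms perform identically, to first order in the noise, in the high effective SNR regime. -/

import Mathlib

open scoped Matrix

noncomputable section

namespace NCEsprit

/-! ### Exchange matrices, left `Π`-real matrices, forward-backward averaging -/

/-- Reversal of the order of an index set. -/
class Reversal (ι : Type*) where
  /-- the order-reversing relabelling -/
  rev : ι → ι

/-- On `{0, …, n-1}` the reversal is `m ↦ n - 1 - m`. -/
instance (n : ℕ) : Reversal (Fin n) := ⟨Fin.rev⟩

/-- Multi-indices are understood to be flattened lexicographically, as the Kronecker product does;
the reversal of the flattened index then reverses every component. -/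
instance {κ : Type*} {β : κ → Type*} [∀ l, Reversal (β l)] : Reversal ((l : κ) → β l) :=
  ⟨fun m l => Reversal.rev (m l)⟩

instance {α β : Type*} [Reversal α] [Reversal β] : Reversal (α × β) :=
  ⟨fun p => (Reversal.rev p.1, Reversal.rev p.2)⟩

/-- The exchange matrix `Π`: ones on the antidiagonal, zeros elsewhere. -/
def exchange (ι : Type*) [DecidableEq ι] [Reversal ι] : Matrix ι ι ℂ :=
  Matrix.of fun i j => if j = Reversal.rev i then 1 else 0

/-- Entrywise complex conjugate of a matrix. -/
def conj {m n : Type*} (A : Matrix m n ℂ) : Matrix m n ℂ := A.map (starRingEnd ℂ)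

/-- The exchange matrix of doubled size: with the rows stacked as (first block, second block) it is
`[0 Π; Π 0]`. -/
def exchange₂ (ι : Type*) [DecidableEq ι] [Reversal ι] : Matrix (ι ⊕ ι) (ι ⊕ ι) ℂ :=
  Matrix.fromBlocks 0 (exchange ι) (exchange ι) 0

/-- The sparse unitary left `Π`-real matrix of even order,
`Q = (1/√2) [I, jI; Π, -jΠ]`. -/
def leftReal (ι : Type*) [DecidableEq ι] [Reversal ι] : Matrix (ι ⊕ ι) (ι ⊕ ι) ℂ :=
  ((1 / Real.sqrt 2 : ℝ) : ℂ) •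
    Matrix.fromBlocks 1 (Complex.I • (1 : Matrix ι ι ℂ))
      (exchange ι) (-(Complex.I • exchange ι))

section Preprocessing

variable {ι κ : Type*} [Fintype ι] [DecidableEq ι] [Reversal ι]
  [Fintype κ] [DecidableEq κ] [Reversal κ]

/-- The non-circular augmentation `X ↦ [X; Π X*]`. -/
def augment (X : Matrix ι κ ℂ) : Matrix (ι ⊕ ι) κ ℂ :=
  Matrix.fromRows X (exchange ι * conj X)

/-- Forward-backward averaging `Y ↦ [Y, Π Y* Π]` of an augmented matrix. -/
def fba (Y : Matrix (ι ⊕ ι) κ ℂ) : Matrix (ι ⊕ ι) (κ ⊕ κ) ℂ :=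
  Matrix.fromCols Y (exchange₂ ι * conj Y * exchange κ)

/-- The transformation `φ(Z) = Qᴴ Z Q`. -/
def phi (Z : Matrix (ι ⊕ ι) (κ ⊕ κ) ℂ) : Matrix (ι ⊕ ι) (κ ⊕ κ) ℂ :=
  (leftReal ι)ᴴ * Z * leftReal κ

/-- The matrix `φ(fba (augment X))`, which is real-valued, as a real matrix. -/
def realData (X : Matrix ι κ ℂ) : Matrix (ι ⊕ ι) (κ ⊕ κ) ℝ :=
  (phi (fba (augment X))).map Complex.re

end Preprocessing

/-! ### Linear algebra used by the algorithms -/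

section LinearAlgebra

variable {𝕜 : Type*} [RCLike 𝕜]

/-- `P` is the Moore-Penrose pseudo inverse of `B`. -/
structure IsPinv {m n : Type*} [Fintype m] [Fintype n]
    (B : Matrix m n 𝕜) (P : Matrix n m 𝕜) : Prop where
  mul_mul : B * P * B = B
  mul_mul' : P * B * P = P
  herm : (B * P)ᴴ = B * P
  herm' : (P * B)ᴴ = P * B

/-- `G = B⁺ C`, the least squares solution of the overdetermined system `B G ≈ C`. -/
def IsLeastSquares {m n : Type*} [Fintype m] [Fintype n]
    (B C : Matrix m n 𝕜) (G : Matrix n n 𝕜) : Prop :=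
  ∃ P, IsPinv B P ∧ G = P * C

/-- The columns of `U` are `d` dominant left singular vectors of `Y`: they are orthonormal, the
`i`-th one is a left singular vector for the singular value `σ i` (that is, an eigenvector of
`Y Yᴴ` for `σ i ^ 2`), and on the orthogonal complement of these columns `Yᴴ` has norm at most
`σ i` for every `i`. -/
def IsDominantLeft {m n : Type*} [Fintype m] [Fintype n] {d : ℕ}
    (Y : Matrix m n 𝕜) (U : Matrix m (Fin d) 𝕜) : Prop :=
  Uᴴ * U = 1 ∧ ∃ σ : Fin d → ℝ, (∀ i, 0 ≤ σ i) ∧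
    Y * Yᴴ * U = U * Matrix.diagonal (fun i => ((σ i ^ 2 : ℝ) : 𝕜)) ∧
    ∀ w : m → 𝕜, Uᴴ *ᵥ w = 0 →
      ∀ i, ∑ j, ‖(Yᴴ *ᵥ w) j‖ ^ 2 ≤ σ i ^ 2 * ∑ k, ‖w k‖ ^ 2

/-- The singular value decomposition `Y = [Us Un] [Σs 0; 0 0] [Vs Vn]ᴴ` of a matrix of rank `d`:
`[Us Un]` is unitary, `Vs` has orthonormal columns, the `d` singular values in `Σs` are positive. -/
structure IsRankSVD {m n : Type*} [Fintype m] [DecidableEq m] [Fintype n] {d p : ℕ}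
    (Y : Matrix m n 𝕜) (Us : Matrix m (Fin d) 𝕜) (Un : Matrix m (Fin p) 𝕜)
    (σ : Fin d → ℝ) (Vs : Matrix n (Fin d) 𝕜) : Prop where
  orthonormal_s : Usᴴ * Us = 1
  orthonormal_n : Unᴴ * Un = 1
  orthogonal : Usᴴ * Un = 0
  complete : Us * Usᴴ + Un * Unᴴ = 1
  orthonormal_v : Vsᴴ * Vs = 1
  pos : ∀ i, 0 < σ i
  eq : Y = Us * Matrix.diagonal (fun i => (σ i : 𝕜)) * Vsᴴ

/-- The first-order subspace error `Un Unᴴ W Vs Σs⁻¹` caused by the perturbation `W`. -/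
def subspaceError {m n : Type*} [Fintype m] [Fintype n] {d p : ℕ}
    (Un : Matrix m (Fin p) 𝕜) (σ : Fin d → ℝ) (Vs : Matrix n (Fin d) 𝕜)
    (W : Matrix m n 𝕜) : Matrix m (Fin d) 𝕜 :=
  Un * Unᴴ * W * Vs * Matrix.diagonal (fun i => ((σ i : 𝕜))⁻¹)

/-- A basis of unit vectors, given as the columns of an invertible matrix. -/
def IsUnitBasis {d : ℕ} (Q : Matrix (Fin d) (Fin d) 𝕜) : Prop :=
  IsUnit Q.det ∧ ∀ j, ∑ i, ‖Q i j‖ ^ 2 = 1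

/-- Joint off-diagonal energy of the matrices `Q⁻¹ G_r Q`. -/
def offDiagonal {R d : ℕ} (G : Fin R → Matrix (Fin d) (Fin d) 𝕜)
    (Q : Matrix (Fin d) (Fin d) 𝕜) : ℝ :=
  ∑ r, ∑ i, ∑ j, if i = j then 0 else ‖(Q⁻¹ * G r * Q) i j‖ ^ 2

/-- Joint eigendecomposition of a family of square matrices: `Q` is a common basis of unit vectors
that makes the joint off-diagonal energy of `Q⁻¹ G_r Q` minimal up to the tolerance factor `c`
(`c = 1` is an exact minimizer). If the `G_r` can be diagonalized simultaneously, all `Q⁻¹ G_r Q`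
are exactly diagonal. -/
def IsJointEigenbasis {R d : ℕ} (c : ℝ) (G : Fin R → Matrix (Fin d) (Fin d) 𝕜)
    (Q : Matrix (Fin d) (Fin d) 𝕜) : Prop :=
  IsUnitBasis Q ∧ ∀ Q', IsUnitBasis Q' → offDiagonal G Q ≤ c * offDiagonal G Q'

end LinearAlgebra

/-! ### Data model -/

/-- The data of an `R`-dimensional harmonic retrieval problem with `d` strictly non-circular sources
and `N` snapshots. -/
structure Model (R d N : ℕ) where
  /-- number of sensors in each mode -/
  M : Fin R → ℕ
  /-- sampling grid in each mode -/
  grid : (r : Fin R) → Fin (M r) → ℝ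
  /-- number of selected sensors in each mode -/
  Msel : Fin R → ℕ
  /-- the sensors selected for the first subarray in each mode -/
  sel₁ : (r : Fin R) → Fin (Msel r) ↪ Fin (M r)
  /-- the sensors selected for the second subarray in each mode -/
  sel₂ : (r : Fin R) → Fin (Msel r) ↪ Fin (M r)
  /-- the spatial frequency of each source in each mode -/
  μ : Fin d → Fin R → ℝ
  /-- the rotation phase of each source -/
  rot : Fin d → ℝ
  /-- the real-valued symbols -/
  S₀ : Matrix (Fin d) (Fin N) ℝ

namespace Model

variable {R d N : ℕ} (m : Model R d N)

/-- Sensors of the `R`-dimensional array. -/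
abbrev Sensor : Type := (r : Fin R) → Fin (m.M r)

/-- Rows of the effective `r`-mode selection matrices: an index in every mode other than `r`, and
the number of a selected sensor in mode `r`. -/
abbrev Sub (r : Fin R) : Type := ((l : {l : Fin R // l ≠ r}) → Fin (m.M l)) × Fin (m.Msel r)

/-- The array steering matrix: its `i`-th column is the Kronecker product over `r` of the vectors
`exp (j k μ_i^(r))`, where `k` runs through the grid in mode `r`. -/
def steering : Matrix m.Sensor (Fin d) ℂ :=
  Matrix.of fun s i => ∏ r, Complex.exp (Complex.I * ((m.grid r (s r) * m.μ i r : ℝ) : ℂ))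

/-- `Ψ`, the diagonal matrix of the rotation phases. -/
def Psi : Matrix (Fin d) (Fin d) ℂ :=
  Matrix.diagonal fun i => Complex.exp (Complex.I * (m.rot i : ℂ))

/-- The strictly non-circular source symbols `S = Ψ S₀`. -/
def symbols : Matrix (Fin d) (Fin N) ℂ := m.Psi * m.S₀.map Complex.ofReal

/-- The observation `X = A S + W`. -/
def data (W : Matrix m.Sensor (Fin N) ℂ) : Matrix m.Sensor (Fin N) ℂ :=
  m.steering * m.symbols + W

/-- The augmented steering matrix `[A; Π A* Ψ* Ψ*]`. -/
def ncSteering : Matrix (m.Sensor ⊕ m.Sensor) (Fin d) ℂ :=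
  Matrix.fromRows m.steering (exchange m.Sensor * conj m.steering * conj m.Psi * conj m.Psi)

/-- `λ_i^(r) = exp (j μ_i^(r))`. -/
def lam (i : Fin d) (r : Fin R) : ℂ := Complex.exp (Complex.I * (m.μ i r : ℂ))

/-- `ω_i^(r) = tan (μ_i^(r) / 2)`. -/
def omega (i : Fin d) (r : Fin R) : ℝ := Real.tan (m.μ i r / 2)

/-- `I ⊗ J ⊗ I`, where `J` is the matrix in mode `r` selecting the sensors `sel`. -/
def selection (r : Fin R) (sel : Fin (m.Msel r) ↪ Fin (m.M r)) : Matrix (m.Sub r) m.Sensor ℂ :=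
  Matrix.of fun p s =>
    if s r = sel p.2 ∧ ∀ l : {l : Fin R // l ≠ r}, s l = p.1 l then 1 else 0

/-- Effective selection matrix of the first subarray in mode `r`. -/
def J₁ (r : Fin R) : Matrix (m.Sub r) m.Sensor ℂ := m.selection r (m.sel₁ r)

/-- Effective selection matrix of the second subarray in mode `r`. -/
def J₂ (r : Fin R) : Matrix (m.Sub r) m.Sensor ℂ := m.selection r (m.sel₂ r)

/-- The augmented selection matrix `blkdiag (J₁, Π J₂ Π)`. -/
def ncJ₁ (r : Fin R) : Matrix (m.Sub r ⊕ m.Sub r) (m.Sensor ⊕ m.Sensor) ℂ :=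
  Matrix.fromBlocks (m.J₁ r) 0 0 (exchange (m.Sub r) * m.J₂ r * exchange m.Sensor)

/-- The augmented selection matrix `blkdiag (J₂, Π J₁ Π)`. -/
def ncJ₂ (r : Fin R) : Matrix (m.Sub r ⊕ m.Sub r) (m.Sensor ⊕ m.Sensor) ℂ :=
  Matrix.fromBlocks (m.J₂ r) 0 0 (exchange (m.Sub r) * m.J₁ r * exchange m.Sensor)

/-- The real selection matrix `2 Re (Qᴴ J₂ Q)`, with the augmented `J₂`. -/
def K₁ (r : Fin R) : Matrix (m.Sub r ⊕ m.Sub r) (m.Sensor ⊕ m.Sensor) ℝ :=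
  ((leftReal (m.Sub r))ᴴ * m.ncJ₂ r * leftReal m.Sensor).map fun z => 2 * z.re

/-- The real selection matrix `2 Im (Qᴴ J₂ Q)`, with the augmented `J₂`. -/
def K₂ (r : Fin R) : Matrix (m.Sub r ⊕ m.Sub r) (m.Sensor ⊕ m.Sensor) ℝ :=
  ((leftReal (m.Sub r))ᴴ * m.ncJ₂ r * leftReal m.Sensor).map fun z => 2 * z.im

/-- The physical array is shift-invariant: `J₁ A Φ = J₂ A` in every mode. -/
def ShiftInvariant : Prop :=
  ∀ r, m.J₁ r * m.steering * Matrix.diagonal (fun i => m.lam i r) = m.J₂ r * m.steering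

/-- The size of the noise: the Frobenius norm of the augmented noise matrix. -/
def noiseSize (W : Matrix m.Sensor (Fin N) ℂ) : ℝ :=
  Real.sqrt (∑ s, ∑ n, ‖augment W s n‖ ^ 2)

/-! ### The two algorithms -/

/-- `μh` is an output of NC Standard ESPRIT when the signal subspace is estimated from `Y`:
dominant left singular vectors `U` of `Y`, least squares solutions `G_r` of `J₁ U G ≈ J₂ U`, their
joint eigendecomposition, and the arguments of the resulting eigenvalues. -/
def IsStandardEstimate (c : ℝ) {κ : Type*} [Fintype κ]
    (Y : Matrix (m.Sensor ⊕ m.Sensor) κ ℂ) (μh : Fin d → Fin R → ℝ) : Prop :=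
  ∃ (U : Matrix (m.Sensor ⊕ m.Sensor) (Fin d) ℂ) (G : Fin R → Matrix (Fin d) (Fin d) ℂ)
    (Q : Matrix (Fin d) (Fin d) ℂ),
    IsDominantLeft Y U ∧
    (∀ r, IsLeastSquares (m.ncJ₁ r * U) (m.ncJ₂ r * U) (G r)) ∧
    IsJointEigenbasis c G Q ∧
    ∀ i r, μh i r = Complex.arg ((Q⁻¹ * G r * Q) i i)

/-- `μh` is an output of NC Unitary ESPRIT for the observation `X`: real dominant left singular
vectors `E` of the real-valued transformed data, real least squares solutions of `K₁ E G ≈ K₂ E`,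
their joint eigendecomposition over the reals, and `2 arctan` of the resulting eigenvalues. -/
def IsUnitaryEstimate (c : ℝ) (X : Matrix m.Sensor (Fin N) ℂ) (μh : Fin d → Fin R → ℝ) : Prop :=
  ∃ (E : Matrix (m.Sensor ⊕ m.Sensor) (Fin d) ℝ) (G : Fin R → Matrix (Fin d) (Fin d) ℝ)
    (Q : Matrix (Fin d) (Fin d) ℝ),
    IsDominantLeft (realData X) E ∧
    (∀ r, IsLeastSquares (m.K₁ r * E) (m.K₂ r * E) (G r)) ∧
    IsJointEigenbasis c G Q ∧
    ∀ i r, μh i r = 2 * Real.arctan ((Q⁻¹ * G r * Q) i i)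

/-! ### The first-order error expansions -/

/-- The noise-free quantities in the expansion for NC Standard ESPRIT with forward-backward
averaging: an SVD of the averaged noise-free data, the pseudo inverses of `J₁ Us`, and a common
eigenvector matrix `Q` of the noise-free solutions `Γ_r = (J₁ Us)⁺ J₂ Us = Q Λ_r Q⁻¹`. -/
structure StandardExpansion where
  p : ℕ
  Us : Matrix (m.Sensor ⊕ m.Sensor) (Fin d) ℂ
  Un : Matrix (m.Sensor ⊕ m.Sensor) (Fin p) ℂ
  σ : Fin d → ℝ
  Vs : Matrix (Fin N ⊕ Fin N) (Fin d) ℂ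
  P : (r : Fin R) → Matrix (Fin d) (m.Sub r ⊕ m.Sub r) ℂ
  Q : Matrix (Fin d) (Fin d) ℂ
  svd : IsRankSVD (fba (augment (m.data 0))) Us Un σ Vs
  pinv : ∀ r, IsPinv (m.ncJ₁ r * Us) (P r)
  isUnit : IsUnit Q.det
  eigen : ∀ r, P r * (m.ncJ₂ r * Us) = Q * Matrix.diagonal (fun i => m.lam i r) * Q⁻¹

/-- The first-order error of NC Standard ESPRIT with forward-backward averaging,
`Im (p_iᵀ (J₁ Us)⁺ [J₂ / λ_i - J₁] ΔUs q_i)`, where `q_i` is the `i`-th column of `Q` and `p_iᵀ` the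
`i`-th row of `Q⁻¹`. -/
def StandardExpansion.firstOrder {m : Model R d N} (D : m.StandardExpansion)
    (W : Matrix m.Sensor (Fin N) ℂ) (i : Fin d) (r : Fin R) : ℝ :=
  ((D.Q⁻¹ * D.P r * ((m.lam i r)⁻¹ • m.ncJ₂ r - m.ncJ₁ r) *
    subspaceError D.Un D.σ D.Vs (fba (augment W)) * D.Q) i i).im

/-- The noise-free quantities in the expansion for NC Unitary ESPRIT: a real SVD of the transformed
noise-free data, the pseudo inverses of `K₁ Es`, and a common eigenvector matrix `V` of the
noise-free solutions `Υ_r = (K₁ Es)⁺ K₂ Es = V Ω_r V⁻¹`. -/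
structure UnitaryExpansion where
  p : ℕ
  Es : Matrix (m.Sensor ⊕ m.Sensor) (Fin d) ℝ
  En : Matrix (m.Sensor ⊕ m.Sensor) (Fin p) ℝ
  σ : Fin d → ℝ
  Ws : Matrix (Fin N ⊕ Fin N) (Fin d) ℝ
  P : (r : Fin R) → Matrix (Fin d) (m.Sub r ⊕ m.Sub r) ℝ
  V : Matrix (Fin d) (Fin d) ℝ
  svd : IsRankSVD (realData (m.data 0)) Es En σ Ws
  pinv : ∀ r, IsPinv (m.K₁ r * Es) (P r)
  isUnit : IsUnit V.det
  eigen : ∀ r, P r * (m.K₂ r * Es) = V * Matrix.diagonal (fun i => m.omega i r) * V⁻¹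

/-- The first-order error of NC Unitary ESPRIT,
`p_iᵀ (K₁ Es)⁺ [K₂ - ω_i K₁] ΔEs q_i · 2 / (ω_i² + 1)`, where `q_i` is the `i`-th column of `V` and
`p_iᵀ` the `i`-th row of `V⁻¹`. -/
def UnitaryExpansion.firstOrder {m : Model R d N} (D : m.UnitaryExpansion)
    (W : Matrix m.Sensor (Fin N) ℂ) (i : Fin d) (r : Fin R) : ℝ :=
  (D.V⁻¹ * D.P r * (m.K₂ r - m.omega i r • m.K₁ r) *
    subspaceError D.En D.σ D.Ws (realData W) * D.V) i i * (2 / (m.omega i r ^ 2 + 1))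

/-- An estimator, given by the set of its possible outputs for each noise matrix, has the first-order
error `L`: for all sufficiently small noise `W` it has an output, and every output, after one
relabelling of the sources that is common to all modes, differs from the true frequencies by
`L W + O(ν²)`, where `ν` is the size of the noise. -/
def HasFirstOrderError
    (est : Matrix m.Sensor (Fin N) ℂ → (Fin d → Fin R → ℝ) → Prop)
    (L : Matrix m.Sensor (Fin N) ℂ → Fin d → Fin R → ℝ) : Prop :=
  ∃ ε > 0, ∃ C : ℝ, ∀ W, m.noiseSize W < ε →
    (∃ μh, est W μh) ∧
    ∀ μh, est W μh → ∃ τ : Equiv.Perm (Fin d), ∀ i r,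
      |μh (τ i) r - m.μ i r - L W i r| ≤ C * m.noiseSize W ^ 2

end Model

end NCEsprit

end

open scoped Matrix

namespace NCEsprit

open scoped ComplexOrder Topology
open Filter Asymptotics

/-! ### Pseudo inverses and dominant singular vectors -/

section Algebra

variable {𝕜 : Type*} [RCLike 𝕜] {m n : Type*} [Fintype m] [Fintype n] {d : ℕ}

/-! Both kinds of algorithm are one scheme over an `RCLike` field. `IsShiftModel` records what the
scheme needs: Y = A S with A of full column rank and S of full row rank, J₁ A Λ_r = J₂ A with J₁ A
of full column rank, and jointly distinct eigenvalue tuples. The perturbation theory is proved once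
for this structure. It is then used over ℂ with the augmented steering matrix and λ, and over ℝ with
a real steering matrix, K₁, K₂ and ω.

Perturbation theory. The noisy dominant singular vectors U span, after a bounded invertible change
of basis, U_s + ΔU_s + O(ν²) (`IsRankSVD.subspace_expansion`). The least squares solutions are
therefore, in one frame T common to all modes, Λ_r + O(ν), and their diagonals have the expected
first-order terms (`leastSquares_expansion`, `IsShiftModel.exists_frame`). A joint
eigendecomposition has off-diagonal energy at most c times that of the normalized frame, hence
O(ν²). `approxDiag` shows that every unit basis of energy O(ν²) reproduces, up to one permutation,
the diagonals in the frame T up to O(ν²): each correction is a product of two O(ν) factors. Only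
joint distinctness is needed, since for any two sources some mode separates them. The same estimate
bounds the inverses of all competing bases, which gives compactness and hence the existence of a
minimizer. Finally arg = Im log and 2 arctan have quadratic Taylor remainders.

Uniform constants come from working along the filter `comap ν (𝓝 0)` on a type whose elements are
entire runs of the algorithm (noise, singular vectors, least squares solutions, basis). One
asymptotic statement there gives one ε and one C for all outputs.

Coincidence of the errors. `IsShiftModel.firstOrder_eq` brings the first-order term to a form free
of choices, a diagonal entry of (J₁A)⁺ M (1 - Y Y⁺) W Y⁺ A. The real model is the complex one up to
the unitary matrices Q and a diagonal column scaling. The Cayley transform ω = j(1-λ)/(1+λ) makes K₂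
- ω K₁ a multiple of the transformed J₂/λ - J₁. All scalar factors multiply to -j, and Re(-jz) = Im
z.

Forward-backward averaging is immaterial because an augmented matrix is already invariant under
conjugation followed by row exchange. Averaging only appends a column-reversed copy, which doubles Y
Yᴴ and keeps the dominant left singular vectors. -/

/-- A matrix with a left inverse has an invertible Gram matrix. -/
theorem isUnit_det_gram [DecidableEq n] {A : Matrix m n 𝕜} {L : Matrix n m 𝕜} (h : L * A = 1) :
    IsUnit (Aᴴ * A).det := by
  rw [isUnit_iff_ne_zero]
  intro h0
  obtain ⟨v, hv, hv0⟩ := Matrix.exists_mulVec_eq_zero_iff.mpr h0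
  have h1 : A *ᵥ v = 0 := by
    have : v ∈ LinearMap.ker (Aᴴ * A).mulVecLin := by simpa using hv0
    rw [Matrix.ker_mulVecLin_conjTranspose_mul_self] at this
    simpa using this
  apply hv
  have h2 : (L * A) *ᵥ v = 0 := by rw [← Matrix.mulVec_mulVec, h1, Matrix.mulVec_zero]
  simpa [h] using h2

theorem exists_left_inverse_of_rank {A : Matrix m (Fin d) 𝕜} (h : A.rank = d) :
    ∃ L : Matrix (Fin d) m 𝕜, L * A = 1 := by
  have h1 : IsUnit (Aᴴ * A) := by
    rw [Matrix.isUnit_iff_isUnit_det, isUnit_iff_ne_zero]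
    intro h0
    obtain ⟨v, hv, hv0⟩ := Matrix.exists_mulVec_eq_zero_iff.mpr h0
    have hr : (Aᴴ * A).rank = d := by rw [Matrix.rank_conjTranspose_mul_self, h]
    have hk := LinearMap.finrank_range_add_finrank_ker (Aᴴ * A).mulVecLin
    rw [Matrix.rank] at hr
    rw [hr] at hk
    simp only [Module.finrank_fintype_fun_eq_card, Fintype.card_fin] at hk
    have h2 : Module.finrank 𝕜 (LinearMap.ker (Aᴴ * A).mulVecLin) = 0 := by omega
    rw [Submodule.finrank_eq_zero] at h2
    have : v ∈ LinearMap.ker (Aᴴ * A).mulVecLin := by simpa using hv0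
    rw [h2] at this
    exact hv (by simpa using this)
  refine ⟨(Aᴴ * A)⁻¹ * Aᴴ, ?_⟩
  rw [Matrix.mul_assoc, Matrix.nonsing_inv_mul _ ((Matrix.isUnit_iff_isUnit_det _).mp h1)]

theorem exists_right_inverse_of_rank {A : Matrix (Fin d) m 𝕜} (h : A.rank = d) :
    ∃ L : Matrix m (Fin d) 𝕜, A * L = 1 := by
  obtain ⟨L, hL⟩ := exists_left_inverse_of_rank (A := Aᴴ)
    (by rw [Matrix.rank_conjTranspose, h])
  exact ⟨Lᴴ, by simpa using congrArg Matrix.conjTranspose hL⟩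

theorem le_card_of_left_inverse {A : Matrix m (Fin d) 𝕜} {L : Matrix (Fin d) m 𝕜}
    (h : L * A = 1) : d ≤ Fintype.card m := by
  have h1 := Matrix.rank_mul_le_right L A
  rw [h, Matrix.rank_one, Fintype.card_fin] at h1
  exact h1.trans (Matrix.rank_le_card_height A)

/-- The normal equations: take adjoints in B P B = B and use that B P is Hermitian. -/
theorem IsPinv.gram_mul {B : Matrix m n 𝕜} {P : Matrix n m 𝕜} (h : IsPinv B P) :
    Bᴴ * B * P = Bᴴ := by
  have h1 := congrArg Matrix.conjTranspose h.mul_mul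
  rw [Matrix.conjTranspose_mul, h.herm] at h1
  rw [Matrix.mul_assoc, h1]

/-- In full column rank the normal equations can be solved. The closed form makes P depend
continuously on B, which fails for pseudo inverses in general. -/
theorem IsPinv.eq_gram [DecidableEq n] {B : Matrix m n 𝕜} {P : Matrix n m 𝕜} (h : IsPinv B P)
    (hB : IsUnit (Bᴴ * B).det) : P = (Bᴴ * B)⁻¹ * Bᴴ := by
  calc P = (Bᴴ * B)⁻¹ * (Bᴴ * B * P) := by
        rw [← Matrix.mul_assoc, Matrix.nonsing_inv_mul _ hB, Matrix.one_mul]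
    _ = _ := by rw [h.gram_mul]

theorem isPinv_gram [DecidableEq n] {B : Matrix m n 𝕜} (hB : IsUnit (Bᴴ * B).det) :
    IsPinv B ((Bᴴ * B)⁻¹ * Bᴴ) := by
  have h1 : (Bᴴ * B)⁻¹ * Bᴴ * B = 1 := by rw [Matrix.mul_assoc, Matrix.nonsing_inv_mul _ hB]
  have h2 : (Bᴴ * B)ᴴ = Bᴴ * B := by simp
  refine ⟨by rw [Matrix.mul_assoc, h1, Matrix.mul_one], by rw [h1, Matrix.one_mul], ?_, ?_⟩
  · rw [Matrix.conjTranspose_mul, Matrix.conjTranspose_mul, Matrix.conjTranspose_nonsing_inv, h2,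
      Matrix.conjTranspose_conjTranspose, Matrix.mul_assoc]
  · rw [h1, Matrix.conjTranspose_one]

theorem IsPinv.mul_eq_one [DecidableEq n] {B : Matrix m n 𝕜} {P L : Matrix n m 𝕜} (h : IsPinv B P)
    (hL : L * B = 1) : P * B = 1 := by
  have h1 := congrArg (L * ·) h.mul_mul
  simp only [← Matrix.mul_assoc] at h1
  rw [hL, Matrix.one_mul] at h1
  exact h1

/-- B P and B P' are the same orthogonal projector onto the range of B, and P B and P' B agree
likewise. Later computations of pseudo inverses exhibit a candidate and appeal to this. -/
theorem IsPinv.unique {B : Matrix m n 𝕜} {P P' : Matrix n m 𝕜} (h : IsPinv B P)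
    (h' : IsPinv B P') : P = P' := by
  have e1 : B * P = B * P' := by
    rw [← h.herm, Matrix.conjTranspose_mul]
    have := congrArg (Pᴴ * ·) h'.gram_mul
    simp only [← Matrix.mul_assoc] at this
    rw [← this, ← Matrix.conjTranspose_mul, h.herm, h.mul_mul]
  have e2 : P * B = P' * B := by
    have h3 : P' * B * Bᴴ = Bᴴ := by
      rw [← h'.herm', ← Matrix.conjTranspose_mul, ← Matrix.mul_assoc, h'.mul_mul]
    have h4 : Bᴴ * Pᴴ = P * B := by rw [← Matrix.conjTranspose_mul, h.herm']
    rw [← h4]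
    conv_lhs => rw [← h3]
    rw [Matrix.mul_assoc, h4, Matrix.mul_assoc, ← Matrix.mul_assoc B, h.mul_mul]
  rw [← h.mul_mul', e2, Matrix.mul_assoc, e1, ← Matrix.mul_assoc, h'.mul_mul']

theorem sum_norm_sq_eq (v : n → 𝕜) :
    ((∑ k, ‖v k‖ ^ 2 : ℝ) : 𝕜) = star v ⬝ᵥ v := by
  simp [dotProduct, RCLike.conj_mul]

theorem sum_norm_sq_mulVec (B : Matrix m n 𝕜) (v : n → 𝕜) :
    ((∑ k, ‖(B *ᵥ v) k‖ ^ 2 : ℝ) : 𝕜) = star v ⬝ᵥ ((Bᴴ * B) *ᵥ v) := by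
  rw [sum_norm_sq_eq, Matrix.star_mulVec, ← Matrix.dotProduct_mulVec, Matrix.mulVec_mulVec]

theorem sum_norm_sq_mulVec_le (B : Matrix m n 𝕜) (v : n → 𝕜) :
    ∑ k, ‖(B *ᵥ v) k‖ ^ 2 ≤ (∑ k, ∑ j, ‖B k j‖ ^ 2) * ∑ j, ‖v j‖ ^ 2 := by
  rw [Finset.sum_mul]
  refine Finset.sum_le_sum fun k _ => ?_
  calc ‖(B *ᵥ v) k‖ ^ 2 ≤ (∑ j, ‖B k j‖ * ‖v j‖) ^ 2 := by
        refine pow_le_pow_left₀ (norm_nonneg _) ?_ 2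
        simp only [Matrix.mulVec, dotProduct]
        exact (norm_sum_le _ _).trans (by simp)
    _ ≤ _ := Finset.sum_mul_sq_le_sq_mul_sq _ _ _

/-- The image of a vector decomposed along dominant left singular vectors. -/
theorem exists_vector_bound [DecidableEq m] {Y : Matrix m n 𝕜} {U : Matrix m (Fin d) 𝕜}
    {σ : Fin d → ℝ} (hU : Uᴴ * U = 1)
    (hE : Y * Yᴴ * U = U * Matrix.diagonal (fun i => ((σ i ^ 2 : ℝ) : 𝕜)))
    (hdom : ∀ w : m → 𝕜, Uᴴ *ᵥ w = 0 →
      ∀ i, ∑ j, ‖(Yᴴ *ᵥ w) j‖ ^ 2 ≤ σ i ^ 2 * ∑ k, ‖w k‖ ^ 2)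
    (A : Matrix m (Fin d) 𝕜) (i : Fin d) :
    ∃ c : Fin d → 𝕜, c ≠ 0 ∧
      ∑ j, ‖((Yᴴ * A) *ᵥ c) j‖ ^ 2 ≤ σ i ^ 2 * ∑ k, ‖(A *ᵥ c) k‖ ^ 2 := by
  -- Zeroing row i makes the square matrix singular. A kernel vector c then has all coordinates of
  -- Uᴴ A c zero except possibly the i-th, so A c is a multiple of the i-th singular vector plus a
  -- part orthogonal to U.
  set N : Matrix (Fin d) (Fin d) 𝕜 := (Uᴴ * A).updateRow i 0 with hN
  have hdet : N.det = 0 := Matrix.det_eq_zero_of_row_eq_zero i (by simp [hN])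
  obtain ⟨c, hc, hc0⟩ := Matrix.exists_mulVec_eq_zero_iff.mpr hdet
  refine ⟨c, hc, ?_⟩
  set w := A *ᵥ c with hw
  set a : 𝕜 := (Uᴴ *ᵥ w) i with ha
  set e : Fin d → 𝕜 := Pi.single i a with he
  have hUw : Uᴴ *ᵥ w = e := by
    ext j
    by_cases hj : j = i
    · subst hj; simp [he, ha]
    · have := congrFun hc0 j
      rw [hN] at this
      simp only [Matrix.mulVec, Matrix.updateRow_ne hj, Pi.zero_apply] at this
      rw [he, Pi.single_eq_of_ne hj, hw, Matrix.mulVec_mulVec]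
      exact this
  set w' := w - U *ᵥ e with hw'
  have hUw' : Uᴴ *ᵥ w' = 0 := by
    rw [hw', Matrix.mulVec_sub, hUw, Matrix.mulVec_mulVec, hU, Matrix.one_mulVec, sub_self]
  have hwe : w = w' + U *ᵥ e := by rw [hw']; abel
  have hSe : Matrix.diagonal (fun i => ((σ i ^ 2 : ℝ) : 𝕜)) *ᵥ e = ((σ i ^ 2 : ℝ) : 𝕜) • e := by
    ext j
    rw [Matrix.mulVec_diagonal]
    by_cases hj : j = i
    · subst hj; simp
    · simp [he, hj]
  have hcross : star w' ⬝ᵥ (U *ᵥ e) = 0 := by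
    rw [Matrix.dotProduct_mulVec]
    have : star w' ᵥ* U = 0 := by
      have := congrArg star hUw'
      rwa [Matrix.star_mulVec, Matrix.conjTranspose_conjTranspose, star_zero] at this
    rw [this, zero_dotProduct]
  have hcross' : star (U *ᵥ e) ⬝ᵥ w' = 0 := by
    rw [Matrix.star_dotProduct, hcross, star_zero]
  have hHe : (Y * Yᴴ) *ᵥ (U *ᵥ e) = ((σ i ^ 2 : ℝ) : 𝕜) • (U *ᵥ e) := by
    rw [Matrix.mulVec_mulVec, hE, ← Matrix.mulVec_mulVec, hSe, Matrix.mulVec_smul]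
  have hHe' : star (U *ᵥ e) ⬝ᵥ ((Y * Yᴴ) *ᵥ w') = 0 := by
    have : star ((Y * Yᴴ) *ᵥ (U *ᵥ e)) ⬝ᵥ w' = 0 := by
      rw [hHe, star_smul, smul_dotProduct, hcross', smul_zero]
    rw [Matrix.star_mulVec, ← Matrix.dotProduct_mulVec] at this
    simpa using this
  -- U e is an eigenvector of Y Yᴴ for σ_i² and orthogonal to w', so the cross terms vanish. The
  -- dominance hypothesis for w' then gives the bound for the sum.
  have key : ∑ j, ‖(Yᴴ *ᵥ w) j‖ ^ 2 = ∑ j, ‖(Yᴴ *ᵥ w') j‖ ^ 2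
      + σ i ^ 2 * ∑ k, ‖(U *ᵥ e) k‖ ^ 2 := by
    apply RCLike.ofReal_injective (K := 𝕜)
    rw [RCLike.ofReal_add, RCLike.ofReal_mul, sum_norm_sq_mulVec, sum_norm_sq_mulVec,
      sum_norm_sq_eq, Matrix.conjTranspose_conjTranspose]
    conv_lhs => rw [hwe]
    rw [Matrix.mulVec_add, star_add, add_dotProduct, dotProduct_add, dotProduct_add, hHe, hHe',
      dotProduct_smul, dotProduct_smul, hcross]
    simp
  have key2 : ∑ j, ‖w j‖ ^ 2 = ∑ j, ‖w' j‖ ^ 2 + ∑ k, ‖(U *ᵥ e) k‖ ^ 2 := by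
    apply RCLike.ofReal_injective (K := 𝕜)
    rw [RCLike.ofReal_add, sum_norm_sq_eq, sum_norm_sq_eq, sum_norm_sq_eq]
    conv_lhs => rw [hwe]
    rw [star_add, add_dotProduct, dotProduct_add, dotProduct_add, hcross, hcross']
    simp
  have := hdom w' hUw' i
  rw [← Matrix.mulVec_mulVec, key, key2]
  linarith

/-- Lower bound for the dominant singular values. -/
theorem one_le_mul_sq_singularValue [DecidableEq m] {Y : Matrix m n 𝕜} {U : Matrix m (Fin d) 𝕜}
    {σ : Fin d → ℝ} (hU : Uᴴ * U = 1)
    (hE : Y * Yᴴ * U = U * Matrix.diagonal (fun i => ((σ i ^ 2 : ℝ) : 𝕜)))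
    (hdom : ∀ w : m → 𝕜, Uᴴ *ᵥ w = 0 →
      ∀ i, ∑ j, ‖(Yᴴ *ᵥ w) j‖ ^ 2 ≤ σ i ^ 2 * ∑ k, ‖w k‖ ^ 2)
    {A : Matrix m (Fin d) 𝕜} {X : Matrix (Fin d) n 𝕜} (hX : X * (Yᴴ * A) = 1) (i : Fin d) :
    1 ≤ (∑ k, ∑ j, ‖X k j‖ ^ 2) * σ i ^ 2 * ∑ k, ∑ j, ‖A k j‖ ^ 2 := by
  obtain ⟨c, hc, hle⟩ := exists_vector_bound hU hE hdom A i
  have h1 : ∑ j, ‖c j‖ ^ 2 ≤ (∑ k, ∑ j, ‖X k j‖ ^ 2) * ∑ j, ‖((Yᴴ * A) *ᵥ c) j‖ ^ 2 := by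
    have := sum_norm_sq_mulVec_le X ((Yᴴ * A) *ᵥ c)
    rwa [Matrix.mulVec_mulVec, hX, Matrix.one_mulVec] at this
  have h2 := sum_norm_sq_mulVec_le A c
  have hpos : 0 < ∑ j, ‖c j‖ ^ 2 := by
    obtain ⟨j, hj⟩ := Function.ne_iff.mp hc
    exact Finset.sum_pos' (fun _ _ => by positivity)
      ⟨j, Finset.mem_univ _, by have := norm_pos_iff.mpr hj; positivity⟩
  have hX0 : 0 ≤ ∑ k, ∑ j, ‖X k j‖ ^ 2 := by positivity
  have h3 : ∑ j, ‖c j‖ ^ 2 ≤ ((∑ k, ∑ j, ‖X k j‖ ^ 2) * σ i ^ 2 * ∑ k, ∑ j, ‖A k j‖ ^ 2)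
      * ∑ j, ‖c j‖ ^ 2 := by
    -- X inverts Yᴴ A from the left, so c is controlled by Yᴴ A c, then by σ_i A c, then by c again.
    -- Since c ≠ 0, the product of the constants is at least 1.
    calc _ ≤ _ := h1
      _ ≤ (∑ k, ∑ j, ‖X k j‖ ^ 2) * (σ i ^ 2 * ((∑ k, ∑ j, ‖A k j‖ ^ 2) * ∑ j, ‖c j‖ ^ 2)) := by
        gcongr
        exact hle.trans (by gcongr)
      _ = _ := by ring
  by_contra hlt
  push Not at hlt
  nlinarith

/-- Dominant left singular vectors exist, together with an orthonormal basis of the orthogonal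
complement of their span. -/
theorem exists_isDominantLeft [DecidableEq m] (Y : Matrix m n 𝕜) (hd : d ≤ Fintype.card m) :
    ∃ (p : ℕ) (U : Matrix m (Fin d) 𝕜) (Un : Matrix m (Fin p) 𝕜), IsDominantLeft Y U ∧
      Unᴴ * Un = 1 ∧ Uᴴ * Un = 0 ∧ U * Uᴴ + Un * Unᴴ = 1 := by
  have hH : (Y * Yᴴ).IsHermitian := Matrix.isHermitian_mul_conjTranspose_self Y
  have hpsd : (Y * Yᴴ).PosSemidef := Matrix.posSemidef_self_mul_conjTranspose Y
  obtain ⟨p, hp⟩ := Nat.exists_eq_add_of_le hd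
  -- This is the enumeration inside Mathlib's `eigenvalues`, in which they decrease. The `inl`
  -- indices of `e` therefore carry the d largest ones.
  let e0 : Fin (Fintype.card m) ≃ m := Fintype.equivOfCardEq (Fintype.card_fin _)
  let e : Fin d ⊕ Fin p ≃ m := finSumFinEquiv.trans ((finCongr hp.symm).trans e0)
  let V : Matrix m m 𝕜 := hH.eigenvectorUnitary
  have hV1 : Vᴴ * V = 1 := Unitary.coe_star_mul_self hH.eigenvectorUnitary
  have hV2 : V * Vᴴ = 1 := Unitary.coe_mul_star_self hH.eigenvectorUnitary
  let f : m → ℝ := hH.eigenvalues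
  have hf0 : ∀ k, 0 ≤ f k := hpsd.eigenvalues_nonneg
  have hspec : Y * Yᴴ = V * Matrix.diagonal (fun k => (f k : 𝕜)) * Vᴴ := by
    have := hH.spectral_theorem
    rw [Unitary.conjStarAlgAut_apply] at this
    exact this
  have hmono : ∀ i k, f (e (Sum.inr k)) ≤ f (e (Sum.inl i)) := by
    intro i k
    simp only [f, Matrix.IsHermitian.eigenvalues]
    apply hH.eigenvalues₀_antitone
    simp only [e, Equiv.trans_apply, e0, Equiv.symm_apply_apply]
    rw [Fin.le_def]
    simp
    omega
  let W : Matrix m (Fin d ⊕ Fin p) 𝕜 := V.submatrix id e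
  have hW1 : Wᴴ * W = 1 := by
    simp only [W, Matrix.conjTranspose_submatrix]
    rw [Matrix.submatrix_mul _ _ e id e Function.bijective_id |>.symm, hV1]
    simp
  have hW2 : W * Wᴴ = 1 := by
    simp only [W, Matrix.conjTranspose_submatrix]
    rw [Matrix.submatrix_mul _ _ id e id e.bijective |>.symm, hV2]
    simp
  have hWs : Y * Yᴴ = W * Matrix.diagonal (fun k => (f (e k) : 𝕜)) * Wᴴ := by
    rw [hspec]
    have : Matrix.diagonal (fun k => (f (e k) : 𝕜))
        = (Matrix.diagonal (fun k => (f k : 𝕜))).submatrix e e := by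
      rw [Matrix.submatrix_diagonal_equiv]; rfl
    simp only [W, Matrix.conjTranspose_submatrix]
    rw [this, Matrix.submatrix_mul _ _ id e e e.bijective |>.symm,
      Matrix.submatrix_mul _ _ id e id e.bijective |>.symm, Matrix.submatrix_id_id]
  have hWc : W = Matrix.fromCols W.toCols₁ W.toCols₂ := (Matrix.fromCols_toCols W).symm
  set U := W.toCols₁ with hU
  set Un := W.toCols₂ with hUn
  rw [hWc, Matrix.conjTranspose_fromCols_eq_fromRows_conjTranspose, Matrix.fromRows_mul_fromCols,
    ← Matrix.fromBlocks_one, Matrix.fromBlocks_inj] at hW1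
  rw [hWc, Matrix.conjTranspose_fromCols_eq_fromRows_conjTranspose,
    Matrix.fromCols_mul_fromRows] at hW2
  obtain ⟨h11, h12, h21, h22⟩ := hW1
  let σ : Fin d → ℝ := fun i => Real.sqrt (f (e (Sum.inl i)))
  have hσ : ∀ i, σ i ^ 2 = f (e (Sum.inl i)) := fun i => Real.sq_sqrt (hf0 _)
  refine ⟨p, U, Un, ⟨h11, σ, fun i => Real.sqrt_nonneg _, ?_, ?_⟩, h22, h12, hW2⟩
  · have h1 : Y * Yᴴ * W = W * Matrix.diagonal (fun k => (f (e k) : 𝕜)) := by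
      have hW1' : Wᴴ * W = 1 := by
        rw [hWc, Matrix.conjTranspose_fromCols_eq_fromRows_conjTranspose,
          Matrix.fromRows_mul_fromCols, h11, h12, h21, h22, Matrix.fromBlocks_one]
      rw [hWs, Matrix.mul_assoc, hW1', Matrix.mul_one]
    ext a i
    have := congrFun (congrFun h1 a) (Sum.inl i)
    rw [Matrix.mul_diagonal] at this ⊢
    rw [hσ]
    exact this
  · intro w hw i
    set b := Wᴴ *ᵥ w with hb
    have hb0 : ∀ j, b (Sum.inl j) = 0 := fun j => congrFun hw j
    have hn : ∑ k, ‖w k‖ ^ 2 = ∑ k, ‖b k‖ ^ 2 := by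
      apply RCLike.ofReal_injective (K := 𝕜)
      rw [hb, sum_norm_sq_mulVec, sum_norm_sq_eq, Matrix.conjTranspose_conjTranspose]
      have hW2' : W * Wᴴ = 1 := by
        rw [hWc, Matrix.conjTranspose_fromCols_eq_fromRows_conjTranspose,
          Matrix.fromCols_mul_fromRows, hW2]
      rw [hW2', Matrix.one_mulVec]
    have hq : ∑ j, ‖(Yᴴ *ᵥ w) j‖ ^ 2 = ∑ k, f (e k) * ‖b k‖ ^ 2 := by
      apply RCLike.ofReal_injective (K := 𝕜)
      rw [sum_norm_sq_mulVec, Matrix.conjTranspose_conjTranspose, hWs, ← Matrix.mulVec_mulVec,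
        ← Matrix.mulVec_mulVec, ← hb, Matrix.dotProduct_mulVec]
      have : star w ᵥ* W = star b := by rw [hb, Matrix.star_mulVec]; simp
      rw [this]
      simp only [dotProduct, Matrix.mulVec_diagonal, Pi.star_apply, RCLike.star_def]
      push_cast
      refine Finset.sum_congr rfl fun k _ => ?_
      rw [← RCLike.conj_mul]; ring
    rw [hn, hq, hσ, Fintype.sum_sum_type, Fintype.sum_sum_type, mul_add, Finset.mul_sum,
      Finset.mul_sum]
    refine add_le_add ?_ ?_
    · simp [hb0]
    · exact Finset.sum_le_sum fun k _ => by gcongr; exact hmono i k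

end Algebra

/-! ### The abstract noise-free model and its choice-free first-order term -/

section ShiftModel

variable {𝕜 : Type*} [RCLike 𝕜] {m n : Type*} [Fintype m] [DecidableEq m] [Fintype n] {R d p : ℕ}
  {s : Fin R → Type*} [∀ r, Fintype (s r)]

/-- A noise-free data matrix `Y = A S` with `A` of full column rank and `S` of full row rank, and
selection matrices for which `A` is shift invariant with jointly distinct eigenvalues. -/
structure IsShiftModel (Y : Matrix m n 𝕜) (A : Matrix m (Fin d) 𝕜)
    (J₁ J₂ : (r : Fin R) → Matrix (s r) m 𝕜) (lam : Fin d → Fin R → 𝕜) : Prop where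
  factor : ∃ (S : Matrix (Fin d) n 𝕜) (X : Matrix n (Fin d) 𝕜), Y = A * S ∧ S * X = 1
  left_inv : ∃ L : Matrix (Fin d) m 𝕜, L * A = 1
  left_inv_sub : ∀ r, ∃ L : Matrix (Fin d) (s r) 𝕜, L * (J₁ r * A) = 1
  shift : ∀ r, J₁ r * A * Matrix.diagonal (fun i => lam i r) = J₂ r * A
  distinct : Function.Injective lam

variable {Y : Matrix m n 𝕜} {A : Matrix m (Fin d) 𝕜}
  {J₁ J₂ : (r : Fin R) → Matrix (s r) m 𝕜} {lam : Fin d → Fin R → 𝕜}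

theorem diagonal_ofReal_mul_inv {σ : Fin d → ℝ} (hσ : ∀ i, σ i ≠ 0) :
    Matrix.diagonal (fun i => (σ i : 𝕜)) * Matrix.diagonal (fun i => (σ i : 𝕜)⁻¹) = 1 := by
  rw [Matrix.diagonal_mul_diagonal, ← Matrix.diagonal_one]
  congr 1; ext i
  exact mul_inv_cancel₀ (by simpa using hσ i)

theorem diagonal_ofReal_inv_mul {σ : Fin d → ℝ} (hσ : ∀ i, σ i ≠ 0) :
    Matrix.diagonal (fun i => (σ i : 𝕜)⁻¹) * Matrix.diagonal (fun i => (σ i : 𝕜)) = 1 := by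
  rw [mul_eq_one_comm]; exact diagonal_ofReal_mul_inv hσ

theorem IsShiftModel.exists_isRankSVD (h : IsShiftModel Y A J₁ J₂ lam) :
    ∃ (p : ℕ) (Us : Matrix m (Fin d) 𝕜) (Un : Matrix m (Fin p) 𝕜) (σ : Fin d → ℝ)
      (Vs : Matrix n (Fin d) 𝕜), IsRankSVD Y Us Un σ Vs := by
  obtain ⟨L, hL⟩ := h.left_inv
  obtain ⟨S, X, hY, hS⟩ := h.factor
  obtain ⟨p, U, Un, ⟨hU, σ, hσ0, hE, hdom⟩, hn, hUn, hc⟩ :=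
    exists_isDominantLeft (d := d) Y (le_card_of_left_inverse hL)
  have hgram := isUnit_det_gram hL
  -- Yᴴ A = Sᴴ (Aᴴ A) has an explicit left inverse, which forces all d dominant singular values to
  -- be nonzero.
  have hX : ((Aᴴ * A)⁻¹ * Xᴴ) * (Yᴴ * A) = 1 := by
    have : Xᴴ * Sᴴ = 1 := by simpa using congrArg Matrix.conjTranspose hS
    calc ((Aᴴ * A)⁻¹ * Xᴴ) * (Yᴴ * A) = (Aᴴ * A)⁻¹ * ((Xᴴ * Sᴴ) * (Aᴴ * A)) := by
          rw [hY, Matrix.conjTranspose_mul]; simp only [Matrix.mul_assoc]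
      _ = 1 := by rw [this, Matrix.one_mul, Matrix.nonsing_inv_mul _ hgram]
  have hσ : ∀ i, σ i ≠ 0 := by
    intro i h0
    have := one_le_mul_sq_singularValue hU hE hdom hX i
    rw [h0] at this
    norm_num at this
  have hσ' : ∀ i, 0 < σ i := fun i => lt_of_le_of_ne (hσ0 i) (hσ i).symm
  set Si := Matrix.diagonal (fun i => (σ i : 𝕜)⁻¹) with hSi
  set Sg := Matrix.diagonal (fun i => (σ i : 𝕜)) with hSg
  have i1 : Sg * Si = 1 := diagonal_ofReal_mul_inv hσ
  have i2 : Si * Sg = 1 := diagonal_ofReal_inv_mul hσ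
  have hS2 : Matrix.diagonal (fun i => ((σ i ^ 2 : ℝ) : 𝕜)) = Sg * Sg := by
    rw [hSg, Matrix.diagonal_mul_diagonal]; congr 1; ext i; push_cast; ring
  rw [hS2] at hE
  have hSiH : Siᴴ = Si := by
    rw [hSi, Matrix.diagonal_conjTranspose]; congr 1; ext i; simp
  -- From Y Yᴴ U = U Σ² one gets U = Y Yᴴ U Σ⁻², so the columns of U lie in the range of A. By
  -- dimension they span it, and U Uᴴ fixes Y.
  have hUA : U = A * (S * Yᴴ * U * Si * Si) := by
    calc U = U * (Sg * (Sg * Si) * Si) := by rw [i1, Matrix.mul_one, i1, Matrix.mul_one]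
      _ = (U * (Sg * Sg)) * Si * Si := by simp only [Matrix.mul_assoc]
      _ = Y * Yᴴ * U * Si * Si := by rw [hE]
      _ = A * S * Yᴴ * U * Si * Si := by rw [← hY]
      _ = _ := by simp only [Matrix.mul_assoc]
  set C := S * Yᴴ * U * Si * Si with hC
  have hC1 : (Uᴴ * A) * C = 1 := by rw [Matrix.mul_assoc, ← hUA, hU]
  have hC2 : C * (Uᴴ * A) = 1 := by rw [mul_eq_one_comm]; exact hC1
  have hUUA : U * Uᴴ * A = A := by
    calc U * Uᴴ * A = A * (C * (Uᴴ * A)) := by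
          conv_lhs => rw [Matrix.mul_assoc]; arg 1; rw [hUA]
          rw [Matrix.mul_assoc]
      _ = A := by rw [hC2, Matrix.mul_one]
  refine ⟨p, U, Un, σ, Yᴴ * U * Si, hU, hn, hUn, hc, ?_, hσ', ?_⟩
  · rw [Matrix.conjTranspose_mul, Matrix.conjTranspose_mul, hSiH, Matrix.conjTranspose_conjTranspose]
    calc Si * (Uᴴ * Y) * (Yᴴ * U * Si) = Si * (Uᴴ * (Y * Yᴴ * U)) * Si := by
          simp only [Matrix.mul_assoc]
      _ = (Si * Sg) * (Sg * Si) := by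
          rw [hE, ← Matrix.mul_assoc Uᴴ, hU, Matrix.one_mul]; simp only [Matrix.mul_assoc]
      _ = 1 := by rw [i1, i2, Matrix.one_mul]
  · rw [Matrix.conjTranspose_mul, Matrix.conjTranspose_mul, hSiH, Matrix.conjTranspose_conjTranspose]
    calc Y = U * Uᴴ * Y := by rw [hY, ← Matrix.mul_assoc, hUUA]
      _ = U * (Sg * Si) * (Uᴴ * Y) := by rw [i1, Matrix.mul_one, Matrix.mul_assoc]
      _ = U * Sg * (Si * (Uᴴ * Y)) := by simp only [Matrix.mul_assoc]

variable {Us : Matrix m (Fin d) 𝕜} {Un : Matrix m (Fin p) 𝕜} {σ : Fin d → ℝ}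
  {Vs : Matrix n (Fin d) 𝕜}

theorem IsRankSVD.isPinv (hsvd : IsRankSVD Y Us Un σ Vs) :
    IsPinv Y (Vs * Matrix.diagonal (fun i => (σ i : 𝕜)⁻¹) * Usᴴ) := by
  set Si := Matrix.diagonal (fun i => (σ i : 𝕜)⁻¹) with hSi
  set Sg := Matrix.diagonal (fun i => (σ i : 𝕜)) with hSg
  have i1 : Sg * Si = 1 := diagonal_ofReal_mul_inv fun i => (hsvd.pos i).ne'
  have i2 : Si * Sg = 1 := diagonal_ofReal_inv_mul fun i => (hsvd.pos i).ne'
  have e1 : Y * (Vs * Si * Usᴴ) = Us * Usᴴ := by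
    calc Y * (Vs * Si * Usᴴ) = Us * (Sg * (Vsᴴ * Vs) * Si) * Usᴴ := by
          rw [hsvd.eq]; simp only [Matrix.mul_assoc]; rfl
      _ = _ := by rw [hsvd.orthonormal_v, Matrix.mul_one, i1, Matrix.mul_one]
  have e2 : Vs * Si * Usᴴ * Y = Vs * Vsᴴ := by
    calc Vs * Si * Usᴴ * Y = Vs * (Si * (Usᴴ * Us) * Sg) * Vsᴴ := by
          rw [hsvd.eq]; simp only [Matrix.mul_assoc]; rfl
      _ = _ := by rw [hsvd.orthonormal_s, Matrix.mul_one, i2, Matrix.mul_one]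
  refine ⟨?_, ?_, ?_, ?_⟩
  · rw [e1]
    conv_lhs => rw [hsvd.eq]
    rw [← Matrix.mul_assoc, ← Matrix.mul_assoc, Matrix.mul_assoc Us, hsvd.orthonormal_s,
      Matrix.mul_one, ← hsvd.eq]
  · rw [e2, ← Matrix.mul_assoc, ← Matrix.mul_assoc, Matrix.mul_assoc Vs, hsvd.orthonormal_v,
      Matrix.mul_one]
  · rw [e1]; simp
  · rw [e2]; simp

/-- Y Y⁺ is the projector onto the signal subspace, so the noise projector depends on Y alone and
not on the chosen decomposition. -/
theorem IsRankSVD.mul_pinv (hsvd : IsRankSVD Y Us Un σ Vs) {Yp : Matrix n m 𝕜}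
    (hYp : IsPinv Y Yp) : Un * Unᴴ = 1 - Y * Yp := by
  have e1 : Y * Yp = Us * Usᴴ := by
    rw [hYp.unique hsvd.isPinv]
    calc _ = Us * (Matrix.diagonal (fun i => (σ i : 𝕜)) * (Vsᴴ * Vs) *
          Matrix.diagonal (fun i => (σ i : 𝕜)⁻¹)) * Usᴴ := by
          conv_lhs => rw [hsvd.eq]
          simp only [Matrix.mul_assoc]
      _ = _ := by rw [hsvd.orthonormal_v, Matrix.mul_one,
                    diagonal_ofReal_mul_inv fun i => (hsvd.pos i).ne', Matrix.mul_one]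
  rw [e1, ← hsvd.complete]; abel

/-- U_s = Y V_s Σ⁻¹ = A (S V_s Σ⁻¹), and Usᴴ A is the inverse of the square factor, so U_s and A
span the same space. -/
theorem IsShiftModel.exists_basis (h : IsShiftModel Y A J₁ J₂ lam)
    (hsvd : IsRankSVD Y Us Un σ Vs) :
    ∃ C C' : Matrix (Fin d) (Fin d) 𝕜, C * C' = 1 ∧ C' * C = 1 ∧ Us = A * C := by
  obtain ⟨S, X, hY, hS⟩ := h.factor
  have hUA : Us = A * (S * Vs * Matrix.diagonal (fun i => (σ i : 𝕜)⁻¹)) := by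
    calc Us = Us * (Matrix.diagonal (fun i => (σ i : 𝕜)) * (Vsᴴ * Vs) *
          Matrix.diagonal (fun i => (σ i : 𝕜)⁻¹)) := by
          rw [hsvd.orthonormal_v, Matrix.mul_one,
            diagonal_ofReal_mul_inv fun i => (hsvd.pos i).ne', Matrix.mul_one]
      _ = (Us * Matrix.diagonal (fun i => (σ i : 𝕜)) * Vsᴴ) * Vs *
          Matrix.diagonal (fun i => (σ i : 𝕜)⁻¹) := by simp only [Matrix.mul_assoc]
      _ = _ := by rw [← hsvd.eq, hY]; simp only [Matrix.mul_assoc]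
  have hC1 : (Usᴴ * A) * (S * Vs * Matrix.diagonal (fun i => (σ i : 𝕜)⁻¹)) = 1 := by
    rw [Matrix.mul_assoc, ← hUA, hsvd.orthonormal_s]
  exact ⟨_, _, mul_eq_one_comm.mp hC1, hC1, hUA⟩

theorem IsShiftModel.left_inv_subspace (h : IsShiftModel Y A J₁ J₂ lam)
    (hsvd : IsRankSVD Y Us Un σ Vs) (r : Fin R) :
    ∃ L : Matrix (Fin d) (s r) 𝕜, L * (J₁ r * Us) = 1 := by
  obtain ⟨C, C', h1, h2, hU⟩ := h.exists_basis hsvd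
  obtain ⟨L, hL⟩ := h.left_inv_sub r
  refine ⟨C' * L, ?_⟩
  calc C' * L * (J₁ r * Us) = C' * (L * (J₁ r * A)) * C := by
        rw [hU]; simp only [Matrix.mul_assoc]
    _ = 1 := by rw [hL, Matrix.mul_one, h2]

theorem IsShiftModel.exists_isPinv (h : IsShiftModel Y A J₁ J₂ lam)
    (hsvd : IsRankSVD Y Us Un σ Vs) (r : Fin R) :
    ∃ P : Matrix (Fin d) (s r) 𝕜, IsPinv (J₁ r * Us) P := by
  obtain ⟨L, hL⟩ := h.left_inv_subspace hsvd r
  exact ⟨_, isPinv_gram (isUnit_det_gram hL)⟩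

/-- Shift invariance turns J₂ U_s into J₁ U_s C⁻¹ Λ C, and P cancels J₁ U_s. The eigenvector matrix
C⁻¹ is the same in every mode. -/
theorem IsShiftModel.pinv_mul (h : IsShiftModel Y A J₁ J₂ lam) {r : Fin R}
    {C C' : Matrix (Fin d) (Fin d) 𝕜} (hC : C * C' = 1) (hU : Us = A * C)
    (hsvd : IsRankSVD Y Us Un σ Vs) {P : Matrix (Fin d) (s r) 𝕜} (hP : IsPinv (J₁ r * Us) P) :
    P * (J₂ r * Us) = C' * Matrix.diagonal (fun i => lam i r) * C := by
  obtain ⟨L, hL⟩ := h.left_inv_subspace hsvd r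
  calc P * (J₂ r * Us) = P * (J₂ r * A) * C := by rw [hU]; simp only [Matrix.mul_assoc]
    _ = P * (J₁ r * (A * (C * C'))) * Matrix.diagonal (fun i => lam i r) * C := by
        rw [← h.shift, hC, Matrix.mul_one]; simp only [Matrix.mul_assoc]
    _ = (P * (J₁ r * Us)) * C' * Matrix.diagonal (fun i => lam i r) * C := by
        rw [hU]; simp only [Matrix.mul_assoc]
    _ = _ := by rw [hP.mul_eq_one hL, Matrix.one_mul]

theorem IsShiftModel.exists_eigenvectors (h : IsShiftModel Y A J₁ J₂ lam)
    (hsvd : IsRankSVD Y Us Un σ Vs) :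
    ∃ Q : Matrix (Fin d) (Fin d) 𝕜, IsUnit Q.det ∧ ∀ r (P : Matrix (Fin d) (s r) 𝕜),
      IsPinv (J₁ r * Us) P →
      P * (J₂ r * Us) = Q * Matrix.diagonal (fun i => lam i r) * Q⁻¹ := by
  obtain ⟨C, C', h1, h2, hU⟩ := h.exists_basis hsvd
  refine ⟨C', Matrix.isUnit_det_of_left_inverse h1, fun r P hP => ?_⟩
  rw [Matrix.inv_eq_left_inv h1]
  exact h.pinv_mul h1 hU hsvd hP

theorem IsShiftModel.shift_subspace (h : IsShiftModel Y A J₁ J₂ lam)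
    (hsvd : IsRankSVD Y Us Un σ Vs) {r : Fin R} {P : Matrix (Fin d) (s r) 𝕜}
    (hP : IsPinv (J₁ r * Us) P) : J₂ r * Us = J₁ r * Us * (P * (J₂ r * Us)) := by
  obtain ⟨C, C', h1, h2, hU⟩ := h.exists_basis hsvd
  rw [h.pinv_mul h1 hU hsvd hP]
  calc J₂ r * Us = (J₂ r * A) * C := by rw [hU]; simp only [Matrix.mul_assoc]
    _ = J₁ r * (A * (C * C')) * Matrix.diagonal (fun i => lam i r) * C := by
        rw [← h.shift, h1, Matrix.mul_one]
    _ = _ := by rw [hU]; simp only [Matrix.mul_assoc]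

/-- The matrix linking two common eigenvector matrices commutes with every Λ_r. For i ≠ j some mode
has λ_i ≠ λ_j, so it is diagonal: eigenvectors are unique up to scaling. -/
theorem IsShiftModel.exists_scaling (h : IsShiftModel Y A J₁ J₂ lam)
    (hsvd : IsRankSVD Y Us Un σ Vs) {P : (r : Fin R) → Matrix (Fin d) (s r) 𝕜}
    (hP : ∀ r, IsPinv (J₁ r * Us) (P r)) {Q : Matrix (Fin d) (Fin d) 𝕜} (hQ : IsUnit Q.det)
    (heig : ∀ r, P r * (J₂ r * Us) = Q * Matrix.diagonal (fun i => lam i r) * Q⁻¹) :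
    ∃ δ : Fin d → 𝕜, (∀ i, δ i ≠ 0) ∧ Us * Q = A * Matrix.diagonal δ := by
  obtain ⟨C, C', h1, h2, hU⟩ := h.exists_basis hsvd
  set E := C * Q with hE
  have hcomm : ∀ r, E * Matrix.diagonal (fun i => lam i r)
      = Matrix.diagonal (fun i => lam i r) * E := by
    intro r
    have h3 := heig r
    rw [h.pinv_mul h1 hU hsvd (hP r)] at h3
    calc E * Matrix.diagonal (fun i => lam i r)
        = C * (Q * Matrix.diagonal (fun i => lam i r) * Q⁻¹) * Q := by
          simp only [Matrix.mul_assoc, Matrix.nonsing_inv_mul _ hQ, Matrix.mul_one, hE]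
      _ = (C * C') * Matrix.diagonal (fun i => lam i r) * C * Q := by
          rw [← h3]; simp only [Matrix.mul_assoc]
      _ = _ := by rw [h1, Matrix.one_mul, Matrix.mul_assoc]
  have hdiag : E = Matrix.diagonal (fun i => E i i) := by
    ext i j
    by_cases hij : i = j
    · subst hij; simp
    · rw [Matrix.diagonal_apply_ne _ hij]
      have hne : lam j ≠ lam i := fun h' => hij (h.distinct h').symm
      obtain ⟨r, hr⟩ := Function.ne_iff.mp hne
      have := congrFun (congrFun (hcomm r) i) j
      rw [Matrix.mul_diagonal, Matrix.diagonal_mul] at this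
      have h4 : E i j * (lam j r - lam i r) = 0 := by linear_combination this
      exact (mul_eq_zero.mp h4).resolve_right (sub_ne_zero.mpr hr)
  have hdet : E.det ≠ 0 := by
    rw [hE, Matrix.det_mul]
    exact mul_ne_zero (Matrix.isUnit_det_of_right_inverse h1).ne_zero hQ.ne_zero
  refine ⟨fun i => E i i, ?_, ?_⟩
  · rw [hdiag, Matrix.det_diagonal, Finset.prod_ne_zero_iff] at hdet
    intro i; simpa using hdet i (Finset.mem_univ i)
  · rw [← hdiag, hU, Matrix.mul_assoc]

/-- The first-order eigenvalue perturbation does not depend on the chosen singular value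
decomposition and eigenvectors. -/
theorem IsShiftModel.firstOrder_eq (h : IsShiftModel Y A J₁ J₂ lam)
    (hsvd : IsRankSVD Y Us Un σ Vs) {P : (r : Fin R) → Matrix (Fin d) (s r) 𝕜}
    (hP : ∀ r, IsPinv (J₁ r * Us) (P r)) {Q : Matrix (Fin d) (Fin d) 𝕜} (hQ : IsUnit Q.det)
    (heig : ∀ r, P r * (J₂ r * Us) = Q * Matrix.diagonal (fun i => lam i r) * Q⁻¹)
    {Yp : Matrix n m 𝕜} (hYp : IsPinv Y Yp) {r : Fin R} {Pa : Matrix (Fin d) (s r) 𝕜}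
    (hPa : IsPinv (J₁ r * A) Pa) (M : Matrix (s r) m 𝕜) (W : Matrix m n 𝕜) (i : Fin d) :
    (Q⁻¹ * P r * M * subspaceError Un σ Vs W * Q) i i
      = (Pa * M * (1 - Y * Yp) * W * Yp * A : Matrix (Fin d) (Fin d) 𝕜) i i := by
  obtain ⟨δ, hδ, hUQ⟩ := h.exists_scaling hsvd hP hQ heig
  set D := Matrix.diagonal δ with hD
  set D' := Matrix.diagonal (fun i => (δ i)⁻¹) with hD'
  have d1 : D * D' = 1 := by
    rw [hD, hD', Matrix.diagonal_mul_diagonal, ← Matrix.diagonal_one]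
    congr 1; ext i; exact mul_inv_cancel₀ (hδ i)
  have d2 : D' * D = 1 := mul_eq_one_comm.mp d1
  have hA : A = Us * (Q * D') := by
    rw [← Matrix.mul_assoc, hUQ, Matrix.mul_assoc, d1, Matrix.mul_one]
  obtain ⟨L, hL⟩ := h.left_inv_subspace hsvd r
  have hPJ := (hP r).mul_eq_one hL
  have e0 : Q * D' * (D * Q⁻¹) = 1 := by
    rw [Matrix.mul_assoc, ← Matrix.mul_assoc D', d2, Matrix.one_mul, Matrix.mul_nonsing_inv _ hQ]
  have e1 : (J₁ r * A) * (D * Q⁻¹ * P r) = J₁ r * Us * P r := by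
    calc _ = J₁ r * Us * (Q * D' * (D * Q⁻¹)) * P r := by
          rw [hA]; simp only [Matrix.mul_assoc]
      _ = _ := by rw [e0, Matrix.mul_one]
  have e2 : D * Q⁻¹ * P r * (J₁ r * A) = 1 := by
    calc _ = D * Q⁻¹ * (P r * (J₁ r * Us)) * (Q * D') := by
          rw [hA]; simp only [Matrix.mul_assoc]
      _ = 1 := by rw [hPJ, Matrix.mul_one]; exact mul_eq_one_comm.mp e0
  have hPa' : IsPinv (J₁ r * A) (D * Q⁻¹ * P r) := by
    refine ⟨?_, ?_, ?_, ?_⟩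
    · rw [Matrix.mul_assoc, e2, Matrix.mul_one]
    · rw [e2, Matrix.one_mul]
    · rw [e1, (hP r).herm]
    · rw [e2, Matrix.conjTranspose_one]
  rw [hPa.unique hPa', ← hsvd.mul_pinv hYp, hYp.unique hsvd.isPinv]
  -- Replacing U_s Q by A changes the whole expression by conjugation with the diagonal matrix D,
  -- which does not affect diagonal entries.
  have key : D * Q⁻¹ * P r * M * (Un * Unᴴ) * W
      * (Vs * Matrix.diagonal (fun i => (σ i : 𝕜)⁻¹) * Usᴴ) * A
      = D * (Q⁻¹ * P r * M * subspaceError Un σ Vs W * Q) * D' := by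
    calc _ = D * Q⁻¹ * P r * M * (Un * Unᴴ) * W
          * (Vs * Matrix.diagonal (fun i => (σ i : 𝕜)⁻¹)) * (Usᴴ * Us) * (Q * D') := by
          conv_lhs => arg 2; rw [hA]
          simp only [Matrix.mul_assoc]
      _ = _ := by
          rw [hsvd.orthonormal_s, Matrix.mul_one, subspaceError]; simp only [Matrix.mul_assoc]
  rw [key, hD, hD', Matrix.mul_diagonal, Matrix.diagonal_mul]
  field_simp [hδ i]

end ShiftModel

/-! ### Entrywise asymptotics of matrix functions -/

section EntryO

variable {𝕜 : Type*} [RCLike 𝕜] {α m n k : Type*} {l : Filter α} {g g' : α → ℝ}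

/-- Every entry of the matrix function `F` is `O(g)` along `l`. -/
def EntryO (l : Filter α) (F : α → Matrix m n 𝕜) (g : α → ℝ) : Prop :=
  ∀ i j, (fun x => F x i j) =O[l] g

namespace EntryO

variable {F G : α → Matrix m n 𝕜}

theorem const (A : Matrix m n 𝕜) : EntryO l (fun _ => A) (fun _ => 1) :=
  fun _ _ => isBigO_const_const _ one_ne_zero _

theorem congr' (h : EntryO l F g) (e : ∀ᶠ x in l, F x = G x) : EntryO l G g := by
  intro i j
  refine (h i j).congr' ?_ EventuallyEq.rfl
  filter_upwards [e] with x hx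
  rw [hx]

theorem trans (h : EntryO l F g) (hg : g =O[l] g') : EntryO l F g' :=
  fun i j => (h i j).trans hg

theorem add (h : EntryO l F g) (h' : EntryO l G g) : EntryO l (fun x => F x + G x) g :=
  fun i j => (h i j).add (h' i j)

theorem sub (h : EntryO l F g) (h' : EntryO l G g) : EntryO l (fun x => F x - G x) g :=
  fun i j => (h i j).sub (h' i j)

theorem neg (h : EntryO l F g) : EntryO l (fun x => - F x) g :=
  fun i j => (h i j).neg_left

theorem conjTranspose (h : EntryO l F g) : EntryO l (fun x => (F x)ᴴ) g := by
  intro i j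
  refine ((h j i).norm_left).congr_left ?_ |>.of_norm_left
  intro x; simp [Matrix.conjTranspose_apply]

theorem mul [Fintype n] {H : α → Matrix n k 𝕜} (h : EntryO l F g) (h' : EntryO l H g') :
    EntryO l (fun x => F x * H x) (fun x => g x * g' x) := by
  intro i j
  simp only [Matrix.mul_apply]
  exact IsBigO.fun_sum fun a _ => (h i a).mul (h' a j)

theorem bdd_mul [Fintype n] {H : α → Matrix n k 𝕜} (h : EntryO l F (fun _ => 1))
    (h' : EntryO l H g) : EntryO l (fun x => F x * H x) g := by
  simpa using h.mul h'

theorem mul_bdd [Fintype n] {H : α → Matrix n k 𝕜} (h : EntryO l F g)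
    (h' : EntryO l H (fun _ => 1)) : EntryO l (fun x => F x * H x) g := by
  simpa using h.mul h'

theorem mul_sq [Fintype n] {H : α → Matrix n k 𝕜} (h : EntryO l F g)
    (h' : EntryO l H g) : EntryO l (fun x => F x * H x) (fun x => g x ^ 2) := by
  simpa [sq] using h.mul h'

theorem const_mul [Fintype m] (A : Matrix k m 𝕜) (h : EntryO l F g) :
    EntryO l (fun x => A * F x) g := (const A).bdd_mul h

theorem mul_const [Fintype n] (A : Matrix n k 𝕜) (h : EntryO l F g) :
    EntryO l (fun x => F x * A) g := h.mul_bdd (const A)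

end EntryO

theorem isBigO_one_of_tendsto {ν : α → ℝ} (hν : Tendsto ν l (𝓝 0)) :
    ν =O[l] (fun _ => (1 : ℝ)) := hν.isBigO_one ℝ

theorem isBigO_sq_of_tendsto {ν : α → ℝ} (hν : Tendsto ν l (𝓝 0)) :
    (fun x => ν x ^ 2) =O[l] ν := by
  simpa [sq] using (isBigO_one_of_tendsto hν).mul (isBigO_refl ν l)

theorem EntryO.bdd_of_sub {F : α → Matrix m n 𝕜} {A : Matrix m n 𝕜} {ν : α → ℝ}
    (hν : Tendsto ν l (𝓝 0)) (h : EntryO l (fun x => F x - A) ν) :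
    EntryO l F (fun _ => 1) := by
  simpa using (h.trans (isBigO_one_of_tendsto hν)).add (EntryO.const A)

theorem EntryO.tendsto {F : α → Matrix m n 𝕜} {A : Matrix m n 𝕜} {ν : α → ℝ}
    (hν : Tendsto ν l (𝓝 0)) (h : EntryO l (fun x => F x - A) ν) : Tendsto F l (𝓝 A) := by
  refine tendsto_pi_nhds.mpr fun i => tendsto_pi_nhds.mpr fun j => ?_
  have := (h i j).trans_tendsto hν
  simp only [Matrix.sub_apply] at this
  simpa using this.add_const (A i j)

/-- Continuity of determinant and adjugate bounds the inverse. The rate then comes from F⁻¹ - A⁻¹ =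
-F⁻¹ (F - A) A⁻¹. -/
theorem EntryO.inv [Fintype n] [DecidableEq n] {F : α → Matrix n n 𝕜} {A : Matrix n n 𝕜}
    {ν : α → ℝ} (hν : Tendsto ν l (𝓝 0)) (h : EntryO l (fun x => F x - A) ν)
    (hA : IsUnit A.det) :
    (∀ᶠ x in l, IsUnit (F x).det) ∧ EntryO l (fun x => (F x)⁻¹) (fun _ => 1) ∧
      EntryO l (fun x => (F x)⁻¹ - A⁻¹) ν := by
  have ht := h.tendsto hν
  have hdet : Tendsto (fun x => (F x).det) l (𝓝 A.det) :=
    (continuous_id.matrix_det.tendsto A).comp ht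
  have hu : ∀ᶠ x in l, IsUnit (F x).det := by
    filter_upwards [hdet.eventually_ne hA.ne_zero] with x hx
    exact isUnit_iff_ne_zero.mpr hx
  have hb : EntryO l (fun x => (F x)⁻¹) (fun _ => 1) := by
    have hadj : Tendsto (fun x => (F x).adjugate) l (𝓝 A.adjugate) :=
      (continuous_id.matrix_adjugate.tendsto A).comp ht
    intro i j
    have h1 : Tendsto (fun x => (F x).adjugate i j) l (𝓝 (A.adjugate i j)) :=
      tendsto_pi_nhds.mp (tendsto_pi_nhds.mp hadj i) j
    have h2 := ((hdet.inv₀ hA.ne_zero).mul h1).isBigO_one ℝ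
    have h4 : (fun x => (F x)⁻¹ i j) = fun x => (F x).det⁻¹ * (F x).adjugate i j := by
      ext x
      rw [Matrix.inv_def, Ring.inverse_eq_inv', Matrix.smul_apply, smul_eq_mul]
    exact h4 ▸ h2
  refine ⟨hu, hb, ?_⟩
  have h3 : EntryO l (fun x => -((F x)⁻¹ * (F x - A) * A⁻¹)) ν :=
    ((hb.bdd_mul h).mul_const _).neg
  refine h3.congr' ?_
  filter_upwards [hu] with x hx
  rw [Matrix.mul_sub, Matrix.nonsing_inv_mul _ hx, Matrix.sub_mul, Matrix.mul_assoc,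
    Matrix.mul_nonsing_inv _ hA, Matrix.one_mul, Matrix.mul_one]
  abel

end EntryO

/-! ### Perturbation of the signal subspace -/

section Subspace

variable {𝕜 : Type*} [RCLike 𝕜] {α m n : Type*} [Fintype m] [Fintype n]
  {d p : ℕ} {l : Filter α} {ν : α → ℝ}
  {Y₀ : Matrix m n 𝕜} {Us : Matrix m (Fin d) 𝕜} {Un : Matrix m (Fin p) 𝕜} {σ : Fin d → ℝ}
  {Vs : Matrix n (Fin d) 𝕜}

theorem norm_le_one_of_orthonormal {U : Matrix m (Fin d) 𝕜} (hU : Uᴴ * U = 1) (i : m)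
    (j : Fin d) : ‖U i j‖ ≤ 1 := by
  have h1 : ((∑ k, ‖U k j‖ ^ 2 : ℝ) : 𝕜) = 1 := by
    have := congrFun (congrFun hU j) j
    rw [Matrix.one_apply_eq] at this
    rw [sum_norm_sq_eq (fun k => U k j)]
    exact this
  have h2 : ∑ k, ‖U k j‖ ^ 2 = 1 := by exact_mod_cast h1
  have h3 : ‖U i j‖ ^ 2 ≤ 1 := h2 ▸ Finset.single_le_sum
    (f := fun k => ‖U k j‖ ^ 2) (fun k _ => by positivity) (Finset.mem_univ i)
  exact (sq_le_one_iff₀ (norm_nonneg _)).mp h3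

theorem EntryO.of_orthonormal {U : α → Matrix m (Fin d) 𝕜} (hU : ∀ x, (U x)ᴴ * U x = 1) :
    EntryO l U (fun _ => 1) := by
  intro i j
  refine IsBigO.of_bound 1 (Eventually.of_forall fun x => ?_)
  simpa using norm_le_one_of_orthonormal (hU x) i j

theorem EntryO.sum_norm_sq {k : Type*} [Fintype k] {F : α → Matrix m k 𝕜}
    (h : EntryO l F (fun _ => 1)) :
    (fun x => ∑ i, ∑ j, ‖F x i j‖ ^ 2) =O[l] (fun _ => (1 : ℝ)) := by
  refine IsBigO.fun_sum fun i _ => IsBigO.fun_sum fun j _ => ?_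
  simpa using (h i j).norm_left.pow 2

theorem EntryO.subspaceError {Δ : α → Matrix m n 𝕜} (h : EntryO l Δ ν) :
    EntryO l (fun x => NCEsprit.subspaceError Un σ Vs (Δ x)) ν :=
  ((h.const_mul _).mul_const _).mul_const _

/-- First-order expansion of the dominant left singular subspace, in a suitable basis. -/
theorem IsRankSVD.subspace_expansion [DecidableEq m] (hsvd : IsRankSVD Y₀ Us Un σ Vs)
    (hν : Tendsto ν l (𝓝 0)) {Δ : α → Matrix m n 𝕜} (hΔ : EntryO l Δ ν)
    {U : α → Matrix m (Fin d) 𝕜} (hU : ∀ x, IsDominantLeft (Y₀ + Δ x) (U x)) :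
    ∃ B N : α → Matrix (Fin d) (Fin d) 𝕜, EntryO l B (fun _ => 1) ∧ EntryO l N (fun _ => 1) ∧
      (∀ᶠ x in l, B x * N x = 1) ∧
      EntryO l (fun x => U x * B x - Us - NCEsprit.subspaceError Un σ Vs (Δ x))
        (fun x => ν x ^ 2) := by
  choose hUU τ hτ0 hE hdom using hU
  have hν1 := isBigO_one_of_tendsto hν
  have hν2 := isBigO_sq_of_tendsto hν
  set Si := Matrix.diagonal (fun i => (σ i : 𝕜)⁻¹) with hSi
  set Sg := Matrix.diagonal (fun i => (σ i : 𝕜)) with hSg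
  have i1 : Sg * Si = 1 := diagonal_ofReal_mul_inv fun i => (hsvd.pos i).ne'
  have i2 : Si * Sg = 1 := diagonal_ofReal_inv_mul fun i => (hsvd.pos i).ne'
  have hSgH : Sgᴴ = Sg := by
    rw [hSg, Matrix.diagonal_conjTranspose]; congr 1; ext i; simp
  set Y : α → Matrix m n 𝕜 := fun x => Y₀ + Δ x with hY
  have hYx : ∀ x, Y x = Y₀ + Δ x := fun _ => rfl
  have hYb : EntryO l Y (fun _ => 1) := (EntryO.const Y₀).add (hΔ.trans hν1)
  have hUb : EntryO l U (fun _ => 1) := EntryO.of_orthonormal hUU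
  have hY0Us : Y₀ᴴ * Us = Vs * Sg := by
    conv_lhs => rw [hsvd.eq]
    rw [Matrix.conjTranspose_mul, Matrix.conjTranspose_mul, Matrix.conjTranspose_conjTranspose,
      Matrix.mul_assoc, Matrix.mul_assoc, hsvd.orthonormal_s, Matrix.mul_one]
    exact congrArg (Vs * ·) hSgH
  have hUsY0 : Usᴴ * Y₀ = Sg * Vsᴴ := by
    have := congrArg Matrix.conjTranspose hY0Us
    rwa [Matrix.conjTranspose_mul, Matrix.conjTranspose_mul, Matrix.conjTranspose_conjTranspose,
      hSgH] at this
  have hUnUs : Unᴴ * Us = 0 := by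
    have := congrArg Matrix.conjTranspose hsvd.orthogonal
    rwa [Matrix.conjTranspose_mul, Matrix.conjTranspose_conjTranspose,
      Matrix.conjTranspose_zero] at this
  have hUnY0 : Unᴴ * Y₀ = 0 := by
    rw [hsvd.eq, ← Matrix.mul_assoc, ← Matrix.mul_assoc, hUnUs, Matrix.zero_mul, Matrix.zero_mul]
  have hUnY : ∀ x, Unᴴ * Y x = Unᴴ * Δ x := fun x => by
    rw [hYx, Matrix.mul_add, hUnY0, zero_add]
  -- the dominant singular values are bounded below
  have hM : EntryO l (fun x => Si * Vsᴴ * (Y x)ᴴ * Us - 1) ν := by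
    have h1 : EntryO l (fun x => Si * Vsᴴ * (Δ x)ᴴ * Us) ν :=
      (hΔ.conjTranspose.const_mul _).mul_const _
    refine h1.congr' (Eventually.of_forall fun x => ?_)
    have h2 : Si * Vsᴴ * Y₀ᴴ * Us = 1 := by
      rw [Matrix.mul_assoc, hY0Us, Matrix.mul_assoc, ← Matrix.mul_assoc Vsᴴ, hsvd.orthonormal_v,
        Matrix.one_mul, i2]
    rw [hYx, Matrix.conjTranspose_add, Matrix.mul_add, Matrix.add_mul, h2]
    abel
  obtain ⟨hMu, hMi, -⟩ := hM.inv hν (by simp)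
  have hlow : ∀ i, (fun _ => (1 : ℝ)) =O[l] (fun x => τ x i ^ 2) := by
    intro i
    have hRb : EntryO l (fun x => (Si * Vsᴴ * (Y x)ᴴ * Us)⁻¹ * (Si * Vsᴴ)) (fun _ => 1) :=
      hMi.mul_const _
    set K := ∑ k, ∑ j, ‖Us k j‖ ^ 2 with hK
    have h1 : (fun _ => (1 : ℝ)) =O[l] (fun x => (∑ k, ∑ j,
        ‖((Si * Vsᴴ * (Y x)ᴴ * Us)⁻¹ * (Si * Vsᴴ)) k j‖ ^ 2) * τ x i ^ 2 * K) := by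
      refine IsBigO.of_bound 1 ?_
      filter_upwards [hMu] with x hx
      have h2 := one_le_mul_sq_singularValue (hUU x) (hE x) (hdom x) (A := Us)
        (X := (Si * Vsᴴ * (Y x)ᴴ * Us)⁻¹ * (Si * Vsᴴ)) (by
          rw [Matrix.mul_assoc, ← Matrix.mul_assoc _ _ Us, ← hYx]
          rw [Matrix.nonsing_inv_mul _ hx]) i
      rw [one_mul, norm_one]
      exact h2.trans (le_abs_self _)
    refine h1.trans ?_
    have h3 := (hRb.sum_norm_sq.mul (isBigO_refl (fun x => τ x i ^ 2) l)).mul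
      (isBigO_const_const K (one_ne_zero (α := ℝ)) l)
    simpa using h3
  set N' : α → Matrix (Fin p) (Fin d) 𝕜 := fun x => Unᴴ * U x with hN'
  set N : α → Matrix (Fin d) (Fin d) 𝕜 := fun x => Usᴴ * U x with hN
  set S : α → Matrix (Fin d) (Fin d) 𝕜 :=
    fun x => Matrix.diagonal (fun i => ((τ x i ^ 2 : ℝ) : 𝕜)) with hS
  have hEx : ∀ x, Y x * (Y x)ᴴ * U x = U x * S x := hE
  -- Unᴴ annihilates Y₀, so multiplying the singular vector equation by Unᴴ leaves Unᴴ U S = Unᴴ Δ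
  -- Yᴴ U = O(ν). The lower bound on the singular values allows dividing by S.
  have hN'O : EntryO l N' ν := by
    have h1 : EntryO l (fun x => N' x * S x) ν := by
      have h2 : EntryO l (fun x => Unᴴ * Δ x * (Y x)ᴴ * U x) ν :=
        ((hΔ.const_mul _).mul_bdd hYb.conjTranspose).mul_bdd hUb
      refine h2.congr' (Eventually.of_forall fun x => ?_)
      rw [← hUnY, Matrix.mul_assoc, Matrix.mul_assoc, ← Matrix.mul_assoc (Y x), hEx,
        Matrix.mul_assoc]
    intro a i
    have h4 : (fun x => ‖N' x a i‖ * ‖τ x i ^ 2‖) =O[l] ν := by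
      refine (h1 a i).norm_left.congr_left fun x => ?_
      have h5 : (N' x * S x) a i = N' x a i * ((τ x i ^ 2 : ℝ) : 𝕜) := Matrix.mul_diagonal _ _ _ _
      change ‖(N' x * S x) a i‖ = _
      rw [h5, norm_mul, RCLike.norm_ofReal, Real.norm_eq_abs]
    have h5 : (fun x => ‖N' x a i‖ * 1) =O[l] (fun x => ‖N' x a i‖ * ‖τ x i ^ 2‖) :=
      (isBigO_refl (fun x => ‖N' x a i‖) l).mul (hlow i).norm_right
    exact ((h5.trans h4).congr_left fun x => mul_one _).of_norm_left
  have hNb : EntryO l N (fun _ => 1) := hUb.const_mul _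
  -- By Pythagoras Nᴴ N = 1 - N'ᴴ N'. Hence N is eventually invertible with bounded inverse B,
  -- although U itself need not converge.
  have hNN : EntryO l (fun x => (N x)ᴴ * N x - 1) ν := by
    have h1 : EntryO l (fun x => -((N' x)ᴴ * N' x)) ν :=
      ((hN'O.conjTranspose.mul_sq hN'O).trans hν2).neg
    refine h1.congr' (Eventually.of_forall fun x => ?_)
    have h2 : (N x)ᴴ * N x + (N' x)ᴴ * N' x = 1 := by
      simp only [hN, hN', Matrix.conjTranspose_mul, Matrix.conjTranspose_conjTranspose]
      calc _ = (U x)ᴴ * (Us * Usᴴ + Un * Unᴴ) * U x := by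
            simp only [Matrix.mul_add, Matrix.add_mul, Matrix.mul_assoc]
        _ = 1 := by rw [hsvd.complete, Matrix.mul_one, hUU]
    rw [← h2]; abel
  obtain ⟨hNu, hNi, -⟩ := hNN.inv hν (by simp)
  set B : α → Matrix (Fin d) (Fin d) 𝕜 := fun x => ((N x)ᴴ * N x)⁻¹ * (N x)ᴴ with hB
  have hBb : EntryO l B (fun _ => 1) := hNi.bdd_mul hNb.conjTranspose
  have hBN : ∀ᶠ x in l, B x * N x = 1 := by
    filter_upwards [hNu] with x hx
    simp only [hB]
    rw [Matrix.mul_assoc, Matrix.nonsing_inv_mul _ hx]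
  set Z : α → Matrix (Fin p) (Fin d) 𝕜 := fun x => N' x * B x with hZ
  have hZO : EntryO l Z ν := hN'O.mul_bdd hBb
  have hUB : ∀ᶠ x in l, U x * B x = Us + Un * Z x := by
    filter_upwards [hBN] with x hx
    have hx' : N x * B x = 1 := mul_eq_one_comm.mp hx
    calc U x * B x = (Us * Usᴴ + Un * Unᴴ) * U x * B x := by rw [hsvd.complete, Matrix.one_mul]
      _ = Us * (N x * B x) + Un * Z x := by
        simp only [hN, hZ, hN', Matrix.add_mul, Matrix.mul_assoc]
      _ = _ := by rw [hx', Matrix.mul_one]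
  have hUBb : EntryO l (fun x => U x * B x) (fun _ => 1) := hUb.bdd_mul hBb
  have hUBs : EntryO l (fun x => U x * B x - Us) ν := by
    refine (hZO.const_mul Un).congr' ?_
    filter_upwards [hUB] with x hx
    rw [hx]; abel
  set K : α → Matrix (Fin d) (Fin d) 𝕜 := fun x => Usᴴ * (Y x * (Y x)ᴴ * (U x * B x)) with hK
  have hKO : EntryO l (fun x => K x - Sg * Sg) ν := by
    have h1 : EntryO l (fun x => Usᴴ * (Δ x * (Y x)ᴴ * (U x * B x) + Y₀ * (Δ x)ᴴ * (U x * B x)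
        + Y₀ * Y₀ᴴ * (U x * B x - Us))) ν :=
      ((((hΔ.mul_bdd hYb.conjTranspose).mul_bdd hUBb).add
        ((hΔ.conjTranspose.const_mul _).mul_bdd hUBb)).add (hUBs.const_mul _)).const_mul _
    refine h1.congr' (Eventually.of_forall fun x => ?_)
    have h2 : Sg * Sg = Usᴴ * (Y₀ * Y₀ᴴ * Us) := by
      rw [Matrix.mul_assoc Y₀, hY0Us, ← Matrix.mul_assoc, hUsY0, Matrix.mul_assoc,
        ← Matrix.mul_assoc Vsᴴ, hsvd.orthonormal_v, Matrix.one_mul]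
    simp only [hK, h2, hYx, Matrix.conjTranspose_add]
    simp only [Matrix.mul_add, Matrix.add_mul, Matrix.mul_sub, Matrix.mul_assoc]
    abel
  -- An exact equation for the noise-space component Z of U B = U_s + U_n Z. Here K = Σ² + O(ν) and
  -- Yᴴ U B = V_s Σ + O(ν), while Z and Δ are O(ν), so replacing both by their limits costs O(ν²).
  have hEq : ∀ᶠ x in l, Z x * K x = Unᴴ * Δ x * ((Y x)ᴴ * (U x * B x)) := by
    filter_upwards [hBN] with x hx
    have h1 : Y x * (Y x)ᴴ * (U x * B x) = U x * S x * B x := by rw [← Matrix.mul_assoc, hEx]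
    calc Z x * K x = N' x * (B x * N x) * S x * B x := by
          simp only [hK, hZ, hN]
          rw [h1]
          simp only [Matrix.mul_assoc]
      _ = Unᴴ * (Y x * (Y x)ᴴ * (U x * B x)) := by
          rw [hx, Matrix.mul_one, h1]; simp only [hN', Matrix.mul_assoc]
      _ = _ := by rw [← hUnY]; simp only [Matrix.mul_assoc]
  have hZ2 : EntryO l (fun x => Z x * (Sg * Sg) - Unᴴ * Δ x * (Vs * Sg)) (fun x => ν x ^ 2) := by
    have h1 : EntryO l (fun x => (Δ x)ᴴ * (U x * B x) + Y₀ᴴ * (U x * B x - Us)) ν :=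
      (hΔ.conjTranspose.mul_bdd hUBb).add (hUBs.const_mul _)
    have h2 : EntryO l (fun x => Unᴴ * Δ x * ((Δ x)ᴴ * (U x * B x) + Y₀ᴴ * (U x * B x - Us))
        - Z x * (K x - Sg * Sg)) (fun x => ν x ^ 2) :=
      ((hΔ.const_mul _).mul_sq h1).sub (hZO.mul_sq hKO)
    refine h2.congr' ?_
    filter_upwards [hEq] with x hx
    rw [Matrix.mul_sub (Z x), hx, ← hY0Us, hYx, Matrix.conjTranspose_add]
    simp only [Matrix.mul_add, Matrix.add_mul, Matrix.mul_sub]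
    abel
  refine ⟨B, N, hBb, hNb, hBN, ?_⟩
  refine ((hZ2.mul_const (Si * Si)).const_mul Un).congr' ?_
  filter_upwards [hUB] with x hx
  have h1 : Sg * Sg * (Si * Si) = 1 := by
    rw [Matrix.mul_assoc, ← Matrix.mul_assoc Sg Si, i1, Matrix.one_mul, i1]
  have h2 : Unᴴ * Δ x * (Vs * Sg) * (Si * Si) = Unᴴ * Δ x * Vs * Si := by
    calc _ = Unᴴ * Δ x * Vs * (Sg * Si) * Si := by simp only [Matrix.mul_assoc]
      _ = _ := by rw [i1, Matrix.mul_one]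
  rw [hx, Matrix.sub_mul, Matrix.mul_assoc (Z x), h1, Matrix.mul_one, h2, NCEsprit.subspaceError]
  simp only [Matrix.mul_sub, Matrix.mul_assoc]
  rw [add_sub_cancel_left]

end Subspace

/-! ### Perturbation of the least squares solutions -/

section LeastSquares

variable {𝕜 : Type*} [RCLike 𝕜] {α m n : Type*} [Fintype m] [Fintype n]
  {d p R : ℕ} {l : Filter α} {ν : α → ℝ} {s : Fin R → Type*} [∀ r, Fintype (s r)]
  {Y₀ : Matrix m n 𝕜} {A : Matrix m (Fin d) 𝕜} {J₁ J₂ : (r : Fin R) → Matrix (s r) m 𝕜}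
  {lam : Fin d → Fin R → 𝕜} {Us : Matrix m (Fin d) 𝕜} {Un : Matrix m (Fin p) 𝕜} {σ : Fin d → ℝ}
  {Vs : Matrix n (Fin d) 𝕜}

/-- With X = U B, the matrix N G B is the least squares solution for J₁ X, J₂ X. Since J₂ U_s = J₁
U_s Γ exactly, its deviation from Γ is (J₁ X)⁺ (J₂ δ - J₁ δ Γ) with δ = X - U_s. The second factor
is already O(ν), so the perturbation of the pseudo inverse enters only at second order. -/
theorem leastSquares_expansion {k : Type*} [Fintype k] {J₁ J₂ : Matrix k m 𝕜}
    {Us : Matrix m (Fin d) 𝕜} {P : Matrix (Fin d) k 𝕜} (hP : IsPinv (J₁ * Us) P)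
    (hL : ∃ L : Matrix (Fin d) k 𝕜, L * (J₁ * Us) = 1) {Γ : Matrix (Fin d) (Fin d) 𝕜}
    (hΓ : J₂ * Us = J₁ * Us * Γ) (hν : Tendsto ν l (𝓝 0))
    {U E : α → Matrix m (Fin d) 𝕜} {B N : α → Matrix (Fin d) (Fin d) 𝕜}
    (hBN : ∀ᶠ x in l, B x * N x = 1)
    (hE : EntryO l E ν) (hX : EntryO l (fun x => U x * B x - Us - E x) (fun x => ν x ^ 2)) :
    (∀ᶠ x in l, ∃ L : Matrix (Fin d) k 𝕜, L * (J₁ * U x) = 1) ∧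
    ∀ G : α → Matrix (Fin d) (Fin d) 𝕜,
      (∀ x, IsLeastSquares (J₁ * U x) (J₂ * U x) (G x)) →
      EntryO l (fun x => N x * G x * B x - Γ - P * (J₂ * E x - J₁ * E x * Γ))
        (fun x => ν x ^ 2) := by
  obtain ⟨L, hL⟩ := hL
  have hν1 := isBigO_one_of_tendsto hν
  have hν2 := isBigO_sq_of_tendsto hν
  have hgram0 := isUnit_det_gram hL
  have hP0 := hP.eq_gram hgram0
  set X : α → Matrix m (Fin d) 𝕜 := fun x => U x * B x with hXdef
  have hXs : EntryO l (fun x => X x - Us) ν := by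
    simpa using (hX.trans hν2).add hE
  have hJX : EntryO l (fun x => J₁ * X x - J₁ * Us) ν := by
    simpa [Matrix.mul_sub] using hXs.const_mul J₁
  have hJXb : EntryO l (fun x => J₁ * X x) (fun _ => 1) := hJX.bdd_of_sub hν
  set g : α → Matrix (Fin d) (Fin d) 𝕜 := fun x => (J₁ * X x)ᴴ * (J₁ * X x) with hg
  set g₀ : Matrix (Fin d) (Fin d) 𝕜 := (J₁ * Us)ᴴ * (J₁ * Us) with hg0
  have hgO : EntryO l (fun x => g x - g₀) ν := by
    have h1 : EntryO l (fun x => (J₁ * X x - J₁ * Us)ᴴ * (J₁ * X x)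
        + (J₁ * Us)ᴴ * (J₁ * X x - J₁ * Us)) ν :=
      (hJX.conjTranspose.mul_bdd hJXb).add (hJX.const_mul _)
    refine h1.congr' (Eventually.of_forall fun x => ?_)
    simp only [hg, hg0, Matrix.conjTranspose_sub, Matrix.sub_mul, Matrix.mul_sub]
    abel
  obtain ⟨hgu, hgi, hgs⟩ := hgO.inv hν hgram0
  have hleft : ∀ᶠ x in l, (g x)⁻¹ * (J₁ * X x)ᴴ * (J₁ * X x) = 1 := by
    filter_upwards [hgu] with x hx
    rw [Matrix.mul_assoc, Matrix.nonsing_inv_mul _ hx]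
  refine ⟨?_, fun G hG => ?_⟩
  · filter_upwards [hleft, hBN] with x hx hx2
    refine ⟨B x * ((g x)⁻¹ * (J₁ * X x)ᴴ), ?_⟩
    have h1 : B x * ((g x)⁻¹ * (J₁ * X x)ᴴ) * (J₁ * U x) * B x = B x := by
      calc _ = B x * ((g x)⁻¹ * (J₁ * X x)ᴴ * (J₁ * X x)) := by
            simp only [hXdef, Matrix.mul_assoc]
        _ = B x := by rw [hx, Matrix.mul_one]
    have h2 := congrArg (· * N x) h1
    rwa [Matrix.mul_assoc _ (B x), hx2, Matrix.mul_one] at h2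
  · choose P' hP' hGP using hG
    set P'' : α → Matrix (Fin d) k 𝕜 := fun x => (g x)⁻¹ * (J₁ * X x)ᴴ with hP''
    have hPO : EntryO l (fun x => P'' x - P) ν := by
      have h1 : EntryO l (fun x => ((g x)⁻¹ - g₀⁻¹) * (J₁ * X x)ᴴ
          + g₀⁻¹ * (J₁ * X x - J₁ * Us)ᴴ) ν :=
        (hgs.mul_bdd hJXb.conjTranspose).add (hJX.conjTranspose.const_mul _)
      refine h1.congr' (Eventually.of_forall fun x => ?_)
      rw [hP0]
      simp only [hP'', Matrix.conjTranspose_sub, Matrix.sub_mul, Matrix.mul_sub]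
      abel
    -- J₁ U = (J₁ X) N, so N P' solves the normal equations for J₁ X, whose Gram matrix is
    -- invertible.
    have hNP : ∀ᶠ x in l, N x * P' x = P'' x := by
      filter_upwards [hgu, hBN] with x hx hx2
      have hU : J₁ * U x = J₁ * X x * N x := by
        simp only [hXdef, Matrix.mul_assoc, hx2, Matrix.mul_one]
      have h1 := (hP' x).gram_mul
      rw [hU, Matrix.conjTranspose_mul] at h1
      have h3 : (B x)ᴴ * (N x)ᴴ = 1 := by
        have := congrArg Matrix.conjTranspose (mul_eq_one_comm.mp hx2)
        simpa using this
      have h4 : g x * (N x * P' x) = (J₁ * X x)ᴴ := by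
        calc g x * (N x * P' x)
            = (B x)ᴴ * (N x)ᴴ * (g x * (N x * P' x)) := by rw [h3, Matrix.one_mul]
          _ = (B x)ᴴ * ((N x)ᴴ * (J₁ * X x)ᴴ * (J₁ * X x * N x) * P' x) := by
              simp only [hg, Matrix.mul_assoc]
          _ = _ := by rw [h1, ← Matrix.mul_assoc, h3, Matrix.one_mul]
      simp only [hP'']
      rw [← h4, ← Matrix.mul_assoc, Matrix.nonsing_inv_mul _ hx, Matrix.one_mul]
    have hE2 : EntryO l (fun x => J₂ * (X x - Us) - J₁ * (X x - Us) * Γ) ν :=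
      (hXs.const_mul _).sub ((hXs.const_mul _).mul_const _)
    have hE3 : EntryO l (fun x => J₂ * (X x - Us - E x) - J₁ * (X x - Us - E x) * Γ)
        (fun x => ν x ^ 2) :=
      (hX.const_mul _).sub ((hX.const_mul _).mul_const _)
    refine ((hPO.mul_sq hE2).add (hE3.const_mul P)).congr' ?_
    filter_upwards [hNP, hleft] with x hx hx2
    have h1 : N x * G x * B x = P'' x * (J₂ * X x) := by
      rw [hGP, ← hx]; simp only [hXdef, Matrix.mul_assoc]
    have h2 : P'' x * (J₁ * X x * Γ) = Γ := by
      rw [← Matrix.mul_assoc, hx2, Matrix.one_mul]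
    have h3 : N x * G x * B x - Γ = P'' x * (J₂ * (X x - Us) - J₁ * (X x - Us) * Γ) := by
      conv_lhs => rw [h1, ← h2]
      rw [← Matrix.mul_sub]
      congr 1
      simp only [Matrix.mul_sub, Matrix.sub_mul]
      rw [hΓ]; abel
    rw [h3]
    simp only [Matrix.mul_sub, Matrix.sub_mul]
    abel

/-- The i-th column of Q is an eigenvector of Q diag(ω) Q⁻¹, so in the i-th diagonal entry this
matrix acts as the scalar ω_i. -/
theorem diag_conj_eq {k : Type*} [Fintype k] {J₁ J₂ : Matrix k m 𝕜} {P : Matrix (Fin d) k 𝕜}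
    {Q : Matrix (Fin d) (Fin d) 𝕜} (hQ : IsUnit Q.det) (ω : Fin d → 𝕜)
    (E : Matrix m (Fin d) 𝕜) (i : Fin d) :
    (Q⁻¹ * (P * (J₂ * E - J₁ * E * (Q * Matrix.diagonal ω * Q⁻¹))) * Q) i i
      = (Q⁻¹ * P * (J₂ - ω i • J₁) * E * Q) i i := by
  have h1 : Q⁻¹ * (P * (J₂ * E - J₁ * E * (Q * Matrix.diagonal ω * Q⁻¹))) * Q
      = Q⁻¹ * P * J₂ * E * Q - Q⁻¹ * P * J₁ * E * Q * Matrix.diagonal ω := by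
    simp only [Matrix.mul_sub, Matrix.sub_mul, Matrix.mul_assoc, Matrix.nonsing_inv_mul _ hQ,
      Matrix.mul_one]
  have h2 : Q⁻¹ * P * (J₂ - ω i • J₁) * E * Q
      = Q⁻¹ * P * J₂ * E * Q - ω i • (Q⁻¹ * P * J₁ * E * Q) := by
    simp only [Matrix.mul_sub, Matrix.sub_mul, Matrix.mul_smul, Matrix.smul_mul]
  rw [h1, h2, Matrix.sub_apply, Matrix.sub_apply, Matrix.mul_diagonal, Matrix.smul_apply,
    smul_eq_mul, mul_comm]

/-- In a suitable well-conditioned frame, the estimated rotational operators are diagonal up to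
`O(ν)`, and their diagonals have the first-order expansion of the eigenvalues. -/
theorem IsShiftModel.exists_frame [DecidableEq m] (h : IsShiftModel Y₀ A J₁ J₂ lam)
    (hsvd : IsRankSVD Y₀ Us Un σ Vs) {P : (r : Fin R) → Matrix (Fin d) (s r) 𝕜}
    (hP : ∀ r, IsPinv (J₁ r * Us) (P r)) {Q : Matrix (Fin d) (Fin d) 𝕜} (hQ : IsUnit Q.det)
    (heig : ∀ r, P r * (J₂ r * Us) = Q * Matrix.diagonal (fun i => lam i r) * Q⁻¹)
    (hν : Tendsto ν l (𝓝 0)) {Δ : α → Matrix m n 𝕜} (hΔ : EntryO l Δ ν)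
    {U : α → Matrix m (Fin d) 𝕜} (hU : ∀ x, IsDominantLeft (Y₀ + Δ x) (U x)) :
    (∀ᶠ x in l, ∀ r, ∃ L : Matrix (Fin d) (s r) 𝕜, L * (J₁ r * U x) = 1) ∧
    ∃ T T' : α → Matrix (Fin d) (Fin d) 𝕜, EntryO l T (fun _ => 1) ∧
      EntryO l T' (fun _ => 1) ∧ (∀ᶠ x in l, T x * T' x = 1) ∧
      ∀ r (G : α → Matrix (Fin d) (Fin d) 𝕜),
        (∀ x, IsLeastSquares (J₁ r * U x) (J₂ r * U x) (G x)) →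
        EntryO l (fun x => T' x * G x * T x - Matrix.diagonal (fun i => lam i r)) ν ∧
        ∀ i, (fun x => (T' x * G x * T x) i i - lam i r
          - (Q⁻¹ * P r * (J₂ r - lam i r • J₁ r) *
              subspaceError Un σ Vs (Δ x) * Q) i i) =O[l] (fun x => ν x ^ 2) := by
  have hν2 := isBigO_sq_of_tendsto hν
  obtain ⟨B, N, hB, hN, hBN, hX⟩ := hsvd.subspace_expansion hν hΔ hU
  have hE : EntryO l (fun x => subspaceError Un σ Vs (Δ x)) ν := hΔ.subspaceError
  have hLS := fun r => leastSquares_expansion (J₁ := J₁ r) (J₂ := J₂ r) (hP r)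
    (h.left_inv_subspace hsvd r) (h.shift_subspace hsvd (hP r)) hν hBN hE hX
  refine ⟨eventually_all.mpr fun r => (hLS r).1, fun x => B x * Q, fun x => Q⁻¹ * N x,
    hB.mul_const _, hN.const_mul _, ?_, fun r G hG => ?_⟩
  · filter_upwards [hBN] with x hx
    have h1 : (B x * Q) * (Q⁻¹ * N x) = B x * (Q * Q⁻¹) * N x := by simp only [Matrix.mul_assoc]
    rw [h1, Matrix.mul_nonsing_inv _ hQ, Matrix.mul_one, hx]
  · have h1 := (hLS r).2 G hG
    rw [heig r] at h1
    set Γ := Q * Matrix.diagonal (fun i => lam i r) * Q⁻¹ with hΓ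
    have hΓQ : Q⁻¹ * Γ * Q = Matrix.diagonal (fun i => lam i r) := by
      rw [hΓ, ← Matrix.mul_assoc, ← Matrix.mul_assoc, Matrix.nonsing_inv_mul _ hQ, Matrix.one_mul,
        Matrix.mul_assoc, Matrix.nonsing_inv_mul _ hQ, Matrix.mul_one]
    set H : α → Matrix (Fin d) (Fin d) 𝕜 := fun x => P r * (J₂ r * subspaceError Un σ Vs (Δ x)
      - J₁ r * subspaceError Un σ Vs (Δ x) * Γ) with hH
    have hHO : EntryO l H ν :=
      ((hE.const_mul _).sub ((hE.const_mul _).mul_const _)).const_mul _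
    have h2 : EntryO l (fun x => Q⁻¹ * N x * G x * (B x * Q)
        - Matrix.diagonal (fun i => lam i r) - Q⁻¹ * H x * Q) (fun x => ν x ^ 2) := by
      refine ((h1.const_mul Q⁻¹).mul_const Q).congr' (Eventually.of_forall fun x => ?_)
      rw [← hΓQ]
      simp only [hH, Matrix.mul_sub, Matrix.sub_mul, Matrix.mul_assoc]
    refine ⟨?_, fun i => ?_⟩
    · refine ((h2.trans hν2).add ((hHO.const_mul Q⁻¹).mul_const Q)).congr'
        (Eventually.of_forall fun x => ?_)
      abel
    · refine (h2 i i).congr_left fun x => ?_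
      rw [← diag_conj_eq hQ (fun i => lam i r)]
      simp [hH, hΓ]

end LeastSquares

/-! ### Lower bounds and finite case splits for big-O -/

section BigO

variable {α 𝕜 : Type*} [RCLike 𝕜] {l : Filter α}

/-- `(fun _ => 1) =O[l] u` expresses that u is eventually bounded away from zero, so it can be
divided out. Lower bounds take this form throughout. -/
theorem isBigO_of_mul {f u : α → 𝕜} {g : α → ℝ} (h : (fun x => f x * u x) =O[l] g)
    (hu : (fun _ => (1 : ℝ)) =O[l] u) : f =O[l] g := by
  have h1 : (fun x => ‖f x‖ * 1) =O[l] (fun x => ‖f x‖ * ‖u x‖) :=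
    (isBigO_refl (fun x => ‖f x‖) l).mul hu.norm_right
  have h2 : (fun x => ‖f x‖ * ‖u x‖) =O[l] g :=
    h.norm_left.congr_left fun x => norm_mul _ _
  exact ((h1.trans h2).congr_left fun x => mul_one _).of_norm_left

theorem one_isBigO_of_tendsto {f : α → 𝕜} {a : 𝕜} (h : Tendsto f l (𝓝 a)) (ha : a ≠ 0) :
    (fun _ => (1 : ℝ)) =O[l] f := by
  have h1 := (h.inv₀ ha).isBigO_one ℝ
  have h2 : (fun x => ‖(f x)⁻¹‖ * ‖f x‖) =O[l] (fun x => 1 * ‖f x‖) :=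
    h1.norm_left.mul (isBigO_refl _ l)
  have h3 : (fun _ => (1 : ℝ)) =O[l] (fun x => 1 * ‖f x‖) := by
    refine h2.congr' ?_ EventuallyEq.rfl
    filter_upwards [h.eventually_ne ha] with x hx
    rw [← norm_mul, inv_mul_cancel₀ hx, norm_one]
  simpa using h3

/-- A bound that holds on each of finitely many pieces holds globally. -/
theorem exists_bound_of_pieces {T : Type*} [Fintype T] (τ : α → T) {p : T → ℝ → α → Prop}
    (hmono : ∀ t C C' x, C ≤ C' → p t C x → p t C' x)
    (h : ∀ t, ∃ C, ∀ᶠ x in l ⊓ 𝓟 {x | τ x = t}, p t C x) :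
    ∃ C, ∀ᶠ x in l, p (τ x) C x := by
  choose C hC using h
  refine ⟨∑ t, |C t|, ?_⟩
  have h1 : ∀ᶠ x in l, ∀ t, τ x = t → p t (C t) x := by
    rw [eventually_all]
    intro t
    exact eventually_inf_principal.mp (hC t)
  filter_upwards [h1] with x hx
  exact hmono _ _ _ _ ((le_abs_self _).trans
    (Finset.single_le_sum (f := fun t => |C t|) (fun t _ => abs_nonneg _) (Finset.mem_univ _)))
    (hx _ rfl)

theorem EntryO.entrySum {m n : Type*} [Fintype m] [Fintype n] (F : α → Matrix m n 𝕜) :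
    EntryO l F (fun x => ∑ i, ∑ j, ‖F x i j‖) := by
  intro i j
  refine IsBigO.of_bound 1 (Eventually.of_forall fun x => ?_)
  rw [one_mul]
  refine le_trans ?_ (le_abs_self _)
  exact (Finset.single_le_sum (f := fun j => ‖F x i j‖) (fun j _ => norm_nonneg _)
    (Finset.mem_univ j)).trans (Finset.single_le_sum (f := fun i => ∑ j, ‖F x i j‖)
    (fun i _ => Finset.sum_nonneg fun j _ => norm_nonneg _) (Finset.mem_univ i))

theorem EntryO.comp_tendsto {m n β : Type*} {F : α → Matrix m n 𝕜} {g : α → ℝ}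
    (h : EntryO l F g) {l' : Filter β} {φ : β → α} (hφ : Tendsto φ l' l) :
    EntryO l' (fun x => F (φ x)) (fun x => g (φ x)) :=
  fun i j => (h i j).comp_tendsto hφ

end BigO

/-! ### Approximate joint diagonalization -/

section JointDiagonalization

variable {𝕜 : Type*} [RCLike 𝕜] {α : Type*} {l : Filter α} {d R : ℕ} {ν : α → ℝ}
  {lam : Fin d → Fin R → 𝕜}

/-- Perturbation of the diagonal under approximate joint diagonalization, when the dominant entry
in each column of the transformation is known. -/
theorem approxDiag_of_dominant [l.NeBot] (hlam : Function.Injective lam)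
    (hν : Tendsto ν l (𝓝 0)) (hν0 : ∀ x, 0 ≤ ν x)
    {F : α → Fin R → Matrix (Fin d) (Fin d) 𝕜}
    (hF : ∀ r, EntryO l (fun x => F x r - Matrix.diagonal (fun i => lam i r)) ν)
    {Y P : α → Matrix (Fin d) (Fin d) 𝕜} (hPY : ∀ᶠ x in l, P x * Y x = 1)
    (hY : EntryO l Y (fun _ => 1))
    (hoff : ∀ r i j, i ≠ j → (fun x => (P x * F x r * Y x) i j) =O[l] ν)
    {t : Fin d → Fin d} (ht : ∀ j, (fun _ => (1 : ℝ)) =O[l] (fun x => Y x (t j) j)) :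
    EntryO l P (fun _ => 1) ∧ Function.Bijective t ∧
      ∀ j r, (fun x => (P x * F x r * Y x) j j - F x r (t j) (t j)) =O[l] (fun x => ν x ^ 2) := by
  have hν1 := isBigO_one_of_tendsto hν
  have hν2 := isBigO_sq_of_tendsto hν
  set M : Fin R → α → Matrix (Fin d) (Fin d) 𝕜 := fun r x => P x * F x r * Y x with hM
  set Θ : Fin R → α → Matrix (Fin d) (Fin d) 𝕜 :=
    fun r x => Matrix.diagonal (fun i => M r x i i) with hΘ
  set Λ : Fin R → Matrix (Fin d) (Fin d) 𝕜 := fun r => Matrix.diagonal (fun i => lam i r) with hΛ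
  have hYP : ∀ᶠ x in l, Y x * P x = 1 := hPY.mono fun x hx => mul_eq_one_comm.mp hx
  have hoffO : ∀ r, EntryO l (fun x => M r x - Θ r x) ν := by
    intro r i j
    by_cases hij : i = j
    · subst hij; simpa [hΘ] using isBigO_zero ν l
    · simpa [hΘ, hij] using hoff r i j hij
  -- The columns of Y are approximate joint eigenvectors of the diagonal matrices Λ_r. Column j
  -- therefore concentrates on its dominant row t j, with approximate eigenvalues λ_{t j}.
  have hcolO : ∀ r, EntryO l (fun x => Λ r * Y x - Y x * Θ r x) ν := by
    intro r
    refine ((hY.bdd_mul (hoffO r)).sub ((hF r).mul_bdd hY)).congr' ?_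
    filter_upwards [hYP] with x hx
    have : Y x * M r x = F x r * Y x := by
      simp only [hM, ← Matrix.mul_assoc]
      rw [hx, Matrix.one_mul]
    rw [Matrix.mul_sub, this, Matrix.sub_mul]
    abel
  have key1 : ∀ r i j, (fun x => (lam i r - M r x j j) * Y x i j) =O[l] ν := by
    intro r i j
    refine (hcolO r i j).congr_left fun x => ?_
    simp only [Matrix.sub_apply, hΛ, hΘ, Matrix.diagonal_mul, Matrix.mul_diagonal]
    ring
  have key2 : ∀ r j, (fun x => lam (t j) r - M r x j j) =O[l] ν :=
    fun r j => isBigO_of_mul (key1 r (t j) j) (ht j)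
  -- The separating mode r depends on a and j; joint distinctness supplies one for each pair.
  have key3 : ∀ a j, a ≠ t j → ∃ r, (fun _ => (1 : ℝ)) =O[l] (fun x => lam a r - M r x j j) := by
    intro a j haj
    obtain ⟨r, hr⟩ := Function.ne_iff.mp fun h' => haj (hlam h')
    refine ⟨r, one_isBigO_of_tendsto (a := lam a r - lam (t j) r) ?_ (sub_ne_zero.mpr hr)⟩
    have := ((key2 r j).trans_tendsto hν).add_const (lam a r - lam (t j) r)
    simpa using this
  have key4 : ∀ a j, a ≠ t j → (fun x => Y x a j) =O[l] ν := by
    intro a j haj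
    obtain ⟨r, hr⟩ := key3 a j haj
    exact isBigO_of_mul ((key1 r a j).congr_left fun x => mul_comm _ _) hr
  -- P = Y⁻¹ is not yet known to be bounded. Its size π is carried through the row estimates and
  -- absorbed afterwards.
  set π : α → ℝ := fun x => ∑ i, ∑ j, ‖P x i j‖ with hπ
  have hPπ : EntryO l P π := EntryO.entrySum P
  have hπ0 : ∀ x, 0 ≤ π x := fun x => by positivity
  have hrowO : ∀ r, EntryO l (fun x => Θ r x * P x - P x * Λ r) (fun x => ν x * π x) := by
    intro r
    have h1 : EntryO l (fun x => P x * (F x r - Λ r)) (fun x => ν x * π x) := by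
      simpa [mul_comm] using hPπ.mul (hF r)
    refine (h1.sub ((hoffO r).mul hPπ)).congr' ?_
    filter_upwards [hYP] with x hx
    have : M r x * P x = P x * F x r := by
      simp only [hM]
      rw [Matrix.mul_assoc _ (Y x), hx, Matrix.mul_one]
    rw [Matrix.sub_mul, this, Matrix.mul_sub]
    abel
  have keyP : ∀ a j, a ≠ t j → (fun x => P x j a) =O[l] (fun x => ν x * π x) := by
    intro a j haj
    obtain ⟨r, hr⟩ := key3 a j haj
    refine isBigO_of_mul ((hrowO r j a).neg_left.congr_left fun x => ?_) hr
    simp only [Matrix.sub_apply, hΛ, hΘ, Matrix.diagonal_mul, Matrix.mul_diagonal]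
    ring
  set g : α → ℝ := fun x => 1 + ν x * π x with hg
  have hg1 : (fun _ => (1 : ℝ)) =O[l] g := by
    refine IsBigO.of_bound 1 (Eventually.of_forall fun x => ?_)
    have := mul_nonneg (hν0 x) (hπ0 x)
    rw [one_mul, norm_one, Real.norm_eq_abs, abs_of_nonneg] <;> simp only [hg] <;> linarith
  have hg2 : (fun x => ν x * π x) =O[l] g := by
    refine IsBigO.of_bound 1 (Eventually.of_forall fun x => ?_)
    have := mul_nonneg (hν0 x) (hπ0 x)
    rw [one_mul, Real.norm_eq_abs, Real.norm_eq_abs, abs_of_nonneg this, abs_of_nonneg] <;>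
      simp only [hg] <;> linarith
  have hPg : EntryO l P g := by
    intro j a
    by_cases haj : a = t j
    · subst haj
      refine isBigO_of_mul ?_ (ht j)
      have h1 : (fun x => (1 : 𝕜) - ∑ a ∈ Finset.univ.erase (t j), P x j a * Y x a j) =O[l] g := by
        refine IsBigO.sub ?_ (IsBigO.fun_sum fun a ha => ?_)
        · exact (isBigO_const_const (1 : 𝕜) (one_ne_zero (α := ℝ)) l).trans hg1
        · simpa using ((keyP a j (Finset.ne_of_mem_erase ha)).trans hg2).mul (hY a j)
      refine h1.congr' ?_ EventuallyEq.rfl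
      filter_upwards [hPY] with x hx
      have h2 := congrFun (congrFun hx j) j
      rw [Matrix.mul_apply, Matrix.one_apply_eq,
        ← Finset.add_sum_erase _ _ (Finset.mem_univ (t j))] at h2
      rw [← h2]; ring
    · exact (keyP a j haj).trans hg2
  have hπg : π =O[l] g := IsBigO.fun_sum fun i _ => IsBigO.fun_sum fun j _ => (hPg i j).norm_left
  -- From π ≤ C (1 + ν π) and C ν < 1/2 follows π ≤ 2C.
  have hπ1 : π =O[l] (fun _ => (1 : ℝ)) := by
    obtain ⟨C, hC0, hC⟩ := hπg.exists_pos
    have hsmall : ∀ᶠ x in l, C * ν x < 1 / 2 := by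
      have : Tendsto (fun x => C * ν x) l (𝓝 0) := by simpa using hν.const_mul C
      exact this.eventually_lt_const (by norm_num)
    refine IsBigO.of_bound (2 * C) ?_
    filter_upwards [hC.bound, hsmall] with x hx hx2
    have h3 := mul_nonneg (hν0 x) (hπ0 x)
    rw [Real.norm_eq_abs, Real.norm_eq_abs, abs_of_nonneg (hπ0 x),
      abs_of_nonneg (by simp only [hg]; linarith)] at hx
    rw [Real.norm_eq_abs, abs_of_nonneg (hπ0 x), norm_one, mul_one]
    simp only [hg] at hx
    nlinarith [mul_le_mul_of_nonneg_right hx2.le (hπ0 x)]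
  have hP1 : EntryO l P (fun _ => 1) := hPπ.trans hπ1
  have keyP' : ∀ a j, a ≠ t j → (fun x => P x j a) =O[l] ν := fun a j haj =>
    (keyP a j haj).trans (by simpa using (isBigO_refl ν l).mul hπ1)
  have hsum : ∀ j k, (fun x => (1 : Matrix (Fin d) (Fin d) 𝕜) j k - P x j (t j) * Y x (t j) k)
      =O[l] ν := by
    intro j k
    have h1 : (fun x => ∑ a ∈ Finset.univ.erase (t j), P x j a * Y x a k) =O[l] ν := by
      refine IsBigO.fun_sum fun a ha => ?_
      simpa using (keyP' a j (Finset.ne_of_mem_erase ha)).mul (hY a k)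
    refine h1.congr' ?_ EventuallyEq.rfl
    filter_upwards [hPY] with x hx
    rw [← hx, Matrix.mul_apply, ← Finset.add_sum_erase _ _ (Finset.mem_univ (t j))]
    ring
  -- If two columns shared a dominant row, (P Y)_{jk} = 0 would make P_{j,t j} = O(ν), contradicting
  -- (P Y)_{jj} = 1. This conclusion needs the filter to be nontrivial.
  have hinj : Function.Injective t := by
    intro j k hjk
    by_contra hne
    have h1 : (fun x => P x j (t j) * Y x (t j) k) =O[l] ν := by
      simpa [Matrix.one_apply_ne hne] using hsum j k
    have h2 : (fun x => P x j (t j)) =O[l] ν := isBigO_of_mul h1 (by rw [hjk]; exact ht k)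
    have h3 : (fun x => P x j (t j) * Y x (t j) j) =O[l] ν := by simpa using h2.mul (hY (t j) j)
    have h4 : (fun _ => (1 : 𝕜)) =O[l] ν := by simpa using (hsum j j).add h3
    have h5 := h4.trans_tendsto hν
    exact one_ne_zero (tendsto_nhds_unique h5 tendsto_const_nhds).symm
  refine ⟨hP1, Finite.injective_iff_bijective.mp hinj, fun j r => ?_⟩
  have hFb : EntryO l (fun x => F x r) (fun _ => 1) := (hF r).bdd_of_sub hν
  -- Subtracting the scalar F_{t j,t j} makes the entry of H at (t j, t j) vanish. Every other term
  -- of (P H Y)_{jj} contains two O(ν) factors among P, H and Y, so the diagonal error is quadratic.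
  set H : α → Matrix (Fin d) (Fin d) 𝕜 := fun x => F x r - F x r (t j) (t j) • 1 with hH
  have hH1 : EntryO l H (fun _ => 1) := by
    refine hFb.sub fun a b => ?_
    simp only [Matrix.smul_apply, smul_eq_mul]
    simpa using (hFb (t j) (t j)).mul (EntryO.const (1 : Matrix (Fin d) (Fin d) 𝕜) a b)
  have hHoff : ∀ a b, a ≠ b → (fun x => H x a b) =O[l] ν := by
    intro a b hab
    refine (hF r a b).congr_left fun x => ?_
    simp [hH, hab]
  have h1 : (fun x => ∑ b, ∑ a, P x j a * H x a b * Y x b j) =O[l] (fun x => ν x ^ 2) := by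
    refine IsBigO.fun_sum fun b _ => IsBigO.fun_sum fun a _ => ?_
    by_cases ha : a = t j
    · by_cases hb : b = t j
      · subst ha; subst hb
        simpa [hH] using isBigO_zero _ l
      · have := ((hP1 j a).mul (hHoff a b (by rw [ha]; exact fun h => hb h.symm))).mul
          (key4 b j hb)
        simpa [sq] using this
    · by_cases hb : b = t j
      · have := ((keyP' a j ha).mul (hHoff a b (by rw [hb]; exact ha))).mul (hY b j)
        simpa [sq] using this
      · have := ((keyP' a j ha).mul (hH1 a b)).mul (key4 b j hb)
        simpa [sq] using this
  refine h1.congr' ?_ EventuallyEq.rfl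
  filter_upwards [hPY] with x hx
  have h2 : P x * H x * Y x = M r x - F x r (t j) (t j) • 1 := by
    simp only [hH, hM, Matrix.mul_sub, Matrix.sub_mul, Matrix.mul_smul, Matrix.smul_mul,
      Matrix.mul_one, hx]
  have h3 := congrFun (congrFun h2 j) j
  simp only [Matrix.sub_apply, Matrix.smul_apply, Matrix.one_apply_eq, smul_eq_mul, mul_one] at h3
  rw [← h3, Matrix.mul_apply]
  exact Finset.sum_congr rfl fun b _ => by rw [Matrix.mul_apply, Finset.sum_mul]

/-- Perturbation of the diagonal under approximate joint diagonalization. -/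
theorem approxDiag (hlam : Function.Injective lam) (hν : Tendsto ν l (𝓝 0)) (hν0 : ∀ x, 0 ≤ ν x)
    {F : α → Fin R → Matrix (Fin d) (Fin d) 𝕜}
    (hF : ∀ r, EntryO l (fun x => F x r - Matrix.diagonal (fun i => lam i r)) ν)
    {Y P : α → Matrix (Fin d) (Fin d) 𝕜} (hPY : ∀ᶠ x in l, P x * Y x = 1)
    (hY : EntryO l Y (fun _ => 1))
    (hcol : ∀ j, (fun _ => (1 : ℝ)) =O[l] (fun x => ∑ i, ‖Y x i j‖))
    (hoff : ∀ r i j, i ≠ j → (fun x => (P x * F x r * Y x) i j) =O[l] ν) :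
    EntryO l P (fun _ => 1) ∧ ∃ C, ∀ᶠ x in l, ∃ τ : Equiv.Perm (Fin d), ∀ i r,
      ‖(P x * F x r * Y x) (τ i) (τ i) - F x r i i‖ ≤ C * ν x ^ 2 := by
  -- The dominant rows may vary with x, but only finitely many maps t occur. The filter is split
  -- along the value of t, and empty pieces hold trivially.
  have hmax : ∀ x (j : Fin d), ∃ i, ∀ k, ‖Y x k j‖ ≤ ‖Y x i j‖ := fun x j => by
    have : Nonempty (Fin d) := ⟨j⟩
    exact Finite.exists_max fun k => ‖Y x k j‖
  choose τ hτ using hmax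
  have hpiece : ∀ t : Fin d → Fin d, (l ⊓ 𝓟 {x | τ x = t}).NeBot →
      EntryO (l ⊓ 𝓟 {x | τ x = t}) P (fun _ => 1) ∧ Function.Bijective t ∧
      ∀ j r, (fun x => (P x * F x r * Y x) j j - F x r (t j) (t j))
        =O[l ⊓ 𝓟 {x | τ x = t}] (fun x => ν x ^ 2) := by
    intro t hne
    have hle : l ⊓ 𝓟 {x | τ x = t} ≤ l := inf_le_left
    refine approxDiag_of_dominant hlam (hν.mono_left hle) hν0 (fun r i j => (hF r i j).mono hle)
      (hPY.filter_mono hle) (fun i j => (hY i j).mono hle)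
      (fun r i j hij => (hoff r i j hij).mono hle) fun j => ?_
    refine ((hcol j).mono hle).trans (IsBigO.of_bound d ?_)
    refine eventually_inf_principal.mpr (Eventually.of_forall fun x hx => ?_)
    rw [Real.norm_eq_abs, abs_of_nonneg (Finset.sum_nonneg fun i _ => norm_nonneg _)]
    refine (Finset.sum_le_sum fun i _ => hτ x j i).trans ?_
    rw [Set.mem_ofPred_eq] at hx
    simp [hx]
  refine ⟨fun i j => ?_, ?_⟩
  · have h1 := exists_bound_of_pieces (l := l) τ (p := fun _ C x => 0 ≤ C ∧ ‖P x i j‖ ≤ C)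
      (fun _ _ _ _ hC h => ⟨h.1.trans hC, h.2.trans hC⟩) fun t => by
        rcases eq_or_neBot (l ⊓ 𝓟 {x | τ x = t}) with hb | hb
        · exact ⟨0, by rw [hb]; exact eventually_bot⟩
        · obtain ⟨C, hC0, hC⟩ := ((hpiece t hb).1 i j).exists_pos
          exact ⟨C, hC.bound.mono fun x hx => ⟨hC0.le, by simpa using hx⟩⟩
    obtain ⟨C, hC⟩ := h1
    exact IsBigO.of_bound C (hC.mono fun x hx => by simpa using hx.2)
  · have h1 := exists_bound_of_pieces (l := l) τ (p := fun t C x => Function.Bijective t ∧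
        ∀ j r, ‖(P x * F x r * Y x) j j - F x r (t j) (t j)‖ ≤ C * ν x ^ 2)
      (fun _ _ _ _ hC h => ⟨h.1, fun j r => (h.2 j r).trans (by gcongr)⟩) fun t => by
        rcases eq_or_neBot (l ⊓ 𝓟 {x | τ x = t}) with hb | hb
        · exact ⟨0, by rw [hb]; exact eventually_bot⟩
        · obtain ⟨-, hbij, hO⟩ := hpiece t hb
          choose C hC0 hC using fun j r => (hO j r).exists_pos
          refine ⟨∑ j, ∑ r, C j r, ?_⟩
          have h2 := eventually_all.mpr fun j => eventually_all.mpr fun r => (hC j r).bound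
          filter_upwards [h2] with x hx
          refine ⟨hbij, fun j r => (hx j r).trans ?_⟩
          rw [Real.norm_eq_abs, abs_of_nonneg (by positivity)]
          gcongr
          exact (Finset.single_le_sum (f := fun r => C j r) (fun r _ => (hC0 j r).le)
            (Finset.mem_univ r)).trans (Finset.single_le_sum (f := fun j => ∑ r, C j r)
            (fun j _ => Finset.sum_nonneg fun r _ => (hC0 j r).le) (Finset.mem_univ j))
    obtain ⟨C, hC⟩ := h1
    refine ⟨C, hC.mono fun x hx => ?_⟩
    -- The map t sends estimated columns to sources; the required relabelling goes the other way.
    refine ⟨(Equiv.ofBijective _ hx.1).symm, fun i r => ?_⟩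
    have := hx.2 ((Equiv.ofBijective _ hx.1).symm i) r
    have h3 : τ x ((Equiv.ofBijective _ hx.1).symm i) = i :=
      (Equiv.ofBijective _ hx.1).apply_symm_apply i
    rwa [h3] at this

end JointDiagonalization

/-! ### Existence and stability of joint eigendecompositions -/

section JointEigenbasis

variable {𝕜 : Type*} [RCLike 𝕜] {d R : ℕ}

theorem offDiagonal_nonneg (G : Fin R → Matrix (Fin d) (Fin d) 𝕜)
    (Q : Matrix (Fin d) (Fin d) 𝕜) : 0 ≤ offDiagonal G Q := by
  refine Finset.sum_nonneg fun r _ => Finset.sum_nonneg fun i _ => Finset.sum_nonneg fun j _ => ?_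
  split_ifs <;> positivity

theorem sq_norm_le_offDiagonal (G : Fin R → Matrix (Fin d) (Fin d) 𝕜)
    (Q : Matrix (Fin d) (Fin d) 𝕜) (r : Fin R) {i j : Fin d} (hij : i ≠ j) :
    ‖(Q⁻¹ * G r * Q) i j‖ ^ 2 ≤ offDiagonal G Q := by
  have h0 : ∀ r i j, 0 ≤ if i = j then 0 else ‖(Q⁻¹ * G r * Q) i j‖ ^ 2 := by
    intro r i j; split_ifs <;> positivity
  calc ‖(Q⁻¹ * G r * Q) i j‖ ^ 2
      = if i = j then 0 else ‖(Q⁻¹ * G r * Q) i j‖ ^ 2 := by rw [if_neg hij]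
    _ ≤ ∑ j, if i = j then 0 else ‖(Q⁻¹ * G r * Q) i j‖ ^ 2 :=
        Finset.single_le_sum (f := fun j => if i = j then 0 else ‖(Q⁻¹ * G r * Q) i j‖ ^ 2)
          (fun j _ => h0 r i j) (Finset.mem_univ j)
    _ ≤ ∑ i, ∑ j, if i = j then 0 else ‖(Q⁻¹ * G r * Q) i j‖ ^ 2 :=
        Finset.single_le_sum (f := fun i => ∑ j, if i = j then 0 else ‖(Q⁻¹ * G r * Q) i j‖ ^ 2)
          (fun i _ => Finset.sum_nonneg fun j _ => h0 r i j) (Finset.mem_univ i)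
    _ ≤ _ := Finset.single_le_sum
          (f := fun r => ∑ i, ∑ j, if i = j then 0 else ‖(Q⁻¹ * G r * Q) i j‖ ^ 2)
          (fun r _ => Finset.sum_nonneg fun i _ => Finset.sum_nonneg fun j _ => h0 r i j)
          (Finset.mem_univ r)

theorem IsUnitBasis.norm_le_one {Q : Matrix (Fin d) (Fin d) 𝕜} (hQ : IsUnitBasis Q)
    (i j : Fin d) : ‖Q i j‖ ≤ 1 := by
  have h3 : ‖Q i j‖ ^ 2 ≤ 1 := hQ.2 j ▸ Finset.single_le_sum
    (f := fun k => ‖Q k j‖ ^ 2) (fun k _ => by positivity) (Finset.mem_univ i)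
  exact (sq_le_one_iff₀ (norm_nonneg _)).mp h3

theorem isCompact_entries_le (C : ℝ) :
    IsCompact {Q : Matrix (Fin d) (Fin d) 𝕜 | ∀ i j, ‖Q i j‖ ≤ C} := by
  have h : IsCompact (Set.pi Set.univ fun _ : Fin d => Set.pi Set.univ fun _ : Fin d =>
      Metric.closedBall (0 : 𝕜) C) :=
    isCompact_univ_pi fun _ => isCompact_univ_pi fun _ => isCompact_closedBall _ _
  have e : {Q : Fin d → Fin d → 𝕜 | ∀ i j, ‖Q i j‖ ≤ C} = Set.pi Set.univ fun _ : Fin d =>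
      Set.pi Set.univ fun _ : Fin d => Metric.closedBall (0 : 𝕜) C := by
    ext Q
    simp [Set.mem_pi]
  rw [← e] at h
  exact h

/-- The joint off-diagonal energy has a minimizer, provided that a sublevel set consists of
uniformly well-conditioned bases. -/
theorem exists_isJointEigenbasis {G : Fin R → Matrix (Fin d) (Fin d) 𝕜}
    {Q₀ : Matrix (Fin d) (Fin d) 𝕜} (hQ₀ : IsUnitBasis Q₀) {C : ℝ}
    (hC : ∀ Q, IsUnitBasis Q → offDiagonal G Q ≤ offDiagonal G Q₀ → ∀ i j, ‖Q⁻¹ i j‖ ≤ C)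
    {c : ℝ} (hc : 1 ≤ c) : ∃ Q, IsJointEigenbasis c G Q := by
  -- Invertibility is not a closed condition, so the minimization runs over pairs (Q, Q⁻¹). Together
  -- with the bound C on the inverse this set is compact, and the energy becomes polynomial in the
  -- entries and their conjugates.
  let K : Set (Matrix (Fin d) (Fin d) 𝕜 × Matrix (Fin d) (Fin d) 𝕜) :=
    {q | q.1 * q.2 = 1 ∧ (∀ j, ∑ i, ‖q.1 i j‖ ^ 2 = 1) ∧ ∀ i j, ‖q.2 i j‖ ≤ C}
  have hunit : ∀ q ∈ K, IsUnitBasis q.1 ∧ q.1⁻¹ = q.2 := fun q hq =>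
    ⟨⟨Matrix.isUnit_det_of_right_inverse hq.1, hq.2.1⟩, Matrix.inv_eq_right_inv hq.1⟩
  have hK : IsCompact K := by
    refine ((isCompact_entries_le 1).prod (isCompact_entries_le C)).of_isClosed_subset ?_ ?_
    · have hcl1 : IsClosed {q : Matrix (Fin d) (Fin d) 𝕜 × Matrix (Fin d) (Fin d) 𝕜 |
          q.1 * q.2 = 1} := isClosed_eq (continuous_fst.matrix_mul continuous_snd) continuous_const
      have hcl2 : IsClosed {q : Matrix (Fin d) (Fin d) 𝕜 × Matrix (Fin d) (Fin d) 𝕜 |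
          ∀ j, ∑ i, ‖q.1 i j‖ ^ 2 = 1} := by
        simp only [Set.ofPred_forall]
        refine isClosed_iInter fun j => isClosed_eq ?_ continuous_const
        exact continuous_finsetSum _ fun i _ => ((continuous_fst.matrix_elem i j).norm).pow 2
      have hcl3 : IsClosed {q : Matrix (Fin d) (Fin d) 𝕜 × Matrix (Fin d) (Fin d) 𝕜 |
          ∀ i j, ‖q.2 i j‖ ≤ C} := by
        simp only [Set.ofPred_forall]
        exact isClosed_iInter fun i => isClosed_iInter fun j =>
          isClosed_le (continuous_snd.matrix_elem i j).norm continuous_const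
      exact hcl1.inter (hcl2.inter hcl3)
    · exact fun q hq => ⟨(hunit q hq).1.norm_le_one, hq.2.2⟩
  let f : Matrix (Fin d) (Fin d) 𝕜 × Matrix (Fin d) (Fin d) 𝕜 → ℝ :=
    fun q => ∑ r, ∑ i, ∑ j, if i = j then 0 else ‖(q.2 * G r * q.1) i j‖ ^ 2
  have hf : Continuous f := by
    refine continuous_finsetSum _ fun r _ => continuous_finsetSum _ fun i _ =>
      continuous_finsetSum _ fun j _ => ?_
    by_cases hij : i = j
    · simpa [hij] using continuous_const
    · simp only [if_neg hij]
      exact ((((continuous_snd.matrix_mul continuous_const).matrix_mul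
        continuous_fst).matrix_elem i j).norm).pow 2
  have hfK : ∀ q ∈ K, f q = offDiagonal G q.1 := fun q hq => by
    simp only [f, offDiagonal, (hunit q hq).2]
  have hmem : ∀ Q, IsUnitBasis Q → offDiagonal G Q ≤ offDiagonal G Q₀ → (Q, Q⁻¹) ∈ K :=
    fun Q hQ hle => ⟨Matrix.mul_nonsing_inv _ hQ.1, hQ.2, hC Q hQ hle⟩
  obtain ⟨q, hq, hmin⟩ := hK.exists_isMinOn ⟨_, hmem Q₀ hQ₀ le_rfl⟩ hf.continuousOn
  have hmin' : ∀ Q, IsUnitBasis Q → offDiagonal G Q ≤ offDiagonal G Q₀ →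
      offDiagonal G q.1 ≤ offDiagonal G Q := fun Q hQ hle => by
    have h1 := hmin (hmem Q hQ hle)
    rw [Set.mem_ofPred_eq, hfK _ (hmem Q hQ hle), hfK q hq] at h1
    exact h1
  refine ⟨q.1, (hunit q hq).1, fun Q hQ => ?_⟩
  have h2 : offDiagonal G q.1 ≤ offDiagonal G Q := by
    rcases le_total (offDiagonal G Q) (offDiagonal G Q₀) with h | h
    · exact hmin' Q hQ h
    · exact (hmin' Q₀ hQ₀ le_rfl).trans h
  have h3 := offDiagonal_nonneg G Q
  -- An exact minimizer also satisfies the relaxed condition, because the energy is nonnegative and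
  -- c ≥ 1.
  nlinarith

variable {α : Type*} {l : Filter α} {ν : α → ℝ} {lam : Fin d → Fin R → 𝕜}

/-- Eigenvalue perturbation for bases of small joint off-diagonal energy. -/
theorem offDiagonal_perturbation (hlam : Function.Injective lam) (hν : Tendsto ν l (𝓝 0))
    (hν0 : ∀ x, 0 ≤ ν x) {G : α → Fin R → Matrix (Fin d) (Fin d) 𝕜}
    {T T' : α → Matrix (Fin d) (Fin d) 𝕜} (hT : EntryO l T (fun _ => 1))
    (hT' : EntryO l T' (fun _ => 1)) (hTT : ∀ᶠ x in l, T x * T' x = 1)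
    (hF : ∀ r, EntryO l (fun x => T' x * G x r * T x - Matrix.diagonal (fun i => lam i r)) ν)
    {Q : α → Matrix (Fin d) (Fin d) 𝕜} (hQ : ∀ᶠ x in l, IsUnitBasis (Q x))
    (hoff : (fun x => offDiagonal (G x) (Q x)) =O[l] (fun x => ν x ^ 2)) :
    EntryO l (fun x => (Q x)⁻¹) (fun _ => 1) ∧ ∃ C, ∀ᶠ x in l, ∃ τ : Equiv.Perm (Fin d), ∀ i r,
      ‖((Q x)⁻¹ * G x r * Q x) (τ i) (τ i) - (T' x * G x r * T x) i i‖ ≤ C * ν x ^ 2 := by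
  have hTT' : ∀ᶠ x in l, T' x * T x = 1 := hTT.mono fun x hx => mul_eq_one_comm.mp hx
  have hQb : EntryO l Q (fun _ => 1) := by
    intro i j
    refine IsBigO.of_bound 1 (hQ.mono fun x hx => ?_)
    simpa using hx.norm_le_one i j
  have hconj : ∀ᶠ x in l, ∀ r, (Q x)⁻¹ * T x * (T' x * G x r * T x) * (T' x * Q x)
      = (Q x)⁻¹ * G x r * Q x := by
    filter_upwards [hTT] with x hx r
    calc _ = (Q x)⁻¹ * (T x * T' x) * G x r * (T x * T' x) * Q x := by
          simp only [Matrix.mul_assoc]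
      _ = _ := by rw [hx, Matrix.mul_one, Matrix.mul_one]
  -- Express Q in the frame T. The columns of T' Q stay bounded below, because those of Q = T (T' Q)
  -- have unit norm and T is bounded.
  have hmain := approxDiag (F := fun x r => T' x * G x r * T x) (Y := fun x => T' x * Q x)
    (P := fun x => (Q x)⁻¹ * T x) hlam hν hν0 hF
    (by
      filter_upwards [hTT, hQ] with x hx hx2
      calc _ = (Q x)⁻¹ * (T x * T' x) * Q x := by simp only [Matrix.mul_assoc]
        _ = 1 := by rw [hx, Matrix.mul_one, Matrix.nonsing_inv_mul _ hx2.1])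
    (hT'.bdd_mul hQb)
    (fun j => by
      set S : α → ℝ := fun x => ∑ k, ‖(T' x * Q x) k j‖ with hS
      have h1 : ∀ i, (fun x => Q x i j) =O[l] S := by
        intro i
        have h2 : (fun x => ∑ k, T x i k * (T' x * Q x) k j) =O[l] S := by
          refine IsBigO.fun_sum fun k _ => ?_
          have h3 : (fun x => (T' x * Q x) k j) =O[l] S := by
            refine IsBigO.of_bound 1 (Eventually.of_forall fun x => ?_)
            rw [one_mul]
            exact (Finset.single_le_sum (f := fun k => ‖(T' x * Q x) k j‖)
              (fun k _ => norm_nonneg _) (Finset.mem_univ k)).trans (le_abs_self _)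
          simpa using (hT i k).mul h3
        refine h2.congr' ?_ EventuallyEq.rfl
        filter_upwards [hTT] with x hx
        rw [← Matrix.mul_apply, ← Matrix.mul_assoc, hx, Matrix.one_mul]
      have h4 : (fun x => ∑ i, ‖Q x i j‖ ^ 2) =O[l] (fun x => S x ^ 2) :=
        IsBigO.fun_sum fun i _ => (h1 i).norm_left.pow 2
      have h5 : (fun _ => (1 : ℝ) ^ 2) =O[l] (fun x => S x ^ 2) := by
        refine h4.congr' ?_ EventuallyEq.rfl
        filter_upwards [hQ] with x hx
        rw [hx.2 j, one_pow]
      exact h5.of_pow two_ne_zero)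
    (fun r i j hij => by
      have h1 : (fun x => ‖((Q x)⁻¹ * G x r * Q x) i j‖ ^ 2) =O[l] (fun x => ν x ^ 2) := by
        refine IsBigO.trans (IsBigO.of_bound 1 (Eventually.of_forall fun x => ?_)) hoff
        rw [one_mul, Real.norm_eq_abs, abs_of_nonneg (by positivity)]
        exact (sq_norm_le_offDiagonal (G x) (Q x) r hij).trans (le_abs_self _)
      refine (h1.of_pow two_ne_zero).of_norm_left.congr' ?_ EventuallyEq.rfl
      filter_upwards [hconj] with x hx
      rw [hx r])
  refine ⟨?_, ?_⟩
  · refine (hmain.1.mul_bdd hT').congr' ?_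
    filter_upwards [hTT] with x hx
    rw [Matrix.mul_assoc, hx, Matrix.mul_one]
  · obtain ⟨C, hC⟩ := hmain.2
    refine ⟨C, ?_⟩
    filter_upwards [hC, hconj] with x hx hx2
    obtain ⟨τ, hτ⟩ := hx
    refine ⟨τ, fun i r => ?_⟩
    have := hτ i r
    rwa [hx2 r] at this

/-- A basis that is well-conditioned and nearly diagonalizes can be normalized. -/
theorem exists_normalized_basis {G : α → Fin R → Matrix (Fin d) (Fin d) 𝕜}
    {T T' : α → Matrix (Fin d) (Fin d) 𝕜} (hT : EntryO l T (fun _ => 1))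
    (hT' : EntryO l T' (fun _ => 1)) (hTT : ∀ᶠ x in l, T x * T' x = 1)
    (hF : ∀ r, EntryO l (fun x => T' x * G x r * T x - Matrix.diagonal (fun i => lam i r)) ν) :
    ∃ Q : α → Matrix (Fin d) (Fin d) 𝕜, (∀ᶠ x in l, IsUnitBasis (Q x)) ∧
      (fun x => offDiagonal (G x) (Q x)) =O[l] (fun x => ν x ^ 2) := by
  -- The column norms of T. They are bounded above since T is, and below since T' T = 1 with T'
  -- bounded, so rescaling keeps the off-diagonal entries O(ν).
  set ρ : α → Fin d → ℝ := fun x j => Real.sqrt (∑ i, ‖T x i j‖ ^ 2) with hρ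
  have hρ0 : ∀ x j, 0 ≤ ρ x j := fun x j => Real.sqrt_nonneg _
  have hρsq : ∀ x j, ρ x j ^ 2 = ∑ i, ‖T x i j‖ ^ 2 := fun x j => Real.sq_sqrt (by positivity)
  have hρb : ∀ j, (fun x => ρ x j) =O[l] (fun _ => (1 : ℝ)) := by
    intro j
    have h1 : (fun x => ρ x j ^ 2) =O[l] (fun _ => (1 : ℝ) ^ 2) := by
      simp only [hρsq, one_pow]
      exact IsBigO.fun_sum fun i _ => by simpa using (hT i j).norm_left.pow 2
    exact h1.of_pow two_ne_zero
  have hTe : ∀ i j, (fun x => T x i j) =O[l] (fun x => ρ x j) := by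
    intro i j
    refine IsBigO.of_bound 1 (Eventually.of_forall fun x => ?_)
    rw [one_mul, Real.norm_eq_abs, abs_of_nonneg (hρ0 x j)]
    refine Real.le_sqrt_of_sq_le ?_
    exact Finset.single_le_sum (f := fun i => ‖T x i j‖ ^ 2) (fun i _ => by positivity)
      (Finset.mem_univ i)
  have hTT' : ∀ᶠ x in l, T' x * T x = 1 := hTT.mono fun x hx => mul_eq_one_comm.mp hx
  have hρ1 : ∀ j, (fun _ => (1 : ℝ)) =O[l] (fun x => ρ x j) := by
    intro j
    have h1 : (fun x => ∑ k, T' x j k * T x k j) =O[l] (fun x => ρ x j) :=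
      IsBigO.fun_sum fun k _ => by simpa using (hT' j k).mul (hTe k j)
    have h2 : (fun _ => (1 : 𝕜)) =O[l] (fun x => ρ x j) := by
      refine h1.congr' ?_ EventuallyEq.rfl
      filter_upwards [hTT'] with x hx
      rw [← Matrix.mul_apply, hx, Matrix.one_apply_eq]
    simpa using h2.norm_left
  have hρpos : ∀ᶠ x in l, ∀ j, ρ x j ≠ 0 := by
    rw [eventually_all]
    intro j
    obtain ⟨C, hC⟩ := (hρ1 j).bound
    filter_upwards [hC] with x hx h0
    rw [h0] at hx
    norm_num at hx
  have hρinv : ∀ j, (fun x => (ρ x j)⁻¹) =O[l] (fun _ => (1 : ℝ)) := by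
    intro j
    have := (hρ1 j).inv_rev (Eventually.of_forall fun x h => absurd h one_ne_zero)
    simpa using this
  refine ⟨fun x => T x * Matrix.diagonal (fun j => ((ρ x j : 𝕜))⁻¹), ?_, ?_⟩
  · filter_upwards [hTT, hρpos] with x hx hx2
    refine ⟨?_, fun j => ?_⟩
    · rw [Matrix.det_mul, Matrix.det_diagonal]
      refine (Matrix.isUnit_det_of_right_inverse hx).mul ?_
      rw [isUnit_iff_ne_zero, Finset.prod_ne_zero_iff]
      intro j _
      exact inv_ne_zero (by simpa using hx2 j)
    · simp only [Matrix.mul_diagonal, norm_mul, norm_inv, RCLike.norm_ofReal, mul_pow, inv_pow,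
        sq_abs]
      rw [← Finset.sum_mul, ← hρsq]
      exact mul_inv_cancel₀ (pow_ne_zero _ (hx2 j))
  · refine IsBigO.fun_sum fun r _ => IsBigO.fun_sum fun i _ => IsBigO.fun_sum fun j _ => ?_
    by_cases hij : i = j
    · simpa [hij] using isBigO_zero _ l
    · simp only [if_neg hij]
      have h1 : (fun x => (T' x * G x r * T x) i j) =O[l] ν :=
        (hF r i j).congr_left fun x => by simp [hij]
      have h2 : (fun x => ρ x i * ‖(T' x * G x r * T x) i j‖ * (ρ x j)⁻¹) =O[l] ν := by
        simpa using ((hρb i).mul h1.norm_left).mul (hρinv j)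
      refine (h2.pow 2).congr' ?_ EventuallyEq.rfl
      filter_upwards [hTT', hρpos] with x hx hx2
      have h3 : (T x * Matrix.diagonal (fun j => ((ρ x j : 𝕜))⁻¹))⁻¹
          = Matrix.diagonal (fun j => (ρ x j : 𝕜)) * T' x := by
        refine Matrix.inv_eq_left_inv ?_
        rw [← Matrix.mul_assoc, Matrix.mul_assoc _ (T' x), hx, Matrix.mul_one]
        exact diagonal_ofReal_mul_inv hx2
      have h4 : Matrix.diagonal (fun j => (ρ x j : 𝕜)) * T' x * G x r *
          (T x * Matrix.diagonal (fun j => ((ρ x j : 𝕜))⁻¹))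
          = Matrix.diagonal (fun j => (ρ x j : 𝕜)) * (T' x * G x r * T x) *
            Matrix.diagonal (fun j => ((ρ x j : 𝕜))⁻¹) := by simp only [Matrix.mul_assoc]
      rw [h3, h4, Matrix.mul_diagonal, Matrix.diagonal_mul, norm_mul, norm_mul, norm_inv,
        RCLike.norm_ofReal, RCLike.norm_ofReal, abs_of_nonneg (hρ0 x i), abs_of_nonneg (hρ0 x j)]

/-- Joint eigendecompositions of matrices close to jointly diagonalizable ones exist. -/
theorem eventually_exists_isJointEigenbasis (hlam : Function.Injective lam)
    (hν : Tendsto ν l (𝓝 0)) (hν0 : ∀ x, 0 ≤ ν x) {G : α → Fin R → Matrix (Fin d) (Fin d) 𝕜}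
    {T T' : α → Matrix (Fin d) (Fin d) 𝕜} (hT : EntryO l T (fun _ => 1))
    (hT' : EntryO l T' (fun _ => 1)) (hTT : ∀ᶠ x in l, T x * T' x = 1)
    (hF : ∀ r, EntryO l (fun x => T' x * G x r * T x - Matrix.diagonal (fun i => lam i r)) ν)
    {c : ℝ} (hc : 1 ≤ c) : ∀ᶠ x in l, ∃ Q, IsJointEigenbasis c (G x) Q := by
  obtain ⟨Q₀, hQ₀, hoff⟩ := exists_normalized_basis hT hT' hTT hF
  -- Parameters are paired with arbitrary competitors of energy no larger than the reference. A
  -- big-O bound along the pulled-back filter then bounds the inverses of all competitors at once,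
  -- as the compactness argument requires.
  let β := {q : α × Matrix (Fin d) (Fin d) 𝕜 //
    IsUnitBasis q.2 ∧ offDiagonal (G q.1) q.2 ≤ offDiagonal (G q.1) (Q₀ q.1)}
  let φ : β → α := fun q => q.1.1
  have hφ : Tendsto φ (comap φ l) l := tendsto_comap
  have h1 := (offDiagonal_perturbation (l := comap φ l) (ν := fun q => ν (φ q))
    (G := fun q => G (φ q)) (T := fun q => T (φ q)) (T' := fun q => T' (φ q))
    (Q := fun q : β => q.1.2) hlam (hν.comp hφ) (fun q => hν0 _) (hT.comp_tendsto hφ)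
    (hT'.comp_tendsto hφ) (hφ.eventually hTT) (fun r => (hF r).comp_tendsto hφ)
    (Eventually.of_forall fun q => q.2.1)
    (by
      refine IsBigO.trans (IsBigO.of_bound 1 (Eventually.of_forall fun q => ?_))
        (hoff.comp_tendsto hφ)
      rw [one_mul, Real.norm_eq_abs, abs_of_nonneg (offDiagonal_nonneg _ _)]
      exact q.2.2.trans (le_abs_self _))).1
  choose C hC0 hC using fun i j => (h1 i j).exists_pos
  have h2 := eventually_all.mpr fun i => eventually_all.mpr fun j => (hC i j).bound
  rw [eventually_comap] at h2
  filter_upwards [h2, hQ₀] with x hx hx2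
  refine exists_isJointEigenbasis hx2 (C := ∑ i, ∑ j, C i j) (fun Q hQ hle i j => ?_) hc
  have h3 := hx ⟨(x, Q), hQ, hle⟩ rfl i j
  rw [norm_one, mul_one] at h3
  exact h3.trans ((Finset.single_le_sum (f := fun j => C i j) (fun j _ => (hC0 i j).le)
    (Finset.mem_univ j)).trans (Finset.single_le_sum (f := fun i => ∑ j, C i j)
    (fun i _ => Finset.sum_nonneg fun j _ => (hC0 i j).le) (Finset.mem_univ i)))

/-- Eigenvalue perturbation for joint eigendecompositions. -/
theorem jointEigenbasis_perturbation (hlam : Function.Injective lam) (hν : Tendsto ν l (𝓝 0))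
    (hν0 : ∀ x, 0 ≤ ν x) {G : α → Fin R → Matrix (Fin d) (Fin d) 𝕜}
    {T T' : α → Matrix (Fin d) (Fin d) 𝕜} (hT : EntryO l T (fun _ => 1))
    (hT' : EntryO l T' (fun _ => 1)) (hTT : ∀ᶠ x in l, T x * T' x = 1)
    (hF : ∀ r, EntryO l (fun x => T' x * G x r * T x - Matrix.diagonal (fun i => lam i r)) ν)
    {c : ℝ} {Q : α → Matrix (Fin d) (Fin d) 𝕜}
    (hQ : ∀ x, IsJointEigenbasis c (G x) (Q x)) :
    ∃ C, ∀ᶠ x in l, ∃ τ : Equiv.Perm (Fin d), ∀ i r,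
      ‖((Q x)⁻¹ * G x r * Q x) (τ i) (τ i) - (T' x * G x r * T x) i i‖ ≤ C * ν x ^ 2 := by
  obtain ⟨Q₀, hQ₀, hoff⟩ := exists_normalized_basis hT hT' hTT hF
  -- Near-minimality compares the energy of Q with that of the normalized frame, which is O(ν²).
  refine (offDiagonal_perturbation hlam hν hν0 hT hT' hTT hF
    (Eventually.of_forall fun x => (hQ x).1) (IsBigO.trans (IsBigO.of_bound |c| ?_) hoff)).2
  filter_upwards [hQ₀] with x hx
  rw [Real.norm_eq_abs, abs_of_nonneg (offDiagonal_nonneg _ _), Real.norm_eq_abs, ← abs_mul]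
  exact ((hQ x).2 _ hx).trans (le_abs_self _)

end JointEigenbasis

/-! ### Expansion of the outputs, uniformly over all runs -/

section Estimators

variable {𝕜 : Type*} [RCLike 𝕜] {m n : Type*} [Fintype m] [DecidableEq m] [Fintype n]
  {d p R : ℕ} {s : Fin R → Type*} [∀ r, Fintype (s r)]
  {Y₀ : Matrix m n 𝕜} {A : Matrix m (Fin d) 𝕜} {J₁ J₂ : (r : Fin R) → Matrix (s r) m 𝕜}
  {lam : Fin d → Fin R → 𝕜} {Us : Matrix m (Fin d) 𝕜} {Un : Matrix m (Fin p) 𝕜} {σ : Fin d → ℝ}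
  {Vs : Matrix n (Fin d) 𝕜}

/-- Smallness of ν is the only information in `comap ν (𝓝 0)`, so an eventual statement along it
yields an explicit threshold valid for every x. -/
theorem exists_pos_of_eventually_comap {α : Type*} {ν : α → ℝ} {q : α → Prop}
    (h : ∀ᶠ x in comap ν (𝓝 0), q x) : ∃ ε > 0, ∀ x, |ν x| < ε → q x := by
  rw [eventually_comap, Metric.eventually_nhds_iff] at h
  obtain ⟨ε, hε, h⟩ := h
  exact ⟨ε, hε, fun x hx => h (by simpa using hx) x rfl⟩

omit [Fintype m] [DecidableEq m] [Fintype n] in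
theorem EntryO.of_norm_le {α : Type*} {l : Filter α} {ν : α → ℝ} {Δ : α → Matrix m n 𝕜} {K : ℝ}
    (h : ∀ x i j, ‖Δ x i j‖ ≤ K * ν x) : EntryO l Δ ν := by
  intro i j
  refine IsBigO.of_bound |K| (Eventually.of_forall fun x => (h x i j).trans ?_)
  rw [Real.norm_eq_abs, ← abs_mul]
  exact le_abs_self _

/-- Composition of an eigenvalue expansion with a map that is differentiable to second order. -/
theorem isBigO_comp_of_expansion {α : Type*} {l : Filter α} {ν : α → ℝ} (hν : Tendsto ν l (𝓝 0))
    {ψ : 𝕜 → ℝ} {ψ' : 𝕜 →L[ℝ] ℝ} {a : 𝕜}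
    (hψ : (fun z => ψ (a + z) - ψ a - ψ' z) =O[𝓝 0] (fun z => ‖z‖ ^ 2))
    {θ L : α → 𝕜} (hL : L =O[l] ν) (hθ : (fun x => θ x - a - L x) =O[l] (fun x => ν x ^ 2)) :
    (fun x => ψ (θ x) - ψ a - ψ' (L x)) =O[l] (fun x => ν x ^ 2) := by
  have h1 : (fun x => θ x - a) =O[l] ν := by
    simpa using (hθ.trans (isBigO_sq_of_tendsto hν)).add hL
  have h2 := (hψ.comp_tendsto (h1.trans_tendsto hν)).trans (h1.norm_left.pow 2)
  have h3 : (fun x => ψ' (θ x - a - L x)) =O[l] (fun x => ν x ^ 2) :=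
    (ψ'.isBigO_comp _ l).trans hθ
  refine (h2.add h3).congr_left fun x => ?_
  simp only [Function.comp_apply, add_sub_cancel, map_sub]
  ring

/-- First-order expansion of the estimates obtained from noisy data. -/
theorem IsShiftModel.eigenvalue_expansion (h : IsShiftModel Y₀ A J₁ J₂ lam)
    (hsvd : IsRankSVD Y₀ Us Un σ Vs) {P : (r : Fin R) → Matrix (Fin d) (s r) 𝕜}
    (hP : ∀ r, IsPinv (J₁ r * Us) (P r)) {Q₀ : Matrix (Fin d) (Fin d) 𝕜} (hQ₀ : IsUnit Q₀.det)
    (heig : ∀ r, P r * (J₂ r * Us) = Q₀ * Matrix.diagonal (fun i => lam i r) * Q₀⁻¹)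
    {α : Type*} {l : Filter α} {ν : α → ℝ} (hν : Tendsto ν l (𝓝 0)) (hν0 : ∀ x, 0 ≤ ν x)
    {Δ : α → Matrix m n 𝕜} (hΔ : EntryO l Δ ν) {ψ : 𝕜 → ℝ} {ψ' : Fin d → Fin R → 𝕜 →L[ℝ] ℝ}
    (hψ : ∀ i r, (fun z => ψ (lam i r + z) - ψ (lam i r) - ψ' i r z) =O[𝓝 0] (fun z => ‖z‖ ^ 2))
    {c : ℝ} {U : α → Matrix m (Fin d) 𝕜} {G : α → Fin R → Matrix (Fin d) (Fin d) 𝕜}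
    {Q : α → Matrix (Fin d) (Fin d) 𝕜} (hU : ∀ x, IsDominantLeft (Y₀ + Δ x) (U x))
    (hG : ∀ x r, IsLeastSquares (J₁ r * U x) (J₂ r * U x) (G x r))
    (hQ : ∀ x, IsJointEigenbasis c (G x) (Q x)) :
    ∃ C, ∀ᶠ x in l, ∃ τ : Equiv.Perm (Fin d), ∀ i r,
      |ψ (((Q x)⁻¹ * G x r * Q x) (τ i) (τ i)) - ψ (lam i r)
        - ψ' i r ((Q₀⁻¹ * P r * (J₂ r - lam i r • J₁ r) *
          subspaceError Un σ Vs (Δ x) * Q₀) i i)| ≤ C * ν x ^ 2 := by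
  obtain ⟨-, T, T', hT, hT', hTT, hGT⟩ := h.exists_frame hsvd hP hQ₀ heig hν hΔ hU
  have hG' := fun r => hGT r (fun x => G x r) (fun x => hG x r)
  obtain ⟨C₀, hC₀⟩ := jointEigenbasis_perturbation h.distinct hν hν0 hT hT' hTT
    (fun r => (hG' r).1) hQ
  set θ : α → Fin d → Fin R → 𝕜 := fun x i r => ((Q x)⁻¹ * G x r * Q x) i i with hθ
  set F : α → Fin d → Fin R → 𝕜 := fun x i r => (T' x * G x r * T x) i i with hF
  -- A total choice of relabelling, with the identity as a dummy where none works, so that the big-O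
  -- statements can be formed.
  have hτ : ∀ x, ∃ τ : Equiv.Perm (Fin d),
      (∃ τ' : Equiv.Perm (Fin d), ∀ i r, ‖θ x (τ' i) r - F x i r‖ ≤ C₀ * ν x ^ 2) →
        ∀ i r, ‖θ x (τ i) r - F x i r‖ ≤ C₀ * ν x ^ 2 := by
    intro x
    by_cases hx : ∃ τ' : Equiv.Perm (Fin d), ∀ i r, ‖θ x (τ' i) r - F x i r‖ ≤ C₀ * ν x ^ 2
    · exact ⟨hx.choose, fun _ => hx.choose_spec⟩
    · exact ⟨1, fun h => absurd h hx⟩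
  choose τ hτ using hτ
  have hE : EntryO l (fun x => subspaceError Un σ Vs (Δ x)) ν := hΔ.subspaceError
  have hbig : ∀ i r, (fun x => ψ (θ x (τ x i) r) - ψ (lam i r)
      - ψ' i r ((Q₀⁻¹ * P r * (J₂ r - lam i r • J₁ r) *
          subspaceError Un σ Vs (Δ x) * Q₀) i i)) =O[l] (fun x => ν x ^ 2) := by
    intro i r
    refine isBigO_comp_of_expansion hν (hψ i r) (((hE.const_mul _).mul_const _) i i) ?_
    have h1 : (fun x => θ x (τ x i) r - F x i r) =O[l] (fun x => ν x ^ 2) := by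
      refine IsBigO.of_bound |C₀| ?_
      filter_upwards [hC₀] with x hx
      refine (hτ x hx i r).trans ?_
      rw [Real.norm_eq_abs, ← abs_mul]
      exact le_abs_self _
    refine (h1.add ((hG' r).2 i)).congr_left fun x => ?_
    simp only [hF]
    ring
  choose C hC0 hC using fun i r => (hbig i r).exists_pos
  refine ⟨∑ i, ∑ r, C i r, ?_⟩
  filter_upwards [eventually_all.mpr fun i => eventually_all.mpr fun r => (hC i r).bound]
    with x hx
  refine ⟨τ x, fun i r => ?_⟩
  have h2 := hx i r
  rw [Real.norm_eq_abs, Real.norm_eq_abs, abs_of_nonneg (sq_nonneg (ν x))] at h2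
  refine h2.trans ?_
  gcongr
  exact (Finset.single_le_sum (f := fun r => C i r) (fun r _ => (hC0 i r).le)
    (Finset.mem_univ r)).trans (Finset.single_le_sum (f := fun i => ∑ r, C i r)
    (fun i _ => Finset.sum_nonneg fun r _ => (hC0 i r).le) (Finset.mem_univ i))

/-- The algorithms have an output for small noise. -/
theorem IsShiftModel.exists_output (h : IsShiftModel Y₀ A J₁ J₂ lam)
    {ω : Type*} {ν : ω → ℝ} (hν0 : ∀ w, 0 ≤ ν w) {Δ : ω → Matrix m n 𝕜} {K : ℝ}
    (hΔ : ∀ w i j, ‖Δ w i j‖ ≤ K * ν w) {c : ℝ} (hc : 1 ≤ c) :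
    ∃ ε > 0, ∀ w, ν w < ε →
      ∃ (U : Matrix m (Fin d) 𝕜) (G : Fin R → Matrix (Fin d) (Fin d) 𝕜)
        (Q : Matrix (Fin d) (Fin d) 𝕜), IsDominantLeft (Y₀ + Δ w) U ∧
        (∀ r, IsLeastSquares (J₁ r * U) (J₂ r * U) (G r)) ∧ IsJointEigenbasis c G Q := by
  obtain ⟨p, Us, Un, σ, Vs, hsvd⟩ := h.exists_isRankSVD
  choose P hP using h.exists_isPinv hsvd
  obtain ⟨Q₀, hQ₀, heig⟩ := h.exists_eigenvectors hsvd
  have heig' := fun r => heig r (P r) (hP r)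
  obtain ⟨L, hL⟩ := h.left_inv
  have hdom : ∀ w, ∃ U : Matrix m (Fin d) 𝕜, IsDominantLeft (Y₀ + Δ w) U := fun w => by
    obtain ⟨-, U, -, hU, -⟩ :=
      exists_isDominantLeft (d := d) (Y₀ + Δ w) (le_card_of_left_inverse hL)
    exact ⟨U, hU⟩
  choose U hU using hdom
  have hν : Tendsto ν (comap ν (𝓝 0)) (𝓝 0) := tendsto_comap
  obtain ⟨hex, T, T', hT, hT', hTT, hGT⟩ :=
    h.exists_frame hsvd hP hQ₀ heig' hν (EntryO.of_norm_le hΔ) hU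
  have hLS : ∀ w r, ∃ G, (∃ L : Matrix (Fin d) (s r) 𝕜, L * (J₁ r * U w) = 1) →
      IsLeastSquares (J₁ r * U w) (J₂ r * U w) G := fun w r => by
    by_cases hw : ∃ L : Matrix (Fin d) (s r) 𝕜, L * (J₁ r * U w) = 1
    · obtain ⟨L', hL'⟩ := hw
      exact ⟨_, fun _ => ⟨_, isPinv_gram (isUnit_det_gram hL'), rfl⟩⟩
    · exact ⟨0, fun h => absurd h hw⟩
  choose G hG using hLS
  obtain ⟨ε₁, hε₁, hex₁⟩ := exists_pos_of_eventually_comap hex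
  -- `exists_frame` asks for least squares solutions at every parameter, so it is applied again on
  -- the subtype where G is genuine.
  let β := {w : ω // ∀ r, IsLeastSquares (J₁ r * U w) (J₂ r * U w) (G w r)}
  have hν' : Tendsto (fun w : β => ν w.1) (comap (fun w : β => ν w.1) (𝓝 0)) (𝓝 0) :=
    tendsto_comap
  obtain ⟨-, T, T', hT, hT', hTT, hGT⟩ :=
    h.exists_frame hsvd hP hQ₀ heig' hν' (EntryO.of_norm_le (K := K) fun w : β => hΔ w.1)
      (fun w : β => hU w.1)
  have hQ := eventually_exists_isJointEigenbasis h.distinct hν' (fun w : β => hν0 w.1)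
    (G := fun w : β => G w.1) hT hT' hTT
    (fun r => (hGT r (fun w => G w.1 r) (fun w => w.2 r)).1) hc
  obtain ⟨ε₂, hε₂, hex₂⟩ := exists_pos_of_eventually_comap hQ
  refine ⟨min ε₁ ε₂, lt_min hε₁ hε₂, fun w hw => ?_⟩
  have habs : |ν w| = ν w := abs_of_nonneg (hν0 w)
  have hGw : ∀ r, IsLeastSquares (J₁ r * U w) (J₂ r * U w) (G w r) := fun r =>
    hG w r (hex₁ w (habs.trans_lt (hw.trans_le (min_le_left _ _))) r)
  obtain ⟨Q, hQ⟩ := hex₂ ⟨w, hGw⟩ (habs.trans_lt (hw.trans_le (min_le_right _ _)))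
  exact ⟨U w, G w, Q, hU w, hGw, hQ⟩

/-- The algorithms have an output for small noise, and each output has the predicted first-order
error. -/
theorem IsShiftModel.estimator_expansion (h : IsShiftModel Y₀ A J₁ J₂ lam)
    (hsvd : IsRankSVD Y₀ Us Un σ Vs) {P : (r : Fin R) → Matrix (Fin d) (s r) 𝕜}
    (hP : ∀ r, IsPinv (J₁ r * Us) (P r)) {Q₀ : Matrix (Fin d) (Fin d) 𝕜} (hQ₀ : IsUnit Q₀.det)
    (heig : ∀ r, P r * (J₂ r * Us) = Q₀ * Matrix.diagonal (fun i => lam i r) * Q₀⁻¹)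
    {ω : Type*} {ν : ω → ℝ} (hν0 : ∀ w, 0 ≤ ν w) {Δ : ω → Matrix m n 𝕜} {K : ℝ}
    (hΔ : ∀ w i j, ‖Δ w i j‖ ≤ K * ν w) {ψ : 𝕜 → ℝ} {ψ' : Fin d → Fin R → 𝕜 →L[ℝ] ℝ}
    (hψ : ∀ i r, (fun z => ψ (lam i r + z) - ψ (lam i r) - ψ' i r z) =O[𝓝 0] (fun z => ‖z‖ ^ 2))
    {c : ℝ} (hc : 1 ≤ c) :
    ∃ ε > 0, ∃ C : ℝ, ∀ w, ν w < ε →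
      (∃ (U : Matrix m (Fin d) 𝕜) (G : Fin R → Matrix (Fin d) (Fin d) 𝕜)
        (Q : Matrix (Fin d) (Fin d) 𝕜), IsDominantLeft (Y₀ + Δ w) U ∧
        (∀ r, IsLeastSquares (J₁ r * U) (J₂ r * U) (G r)) ∧ IsJointEigenbasis c G Q) ∧
      ∀ (U : Matrix m (Fin d) 𝕜) (G : Fin R → Matrix (Fin d) (Fin d) 𝕜)
        (Q : Matrix (Fin d) (Fin d) 𝕜), IsDominantLeft (Y₀ + Δ w) U →
        (∀ r, IsLeastSquares (J₁ r * U) (J₂ r * U) (G r)) → IsJointEigenbasis c G Q →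
        ∃ τ : Equiv.Perm (Fin d), ∀ i r,
          |ψ ((Q⁻¹ * G r * Q) (τ i) (τ i)) - ψ (lam i r)
            - ψ' i r ((Q₀⁻¹ * P r * (J₂ r - lam i r • J₁ r) *
              subspaceError Un σ Vs (Δ w) * Q₀) i i)| ≤ C * ν w ^ 2 := by
  obtain ⟨ε₁, hε₁, hex₁⟩ := h.exists_output hν0 hΔ hc
  -- A point is the noise together with a complete run of the algorithm. The constant obtained along
  -- this filter therefore serves every output simultaneously.
  let β := {q : ω × Matrix m (Fin d) 𝕜 × (Fin R → Matrix (Fin d) (Fin d) 𝕜) ×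
    Matrix (Fin d) (Fin d) 𝕜 // IsDominantLeft (Y₀ + Δ q.1) q.2.1 ∧
      (∀ r, IsLeastSquares (J₁ r * q.2.1) (J₂ r * q.2.1) (q.2.2.1 r)) ∧
      IsJointEigenbasis c q.2.2.1 q.2.2.2}
  have hν : Tendsto (fun q : β => ν q.1.1) (comap (fun q : β => ν q.1.1) (𝓝 0)) (𝓝 0) :=
    tendsto_comap
  obtain ⟨C, hC⟩ := h.eigenvalue_expansion hsvd hP hQ₀ heig hν (fun q => hν0 q.1.1)
    (EntryO.of_norm_le (K := K) fun q : β => hΔ q.1.1) hψ (fun q : β => q.2.1)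
    (fun q => q.2.2.1) (fun q => q.2.2.2)
  obtain ⟨ε₂, hε₂, hex₂⟩ := exists_pos_of_eventually_comap hC
  refine ⟨min ε₁ ε₂, lt_min hε₁ hε₂, C, fun w hw => ⟨hex₁ w (hw.trans_le (min_le_left _ _)),
    fun U G Q hU hG hQ => ?_⟩⟩
  have habs : |ν w| = ν w := abs_of_nonneg (hν0 w)
  exact hex₂ ⟨(w, U, G, Q), hU, hG, hQ⟩ (habs.trans_lt (hw.trans_le (min_le_right _ _)))

end Estimators

/-! ### Taylor expansion of the angle maps -/

section Angles

/-- Second-order Taylor remainder of an analytic function. -/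
theorem analyticAt_isBigO_sq {𝕜 E F : Type*} [NontriviallyNormedField 𝕜] [NormedAddCommGroup E]
    [NormedSpace 𝕜 E] [NormedAddCommGroup F] [NormedSpace 𝕜 F] {f : E → F} {a : E}
    {f' : E →L[𝕜] F} (hf : AnalyticAt 𝕜 f a) (hf' : HasFDerivAt f f' a) :
    (fun z => f (a + z) - f a - f' z) =O[𝓝 0] (fun z => ‖z‖ ^ 2) := by
  obtain ⟨q, hq⟩ := hf
  have h1 := hq.isBigO_sub_partialSum_pow 2
  refine h1.congr_left fun z => ?_
  have h2 : (continuousMultilinearCurryFin1 𝕜 E F) (q 1) = f' := hq.hasFDerivAt.unique hf'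
  have h3 : q 0 (fun _ => z) = f a := hq.coeff_zero _
  have h4 : q 1 (fun _ => z) = f' z := by
    rw [← h2, continuousMultilinearCurryFin1_apply]
    congr 1
  rw [FormalMultilinearSeries.partialSum, Finset.sum_range_succ, Finset.sum_range_one, h3, h4]
  abel

/-- arg = Im log, and log is analytic at e^{jμ} because μ in the open interval keeps it off the
branch cut. The derivative is z ↦ Im(z/λ). -/
theorem arg_isBigO {μ : ℝ} (hμ : μ ∈ Set.Ioo (-Real.pi) Real.pi) :
    (fun z => Complex.arg (Complex.exp (Complex.I * μ) + z)
      - Complex.arg (Complex.exp (Complex.I * μ))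
      - (Complex.imCLM ∘L (((ContinuousLinearMap.mul ℂ ℂ)
          (Complex.exp (Complex.I * μ))⁻¹).restrictScalars ℝ)) z) =O[𝓝 0]
      (fun z => ‖z‖ ^ 2) := by
  set a := Complex.exp (Complex.I * μ) with ha
  have harg : Complex.arg a = μ := by
    rw [ha, mul_comm, Complex.arg_exp_mul_I]
    exact toIocMod_eq_self _ |>.mpr ⟨hμ.1, by linarith [hμ.2]⟩
  have hslit : a ∈ Complex.slitPlane := by
    rw [Complex.mem_slitPlane_iff_arg, harg]
    exact ⟨hμ.2.ne, Complex.exp_ne_zero _⟩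
  have h1 := analyticAt_isBigO_sq (analyticAt_clog hslit) (Complex.hasDerivAt_log hslit).hasFDerivAt
  refine ((Complex.imCLM.isBigO_comp _ _).trans h1).congr_left fun z => ?_
  simp [Complex.log_im, mul_comm]

theorem arctan_isBigO (w : ℝ) :
    (fun z => 2 * Real.arctan (w + z) - 2 * Real.arctan w
      - ((ContinuousLinearMap.mul ℝ ℝ) (2 / (w ^ 2 + 1))) z) =O[𝓝 0] (fun z => ‖z‖ ^ 2) := by
  have h0 : AnalyticAt ℝ Real.arctan w :=
    contDiff_omega_iff_analyticOnNhd.mp Real.contDiff_arctan w (Set.mem_univ w)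
  have h1 := analyticAt_isBigO_sq h0 (Real.hasDerivAt_arctan w).hasFDerivAt
  refine (h1.const_mul_left 2).congr_left fun z => ?_
  simp
  ring

end Angles

/-! ### Exchange matrices and left Π-real matrices -/

section Exchange

variable {ι κ : Type*} [Fintype ι] [DecidableEq ι] [Reversal ι]

/-- The reversal is an involution. -/
def IsReversal (ι : Type*) [Reversal ι] : Prop :=
  Function.Involutive (Reversal.rev : ι → ι)

theorem isReversal_fin (n : ℕ) : IsReversal (Fin n) := Fin.rev_rev

theorem isReversal_pi {κ : Type*} {β : κ → Type*} [∀ k, Reversal (β k)]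
    (h : ∀ k, IsReversal (β k)) : IsReversal ((k : κ) → β k) :=
  fun f => funext fun k => h k (f k)

theorem isReversal_prod {α β : Type*} [Reversal α] [Reversal β] (hα : IsReversal α)
    (hβ : IsReversal β) : IsReversal (α × β) :=
  fun p => Prod.ext (hα p.1) (hβ p.2)

theorem exchange_mul_apply (M : Matrix ι κ ℂ) (i : ι) (j : κ) :
    (exchange ι * M) i j = M (Reversal.rev i) j := by
  simp [Matrix.mul_apply, exchange]

theorem mul_exchange_apply (h : IsReversal ι) (M : Matrix κ ι ℂ) (i : κ) (j : ι) :
    (M * exchange ι) i j = M i (Reversal.rev j) := by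
  have h1 : ∀ k : ι, (j = Reversal.rev k) ↔ (k = Reversal.rev j) := fun k =>
    ⟨fun e => by rw [e, h k], fun e => by rw [e, h j]⟩
  simp [Matrix.mul_apply, exchange, h1]

theorem exchange_mul_exchange (h : IsReversal ι) : exchange ι * exchange ι = 1 := by
  ext i j
  rw [exchange_mul_apply, exchange, Matrix.of_apply, h i, Matrix.one_apply]
  simp only [eq_comm]

theorem exchange_mul_exchange_mul (h : IsReversal ι) (M : Matrix ι κ ℂ) :
    exchange ι * (exchange ι * M) = M := by
  rw [← Matrix.mul_assoc, exchange_mul_exchange h, Matrix.one_mul]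

omit [Fintype ι] in
theorem conjTranspose_exchange (h : IsReversal ι) : (exchange ι)ᴴ = exchange ι := by
  ext i j
  have h1 : (i = Reversal.rev j) ↔ (j = Reversal.rev i) :=
    ⟨fun e => by rw [e, h j], fun e => by rw [e, h i]⟩
  simp only [Matrix.conjTranspose_apply, exchange, Matrix.of_apply, h1]
  split_ifs <;> simp

omit [Fintype ι] in
theorem conj_exchange : conj (exchange ι) = exchange ι := by
  ext i j
  simp only [conj, exchange, Matrix.map_apply, Matrix.of_apply]
  split_ifs <;> simp

theorem conj_mul {m n k : Type*} [Fintype n] (A : Matrix m n ℂ) (B : Matrix n k ℂ) :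
    conj (A * B) = conj A * conj B := by
  ext i j; simp [conj, Matrix.mul_apply]

theorem conj_fromBlocks {m n k o : Type*} (A : Matrix m n ℂ) (B : Matrix m o ℂ)
    (C : Matrix k n ℂ) (D : Matrix k o ℂ) :
    conj (Matrix.fromBlocks A B C D) = Matrix.fromBlocks (conj A) (conj B) (conj C) (conj D) := by
  ext (i | i) (j | j) <;> rfl

theorem conj_conjTranspose {m n : Type*} (A : Matrix m n ℂ) : conj Aᴴ = (conj A)ᴴ := by
  ext i j; simp [conj]

theorem inv_sqrt_two_sq :
    ((1 / Real.sqrt 2 : ℝ) : ℂ) * ((1 / Real.sqrt 2 : ℝ) : ℂ) = 1 / 2 := by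
  rw [← Complex.ofReal_mul, div_mul_div_comm, Real.mul_self_sqrt (by norm_num)]
  norm_num

omit [Fintype ι] in
theorem leftReal_conjTranspose (h : IsReversal ι) : (leftReal ι)ᴴ =
    ((1 / Real.sqrt 2 : ℝ) : ℂ) • Matrix.fromBlocks 1 (exchange ι)
      (-(Complex.I • (1 : Matrix ι ι ℂ))) (Complex.I • exchange ι) := by
  rw [leftReal, Matrix.conjTranspose_smul, Matrix.fromBlocks_conjTranspose]
  simp only [Matrix.conjTranspose_one, Matrix.conjTranspose_smul, Matrix.conjTranspose_neg,
    conjTranspose_exchange h, Complex.star_def, Complex.conj_ofReal, Complex.conj_I, neg_smul,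
    neg_neg]

theorem leftReal_unitary (h : IsReversal ι) : (leftReal ι)ᴴ * leftReal ι = 1 := by
  rw [leftReal_conjTranspose h, leftReal, Matrix.smul_mul, Matrix.mul_smul, smul_smul,
    inv_sqrt_two_sq, Matrix.fromBlocks_multiply, ← Matrix.fromBlocks_one, Matrix.fromBlocks_smul]
  simp only [Matrix.mul_neg, Matrix.smul_mul, Matrix.mul_smul,
    exchange_mul_exchange h, smul_smul, Complex.I_mul_I, neg_smul, one_smul, neg_neg,
    Matrix.mul_one]
  congr 1
  · rw [← two_smul ℂ, smul_smul]; norm_num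
  · simp
  · simp
  · rw [smul_neg, smul_smul, Complex.I_mul_I, neg_smul, one_smul, neg_neg, ← two_smul ℂ, smul_smul]
    norm_num

theorem leftReal_unitary' (h : IsReversal ι) : leftReal ι * (leftReal ι)ᴴ = 1 :=
  mul_eq_one_comm.mp (leftReal_unitary h)

/-- The defining property of a left Π-real matrix. It turns conjugation of a transformed matrix into
multiplication of the original by exchange matrices. -/
theorem conj_leftReal (h : IsReversal ι) : conj (leftReal ι) = exchange₂ ι * leftReal ι := by
  have h1 : conj (leftReal ι) = ((1 / Real.sqrt 2 : ℝ) : ℂ) • conj (Matrix.fromBlocks 1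
      (Complex.I • (1 : Matrix ι ι ℂ)) (exchange ι) (-(Complex.I • exchange ι))) := by
    ext i j
    simp [conj, leftReal]
  have h2 : conj (1 : Matrix ι ι ℂ) = 1 := by
    ext i j; simp [conj, Matrix.one_apply]
  have h3 : ∀ M : Matrix ι ι ℂ, conj (Complex.I • M) = -(Complex.I • conj M) := fun M => by
    ext i j; simp [conj]
  have h4 : ∀ M : Matrix ι ι ℂ, conj (-M) = -conj M := fun M => by
    ext i j; simp [conj]
  rw [h1, conj_fromBlocks, leftReal, exchange₂, Matrix.mul_smul, Matrix.fromBlocks_multiply]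
  simp only [h2, h3, h4, conj_exchange, Matrix.zero_mul, zero_add, add_zero, Matrix.mul_one,
    Matrix.mul_neg, Matrix.mul_smul, exchange_mul_exchange h, neg_neg, smul_zero, neg_zero, zero_add,
    add_zero]

omit [Fintype ι] in
theorem conjTranspose_exchange₂ (h : IsReversal ι) : (exchange₂ ι)ᴴ = exchange₂ ι := by
  rw [exchange₂, Matrix.fromBlocks_conjTranspose]
  simp [conjTranspose_exchange h]

end Exchange

/-! ### Augmentation, averaging and the real transform -/

section Augment

variable {ι κ : Type*} [Fintype ι] [DecidableEq ι] [Reversal ι]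
  [Fintype κ] [DecidableEq κ] [Reversal κ]

theorem augment_add {κ : Type*} (X W : Matrix ι κ ℂ) :
    augment (X + W) = augment X + augment W := by
  ext (i | i) j <;> simp [augment, exchange_mul_apply, conj]

/-- Conjugation followed by row exchange swaps the two blocks of [X; Π X*]. The backward half of the
averaged data is thus the forward half with its columns reversed. -/
theorem exchange₂_mul_conj_augment {κ : Type*} (h : IsReversal ι) (X : Matrix ι κ ℂ) :
    exchange₂ ι * conj (augment X) = augment X := by
  have h1 : conj (augment X) = Matrix.fromRows (conj X) (exchange ι * X) := by
    ext (i | i) j <;> simp [augment, exchange_mul_apply, conj]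
  rw [h1, exchange₂, Matrix.fromBlocks_mul_fromRows, augment, exchange_mul_exchange_mul h]
  simp

theorem fba_augment (h : IsReversal ι) (X : Matrix ι κ ℂ) :
    fba (augment X) = Matrix.fromCols (augment X) (augment X * exchange κ) := by
  rw [fba, exchange₂_mul_conj_augment h]

theorem fba_augment_add (h : IsReversal ι) (X W : Matrix ι κ ℂ) :
    fba (augment (X + W)) = fba (augment X) + fba (augment W) := by
  rw [fba_augment h, fba_augment h, fba_augment h, augment_add, Matrix.add_mul]
  ext i (j | j) <;> rfl

/-- Column reversal is unitary, so both halves contribute equally to the sample covariance.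
Averaging therefore only scales singular values by √2. -/
theorem fba_augment_mul_conjTranspose (h : IsReversal ι) (hκ : IsReversal κ)
    (X : Matrix ι κ ℂ) : fba (augment X) * (fba (augment X))ᴴ
      = (2 : ℂ) • (augment X * (augment X)ᴴ) := by
  rw [fba_augment h, Matrix.conjTranspose_fromCols_eq_fromRows_conjTranspose,
    Matrix.fromCols_mul_fromRows, Matrix.conjTranspose_mul, conjTranspose_exchange hκ,
    Matrix.mul_assoc, ← Matrix.mul_assoc (exchange κ), exchange_mul_exchange hκ, Matrix.one_mul,
    two_smul]

theorem sum_norm_sq_fba (h : IsReversal ι) (hκ : IsReversal κ) (X : Matrix ι κ ℂ)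
    (w : ι ⊕ ι → ℂ) : ∑ j, ‖((fba (augment X))ᴴ *ᵥ w) j‖ ^ 2
      = 2 * ∑ j, ‖((augment X)ᴴ *ᵥ w) j‖ ^ 2 := by
  apply RCLike.ofReal_injective (K := ℂ)
  rw [RCLike.ofReal_mul, sum_norm_sq_mulVec, sum_norm_sq_mulVec, Matrix.conjTranspose_conjTranspose,
    fba_augment_mul_conjTranspose h hκ, Matrix.conjTranspose_conjTranspose, Matrix.smul_mulVec,
    dotProduct_smul]
  simp

/-- Forward-backward averaging does not change the dominant left singular vectors. -/
theorem isDominantLeft_fba_iff (h : IsReversal ι) (hκ : IsReversal κ) {d : ℕ} (X : Matrix ι κ ℂ)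
    (U : Matrix (ι ⊕ ι) (Fin d) ℂ) :
    IsDominantLeft (fba (augment X)) U ↔ IsDominantLeft (augment X) U := by
  have h2 : ((Real.sqrt 2 : ℝ) : ℂ) ^ 2 = 2 := by
    rw [← Complex.ofReal_pow, Real.sq_sqrt (by norm_num)]; norm_num
  constructor
  · rintro ⟨hU, σ, hσ, hE, hdom⟩
    refine ⟨hU, fun i => σ i / Real.sqrt 2, fun i => div_nonneg (hσ i) (Real.sqrt_nonneg _), ?_,
      fun w hw i => ?_⟩
    · have h3 : Matrix.diagonal (fun i => (((σ i / Real.sqrt 2) ^ 2 : ℝ) : ℂ))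
          = (1 / 2 : ℂ) • Matrix.diagonal (fun i => ((σ i ^ 2 : ℝ) : ℂ)) := by
        rw [← Matrix.diagonal_smul]
        congr 1; ext i
        simp only [Pi.smul_apply, smul_eq_mul]
        push_cast
        rw [div_pow, h2]; ring
      rw [fba_augment_mul_conjTranspose h hκ, Matrix.smul_mul] at hE
      have h4 := congrArg ((1 / 2 : ℂ) • ·) hE
      simp only [smul_smul] at h4
      norm_num at h4
      refine h4.trans ?_
      rw [← Matrix.mul_smul]
      refine congrArg (U * ·) (Eq.trans ?_ h3.symm)
      norm_num
    · have := hdom w hw i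
      rw [sum_norm_sq_fba h hκ] at this
      rw [div_pow, Real.sq_sqrt (by norm_num)]
      linarith
  · rintro ⟨hU, σ, hσ, hE, hdom⟩
    refine ⟨hU, fun i => σ i * Real.sqrt 2, fun i => mul_nonneg (hσ i) (Real.sqrt_nonneg _), ?_,
      fun w hw i => ?_⟩
    · have h3 : Matrix.diagonal (fun i => (((σ i * Real.sqrt 2) ^ 2 : ℝ) : ℂ))
          = (2 : ℂ) • Matrix.diagonal (fun i => ((σ i ^ 2 : ℝ) : ℂ)) := by
        rw [← Matrix.diagonal_smul]
        congr 1; ext i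
        simp only [Pi.smul_apply, smul_eq_mul]
        push_cast
        rw [mul_pow, h2]; ring
      rw [fba_augment_mul_conjTranspose h hκ, Matrix.smul_mul]
      refine (congrArg ((2 : ℂ) • ·) hE).trans ?_
      rw [← Matrix.mul_smul]
      exact congrArg (U * ·) h3.symm
    · have := hdom w hw i
      rw [sum_norm_sq_fba h hκ, mul_pow, Real.sq_sqrt (by norm_num)]
      linarith

/-- The transform of the averaged data, in closed form. -/
theorem phi_fba_augment (h : IsReversal ι) (hκ : IsReversal κ) (X : Matrix ι κ ℂ) :
    phi (fba (augment X)) = Matrix.fromBlocks (X + conj X) 0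
      (-(Complex.I • X) + Complex.I • conj X) 0 := by
  rw [phi, leftReal_conjTranspose h, leftReal, fba_augment h, Matrix.smul_mul, Matrix.smul_mul,
    Matrix.mul_smul, smul_smul, inv_sqrt_two_sq, Matrix.mul_assoc,
    Matrix.fromCols_mul_fromBlocks]
  have h1 : augment X * (1 : Matrix κ κ ℂ) + augment X * exchange κ * exchange κ = (2 : ℂ) • augment X := by
    rw [Matrix.mul_assoc, exchange_mul_exchange hκ, Matrix.mul_one, two_smul]
  have h2 : augment X * Complex.I • (1 : Matrix κ κ ℂ)
      + augment X * exchange κ * -(Complex.I • exchange κ) = 0 := by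
    rw [Matrix.mul_neg, Matrix.mul_smul, Matrix.mul_smul, Matrix.mul_assoc,
      exchange_mul_exchange hκ]
    exact add_neg_cancel _
  rw [h1, h2, Matrix.mul_fromCols, Matrix.mul_zero, augment, Matrix.mul_smul,
    Matrix.fromBlocks_mul_fromRows, exchange_mul_exchange_mul h]
  simp only [Matrix.smul_mul, Matrix.neg_mul, Matrix.one_mul, exchange_mul_exchange_mul h]
  ext (i | i) (j | j) <;> simp

/-- Entrywise inclusion of real matrices into complex matrices. -/
def toComplex {m n : Type*} (M : Matrix m n ℝ) : Matrix m n ℂ := M.map Complex.ofReal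

/-! ### Real matrices viewed as complex ones -/

section toComplex

variable {m n k : Type*}

theorem toComplex_mul [Fintype n] (A : Matrix m n ℝ) (B : Matrix n k ℝ) :
    toComplex (A * B) = toComplex A * toComplex B := by
  ext i j; simp [toComplex, Matrix.mul_apply]

theorem toComplex_sub (A B : Matrix m n ℝ) : toComplex (A - B) = toComplex A - toComplex B := by
  ext i j; simp [toComplex]

theorem toComplex_smul (a : ℝ) (A : Matrix m n ℝ) :
    toComplex (a • A) = (a : ℂ) • toComplex A := by
  ext i j; simp [toComplex]

theorem toComplex_one [DecidableEq n] : toComplex (1 : Matrix n n ℝ) = 1 := by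
  ext i j; simp [toComplex, Matrix.one_apply]; split_ifs <;> simp

theorem toComplex_diagonal [DecidableEq n] (v : n → ℝ) :
    toComplex (Matrix.diagonal v) = Matrix.diagonal (fun i => (v i : ℂ)) := by
  ext i j; simp [toComplex, Matrix.diagonal_apply]; split_ifs <;> simp

theorem toComplex_conjTranspose (A : Matrix m n ℝ) : toComplex Aᴴ = (toComplex A)ᴴ := by
  ext i j; simp [toComplex]

theorem toComplex_injective : Function.Injective (toComplex : Matrix m n ℝ → Matrix m n ℂ) := by
  intro A B h
  ext i j
  exact Complex.ofReal_injective (congrFun (congrFun h i) j)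

/-- For real A the real part of L A is (Re L) A, so the real part of a complex left inverse is again
one. -/
theorem exists_left_inverse_of_toComplex [Fintype m] [DecidableEq n] {A : Matrix m n ℝ}
    {L : Matrix n m ℂ} (h : L * toComplex A = 1) : ∃ L' : Matrix n m ℝ, L' * A = 1 := by
  refine ⟨L.map Complex.re, ?_⟩
  ext i j
  have := congrArg Complex.re (congrFun (congrFun h i) j)
  rw [Matrix.mul_apply] at this ⊢
  simp only [toComplex, Matrix.map_apply, Complex.re_sum, Complex.re_mul_ofReal] at this ⊢
  rw [this, Matrix.one_apply, Matrix.one_apply]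
  split_ifs <;> simp

theorem exists_right_inverse_of_toComplex [Fintype m] [DecidableEq n] {A : Matrix n m ℝ}
    {L : Matrix m n ℂ} (h : toComplex A * L = 1) : ∃ L' : Matrix m n ℝ, A * L' = 1 := by
  refine ⟨L.map Complex.re, ?_⟩
  ext i j
  have := congrArg Complex.re (congrFun (congrFun h i) j)
  rw [Matrix.mul_apply] at this ⊢
  simp only [toComplex, Matrix.map_apply, Complex.re_sum, Complex.re_ofReal_mul] at this ⊢
  rw [this, Matrix.one_apply, Matrix.one_apply]
  split_ifs <;> simp

theorem IsPinv.toComplex [Fintype m] [Fintype n] {B : Matrix m n ℝ} {P : Matrix n m ℝ}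
    (h : IsPinv B P) : IsPinv (toComplex B) (toComplex P) := by
  refine ⟨?_, ?_, ?_, ?_⟩
  · rw [← toComplex_mul, ← toComplex_mul, h.mul_mul]
  · rw [← toComplex_mul, ← toComplex_mul, h.mul_mul']
  · rw [← toComplex_mul, ← toComplex_conjTranspose, h.herm]
  · rw [← toComplex_mul, ← toComplex_conjTranspose, h.herm']

end toComplex

theorem toComplex_realData (h : IsReversal ι) (hκ : IsReversal κ) (X : Matrix ι κ ℂ) :
    toComplex (realData X) = (leftReal ι)ᴴ * fba (augment X) * leftReal κ := by
  change toComplex (realData X) = phi (fba (augment X))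
  rw [realData, phi_fba_augment h hκ]
  ext (i | i) (j | j) <;> simp [toComplex, conj, Complex.ext_iff]

theorem realData_eq (h : IsReversal ι) (hκ : IsReversal κ) (X : Matrix ι κ ℂ) :
    realData X = Matrix.fromBlocks ((2 : ℝ) • X.map Complex.re) 0
      ((2 : ℝ) • X.map Complex.im) 0 := by
  rw [realData, phi_fba_augment h hκ]
  ext (i | i) (j | j) <;> simp [conj] <;> ring

theorem realData_add (h : IsReversal ι) (hκ : IsReversal κ) (X W : Matrix ι κ ℂ) :
    realData (X + W) = realData X + realData W := by
  rw [realData_eq h hκ, realData_eq h hκ, realData_eq h hκ]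
  ext (i | i) (j | j) <;> simp <;> ring

/-- V Vᴴ = 1 and V' V'ᴴ = 1 cancel the inner factors and keep the two projectors Hermitian. -/
theorem IsPinv.unitary_conj {m n m' n' : Type*} [Fintype m] [Fintype n] [Fintype m'] [Fintype n']
    [DecidableEq m] [DecidableEq n] {B : Matrix m n ℂ} {P : Matrix n m ℂ}
    (h : IsPinv B P) {V : Matrix m m' ℂ} {V' : Matrix n n' ℂ} (hV : V * Vᴴ = 1)
    (hV' : V' * V'ᴴ = 1) : IsPinv (Vᴴ * B * V') (V'ᴴ * P * V) := by
  have e1 : Vᴴ * B * V' * (V'ᴴ * P * V) = Vᴴ * (B * P) * V := by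
    calc _ = Vᴴ * B * (V' * V'ᴴ) * P * V := by simp only [Matrix.mul_assoc]
      _ = _ := by rw [hV', Matrix.mul_one]; simp only [Matrix.mul_assoc]
  have e2 : V'ᴴ * P * V * (Vᴴ * B * V') = V'ᴴ * (P * B) * V' := by
    calc _ = V'ᴴ * P * (V * Vᴴ) * B * V' := by simp only [Matrix.mul_assoc]
      _ = _ := by rw [hV, Matrix.mul_one]; simp only [Matrix.mul_assoc]
  refine ⟨?_, ?_, ?_, ?_⟩
  · rw [e1]
    calc _ = Vᴴ * (B * P * (V * Vᴴ) * B) * V' := by simp only [Matrix.mul_assoc]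
      _ = _ := by rw [hV, Matrix.mul_one, h.mul_mul]
  · rw [e2]
    calc _ = V'ᴴ * (P * B * (V' * V'ᴴ) * P) * V := by simp only [Matrix.mul_assoc]
      _ = _ := by rw [hV', Matrix.mul_one, h.mul_mul']
  · rw [e1, Matrix.conjTranspose_mul, Matrix.conjTranspose_mul, h.herm,
      Matrix.conjTranspose_conjTranspose]
    simp only [Matrix.mul_assoc]
  · rw [e2, Matrix.conjTranspose_mul, Matrix.conjTranspose_mul, h.herm',
      Matrix.conjTranspose_conjTranspose]
    simp only [Matrix.mul_assoc]

end Augment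

/-! ### The complex and the real shift-invariant models of the array -/

namespace Model

variable {R d N : ℕ} (m : Model R d N)

theorem isReversal_sensor : IsReversal m.Sensor := isReversal_pi fun _ => isReversal_fin _

theorem isReversal_sub (r : Fin R) : IsReversal (m.Sub r) :=
  isReversal_prod (isReversal_pi fun _ => isReversal_fin _) (isReversal_fin _)

theorem conj_Psi_mul_Psi : conj m.Psi * m.Psi = 1 := by
  have h1 : conj m.Psi = Matrix.diagonal fun i => Complex.exp (-(Complex.I * (m.rot i : ℂ))) := by
    ext i j
    simp only [conj, Psi, Matrix.map_apply, Matrix.diagonal_apply]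
    split_ifs
    · rw [← Complex.exp_conj]; simp
    · simp
  rw [h1, Psi, Matrix.diagonal_mul_diagonal, ← Matrix.diagonal_one]
  congr 1; ext i
  rw [← Complex.exp_add]; simp

/-- For real S, conj(Ψ S) = Ψ* Ψ* (Ψ S). The conjugated observation is driven by the same symbols,
which is how non-circularity doubles the array. -/
theorem augment_steering_mul {κ : Type*} (S : Matrix (Fin d) κ ℝ) :
    augment (m.steering * (m.Psi * toComplex S)) = m.ncSteering * (m.Psi * toComplex S) := by
  have h1 : conj (toComplex S) = toComplex S := by
    ext i j; simp [conj, toComplex]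
  have h2 : conj m.Psi * (m.Psi * toComplex S) = toComplex S := by
    rw [← Matrix.mul_assoc, conj_Psi_mul_Psi, Matrix.one_mul]
  rw [augment, ncSteering, Matrix.fromRows_mul, conj_mul, conj_mul, h1]
  simp only [Matrix.mul_assoc, h2]

theorem augment_data_zero : augment (m.data 0) = m.ncSteering * m.symbols := by
  rw [data, add_zero]
  exact m.augment_steering_mul m.S₀

theorem conj_selection (r : Fin R) (sel : Fin (m.Msel r) ↪ Fin (m.M r)) :
    conj (m.selection r sel) = m.selection r sel := by
  ext p s
  simp only [conj, selection, Matrix.map_apply, Matrix.of_apply]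
  split_ifs <;> simp

theorem conj_lam_mul_lam (i : Fin d) (r : Fin R) :
    (starRingEnd ℂ) (m.lam i r) * m.lam i r = 1 := by
  rw [lam, ← Complex.exp_conj, ← Complex.exp_add]; simp

theorem lam_ne_zero (i : Fin d) (r : Fin R) : m.lam i r ≠ 0 := Complex.exp_ne_zero _

/-- In the lower block conjugation replaces Λ by Λ* = Λ⁻¹. This is compensated by exchanging the
roles of J₁ and J₂ there, and Λ commutes with the phases. -/
theorem ncSteering_shift (hshift : m.ShiftInvariant) (r : Fin R) :
    m.ncJ₁ r * m.ncSteering * Matrix.diagonal (fun i => m.lam i r)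
      = m.ncJ₂ r * m.ncSteering := by
  set Λ := Matrix.diagonal (fun i => m.lam i r) with hΛ
  have h1 := hshift r
  have h2 : m.J₁ r * conj m.steering * conj Λ = m.J₂ r * conj m.steering := by
    have := congrArg conj h1
    rw [conj_mul, conj_mul, conj_mul] at this
    rwa [J₁, J₂, conj_selection, conj_selection] at this
  have h3 : conj Λ * Λ = 1 := by
    have h4 : conj Λ = Matrix.diagonal (fun i => (starRingEnd ℂ) (m.lam i r)) := by
      ext i j
      simp only [conj, hΛ, Matrix.map_apply, Matrix.diagonal_apply]
      split_ifs <;> simp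
    rw [h4, hΛ, Matrix.diagonal_mul_diagonal, ← Matrix.diagonal_one]
    congr 1; ext i
    exact m.conj_lam_mul_lam i r
  have hcomm : conj m.Psi * conj m.Psi * Λ = Λ * (conj m.Psi * conj m.Psi) := by
    have h4 : conj m.Psi
        = Matrix.diagonal fun i => (starRingEnd ℂ) (Complex.exp (Complex.I * (m.rot i : ℂ))) := by
      ext i j
      simp only [conj, Psi, Matrix.map_apply, Matrix.diagonal_apply]
      split_ifs <;> simp
    rw [h4, hΛ]
    simp only [Matrix.diagonal_mul_diagonal]
    congr 1; ext i; ring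
  rw [ncJ₁, ncJ₂, ncSteering, Matrix.fromBlocks_mul_fromRows, Matrix.fromBlocks_mul_fromRows,
    Matrix.fromRows_mul]
  simp only [Matrix.zero_mul, add_zero, zero_add]
  congr 1
  have hx := exchange_mul_exchange_mul (m.isReversal_sensor)
    (conj m.steering * conj m.Psi * conj m.Psi)
  have e1 : ∀ J : Matrix (m.Sub r) m.Sensor ℂ, exchange (m.Sub r) * J * exchange m.Sensor *
      (exchange m.Sensor * conj m.steering * conj m.Psi * conj m.Psi)
      = exchange (m.Sub r) * (J * conj m.steering) * (conj m.Psi * conj m.Psi) := by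
    intro J
    calc _ = exchange (m.Sub r) * J * (exchange m.Sensor * (exchange m.Sensor *
          (conj m.steering * conj m.Psi * conj m.Psi))) := by simp only [Matrix.mul_assoc]
      _ = _ := by rw [hx]; simp only [Matrix.mul_assoc]
  rw [e1, e1, ← h2]
  calc _ = exchange (m.Sub r) * (m.J₁ r * conj m.steering * conj Λ) * (Λ *
        (conj m.Psi * conj m.Psi)) := by rw [← hcomm, h2]; simp only [Matrix.mul_assoc]
    _ = exchange (m.Sub r) * (m.J₁ r * conj m.steering * (conj Λ * Λ)) *
        (conj m.Psi * conj m.Psi) := by simp only [Matrix.mul_assoc]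
    _ = _ := by rw [h3, Matrix.mul_one]

theorem lam_injective (hμ : ∀ i r, m.μ i r ∈ Set.Ioo (-Real.pi) Real.pi)
    (hdistinct : Function.Injective m.μ) : Function.Injective m.lam := by
  have harg : ∀ i r, Complex.arg (m.lam i r) = m.μ i r := fun i r => by
    rw [lam, mul_comm, Complex.arg_exp_mul_I]
    exact (toIocMod_eq_self _).mpr ⟨(hμ i r).1, by linarith [(hμ i r).2]⟩
  intro i j h
  apply hdistinct
  ext r
  rw [← harg, ← harg, h]

theorem omega_injective (hμ : ∀ i r, m.μ i r ∈ Set.Ioo (-Real.pi) Real.pi)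
    (hdistinct : Function.Injective m.μ) : Function.Injective m.omega := by
  have harg : ∀ i r, 2 * Real.arctan (m.omega i r) = m.μ i r := fun i r => by
    rw [omega, Real.arctan_tan (by linarith [(hμ i r).1]) (by linarith [(hμ i r).2])]
    ring
  intro i j h
  apply hdistinct
  ext r
  rw [← harg, ← harg, h]

/-- A product of rank d through dimension d forces both factors to have rank d. -/
theorem exists_left_inverse_ncSteering (hrank : (augment (m.data 0)).rank = d) :
    (∃ L : Matrix (Fin d) (m.Sensor ⊕ m.Sensor) ℂ, L * m.ncSteering = 1) ∧
      ∃ X : Matrix (Fin N) (Fin d) ℂ, m.symbols * X = 1 := by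
  rw [augment_data_zero] at hrank
  have h1 := Matrix.rank_mul_le_left m.ncSteering m.symbols
  have h2 := Matrix.rank_mul_le_right m.ncSteering m.symbols
  have h3 := Matrix.rank_le_card_width m.ncSteering
  have h4 := Matrix.rank_le_card_height m.symbols
  rw [Fintype.card_fin] at h3 h4
  rw [hrank] at h1 h2
  exact ⟨exists_left_inverse_of_rank (le_antisymm h3 h1),
    exists_right_inverse_of_rank (le_antisymm h4 h2)⟩

/-- The averaged noise-free data follow a complex shift-invariant model. -/
theorem isShiftModel_fba (hshift : m.ShiftInvariant)
    (hμ : ∀ i r, m.μ i r ∈ Set.Ioo (-Real.pi) Real.pi)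
    (hdistinct : Function.Injective m.μ) (hrank : (augment (m.data 0)).rank = d)
    (hsel : ∀ r, (m.ncJ₁ r * m.ncSteering).rank = d) :
    IsShiftModel (fba (augment (m.data 0))) m.ncSteering m.ncJ₁ m.ncJ₂ m.lam := by
  obtain ⟨hL, X, hX⟩ := m.exists_left_inverse_ncSteering hrank
  refine ⟨⟨Matrix.fromCols m.symbols (m.symbols * exchange (Fin N)), Matrix.fromRows X 0, ?_, ?_⟩,
    hL, fun r => exists_left_inverse_of_rank (hsel r), m.ncSteering_shift hshift,
    m.lam_injective hμ hdistinct⟩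
  · rw [fba_augment m.isReversal_sensor, augment_data_zero, Matrix.mul_fromCols, Matrix.mul_assoc]
  · rw [Matrix.fromCols_mul_fromRows, hX, Matrix.mul_zero, add_zero]

/-! ### The real-valued model -/

/-- Real steering matrix of the transformed data. -/
noncomputable def realSteering : Matrix (m.Sensor ⊕ m.Sensor) (Fin d) ℝ :=
  Matrix.fromRows ((2 : ℝ) • (m.steering * m.Psi).map Complex.re)
    ((2 : ℝ) • (m.steering * m.Psi).map Complex.im)

theorem sqrt_two_mul_inv_sqrt_two : (Real.sqrt 2 : ℂ) * ((1 / Real.sqrt 2 : ℝ) : ℂ) = 1 := by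
  rw [← Complex.ofReal_mul, mul_one_div_cancel (by positivity), Complex.ofReal_one]

/-- Scaling the columns by Ψ turns the augmented steering matrix into an augmentation [AΨ; Π(AΨ)*],
which Qᴴ makes real. Up to a unitary matrix and column scaling the real and complex models agree. -/
theorem toComplex_realSteering : toComplex m.realSteering
    = (leftReal m.Sensor)ᴴ * m.ncSteering * ((Real.sqrt 2 : ℂ) • m.Psi) := by
  have h1 : augment (m.steering * m.Psi) = m.ncSteering * m.Psi := by
    have := m.augment_steering_mul (1 : Matrix (Fin d) (Fin d) ℝ)
    rwa [toComplex_one, Matrix.mul_one] at this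
  rw [Matrix.mul_smul, Matrix.mul_assoc, ← h1, leftReal_conjTranspose m.isReversal_sensor,
    Matrix.smul_mul, smul_smul, sqrt_two_mul_inv_sqrt_two, one_smul, augment,
    Matrix.fromBlocks_mul_fromRows, exchange_mul_exchange_mul m.isReversal_sensor]
  simp only [Matrix.one_mul, Matrix.neg_mul, Matrix.smul_mul,
    exchange_mul_exchange_mul m.isReversal_sensor]
  set B := m.steering * m.Psi with hB
  ext (i | i) j <;> simp [realSteering, toComplex, conj, ← hB, Complex.ext_iff] <;> ring

theorem realData_zero : realData (m.data 0)
    = m.realSteering * Matrix.fromCols m.S₀ (0 : Matrix (Fin d) (Fin N) ℝ) := by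
  have h1 : m.data 0 = m.steering * m.Psi * toComplex m.S₀ := by
    rw [data, add_zero, symbols, Matrix.mul_assoc]; rfl
  rw [realData_eq m.isReversal_sensor (isReversal_fin N), h1, realSteering,
    Matrix.fromRows_mul_fromCols]
  set B := m.steering * m.Psi with hB
  have h2 : (B * toComplex m.S₀).map Complex.re = B.map Complex.re * m.S₀ := by
    ext i j; simp [Matrix.mul_apply, toComplex]
  have h3 : (B * toComplex m.S₀).map Complex.im = B.map Complex.im * m.S₀ := by
    ext i j; simp [Matrix.mul_apply, toComplex]
  simp only [h2, h3, Matrix.smul_mul, Matrix.mul_zero]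

/-- Exchanging rows and columns swaps the diagonal blocks, so Π 𝒥₂* Π = 𝒥₁. Real and imaginary parts
of the transformed 𝒥₂ therefore become sum and difference of both selections. -/
theorem conj_transformed (r : Fin R) :
    conj ((leftReal (m.Sub r))ᴴ * m.ncJ₂ r * leftReal m.Sensor)
      = (leftReal (m.Sub r))ᴴ * m.ncJ₁ r * leftReal m.Sensor := by
  have hs := m.isReversal_sensor
  have hr := m.isReversal_sub r
  have h1 : exchange₂ (m.Sub r) * conj (m.ncJ₂ r) * exchange₂ m.Sensor = m.ncJ₁ r := by
    have e0 : conj (0 : Matrix (m.Sub r) m.Sensor ℂ) = 0 := by ext i j; simp [conj]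
    rw [ncJ₂, conj_fromBlocks, exchange₂, exchange₂, Matrix.fromBlocks_multiply,
      Matrix.fromBlocks_multiply, ncJ₁, conj_mul, conj_mul, conj_exchange, conj_exchange, J₁, J₂,
      conj_selection, conj_selection, e0]
    simp only [Matrix.zero_mul, Matrix.mul_zero, add_zero, zero_add, Matrix.mul_assoc,
      exchange_mul_exchange hs, exchange_mul_exchange_mul hr, Matrix.mul_one]
  rw [conj_mul, conj_mul, conj_conjTranspose, conj_leftReal hs, conj_leftReal hr,
    Matrix.conjTranspose_mul, conjTranspose_exchange₂ hr, ← h1]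
  simp only [Matrix.mul_assoc]

theorem toComplex_map_re {ι κ : Type*} (Z : Matrix ι κ ℂ) :
    toComplex (Z.map fun z => 2 * z.re) = conj Z + Z := by
  ext i j
  simp [toComplex, conj, Complex.ext_iff]
  ring

theorem toComplex_map_im {ι κ : Type*} (Z : Matrix ι κ ℂ) :
    toComplex (Z.map fun z => 2 * z.im) = Complex.I • (conj Z - Z) := by
  ext i j
  simp [toComplex, conj, Complex.ext_iff]
  ring

theorem toComplex_K₁ (r : Fin R) : toComplex (m.K₁ r)
    = (leftReal (m.Sub r))ᴴ * (m.ncJ₁ r + m.ncJ₂ r) * leftReal m.Sensor := by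
  rw [Matrix.mul_add, Matrix.add_mul, ← conj_transformed, K₁, toComplex_map_re]

theorem toComplex_K₂ (r : Fin R) : toComplex (m.K₂ r)
    = (leftReal (m.Sub r))ᴴ * (Complex.I • (m.ncJ₁ r - m.ncJ₂ r)) * leftReal m.Sensor := by
  rw [Matrix.mul_smul, Matrix.smul_mul, Matrix.mul_sub, Matrix.sub_mul, ← conj_transformed, K₂,
    toComplex_map_im]

theorem one_add_lam_ne_zero (hμ : ∀ i r, m.μ i r ∈ Set.Ioo (-Real.pi) Real.pi) (i : Fin d)
    (r : Fin R) : 1 + m.lam i r ≠ 0 := by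
  intro h
  have harg : Complex.arg (m.lam i r) = m.μ i r := by
    rw [lam, mul_comm, Complex.arg_exp_mul_I]
    exact (toIocMod_eq_self _).mpr ⟨(hμ i r).1, by linarith [(hμ i r).2]⟩
  have h1 : m.lam i r = -1 := by linear_combination h
  rw [h1, Complex.arg_neg_one] at harg
  exact (hμ i r).2.ne harg.symm

/-- The Cayley transform ω = j(1-λ)/(1+λ) with the denominator cleared; write λ = (e^{jμ/2})² and
expand in sine and cosine. -/
theorem omega_mul (hμ : ∀ i r, m.μ i r ∈ Set.Ioo (-Real.pi) Real.pi) (i : Fin d)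
    (r : Fin R) : (m.omega i r : ℂ) * (1 + m.lam i r) = Complex.I * (1 - m.lam i r) := by
  set t : ℂ := ((m.μ i r / 2 : ℝ) : ℂ) with ht
  have hcos : Complex.cos t ≠ 0 := by
    rw [ht, ← Complex.ofReal_cos]
    refine Complex.ofReal_ne_zero.mpr (Real.cos_pos_of_mem_Ioo ⟨?_, ?_⟩).ne'
    · linarith [(hμ i r).1]
    · linarith [(hμ i r).2]
  have hlam : m.lam i r = Complex.exp (t * Complex.I) * Complex.exp (t * Complex.I) := by
    rw [lam, ← Complex.exp_add]
    congr 1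
    rw [ht]; push_cast; ring
  have hom : (m.omega i r : ℂ) = Complex.sin t / Complex.cos t := by
    rw [omega, Complex.ofReal_tan, Complex.tan]
  have h2 := Complex.sin_sq_add_cos_sq t
  rw [hom, hlam, Complex.exp_mul_I, div_mul_eq_mul_div, div_eq_iff hcos]
  linear_combination (-(Complex.sin t - Complex.cos t * Complex.I)) * h2
    + (Complex.sin t ^ 3 + 2 * Complex.sin t * Complex.cos t ^ 2
      + Complex.sin t ^ 2 * Complex.cos t * Complex.I) * Complex.I_sq

theorem sqrt_two_smul_Psi : (Real.sqrt 2 : ℂ) • m.Psi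
    = Matrix.diagonal fun i => (Real.sqrt 2 : ℂ) * Complex.exp (Complex.I * (m.rot i : ℂ)) := by
  rw [Psi, ← Matrix.diagonal_smul]; rfl

theorem sqrt_two_mul_exp_ne_zero (x : ℝ) :
    (Real.sqrt 2 : ℂ) * Complex.exp (Complex.I * (x : ℂ)) ≠ 0 :=
  mul_ne_zero (Complex.ofReal_ne_zero.mpr (by positivity)) (Complex.exp_ne_zero _)

theorem toComplex_K₁_mul (hshift : m.ShiftInvariant) (r : Fin R) :
    toComplex (m.K₁ r * m.realSteering) = (leftReal (m.Sub r))ᴴ * (m.ncJ₁ r * m.ncSteering) *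
      Matrix.diagonal (fun i => (1 + m.lam i r) *
        ((Real.sqrt 2 : ℂ) * Complex.exp (Complex.I * (m.rot i : ℂ)))) := by
  have h1 : (m.ncJ₁ r + m.ncJ₂ r) * m.ncSteering
      = m.ncJ₁ r * m.ncSteering * Matrix.diagonal (fun i => 1 + m.lam i r) := by
    rw [← Matrix.diagonal_add, Matrix.mul_add, m.ncSteering_shift hshift, Matrix.add_mul]
    congr 1
    exact (Matrix.mul_one _).symm
  rw [toComplex_mul, toComplex_K₁, toComplex_realSteering, sqrt_two_smul_Psi,
    ← Matrix.diagonal_mul_diagonal (fun i => 1 + m.lam i r)]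
  set D := Matrix.diagonal fun i => (Real.sqrt 2 : ℂ) *
    Complex.exp (Complex.I * (m.rot i : ℂ)) with hD
  calc _ = (leftReal (m.Sub r))ᴴ * ((m.ncJ₁ r + m.ncJ₂ r) *
        (leftReal m.Sensor * (leftReal m.Sensor)ᴴ) * m.ncSteering) * D := by
        simp only [Matrix.mul_assoc]
    _ = _ := by
        rw [leftReal_unitary' m.isReversal_sensor, Matrix.mul_one, h1]
        simp only [Matrix.mul_assoc]

theorem toComplex_K₂_mul (hshift : m.ShiftInvariant) (r : Fin R) :
    toComplex (m.K₂ r * m.realSteering) = (leftReal (m.Sub r))ᴴ * (m.ncJ₁ r * m.ncSteering) *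
      Matrix.diagonal (fun i => Complex.I * (1 - m.lam i r) *
        ((Real.sqrt 2 : ℂ) * Complex.exp (Complex.I * (m.rot i : ℂ)))) := by
  have h1 : (Complex.I • (m.ncJ₁ r - m.ncJ₂ r)) * m.ncSteering
      = m.ncJ₁ r * m.ncSteering * Matrix.diagonal (fun i => Complex.I * (1 - m.lam i r)) := by
    have h2 : Matrix.diagonal (fun i => Complex.I * (1 - m.lam i r))
        = Complex.I • (1 - Matrix.diagonal (fun i => m.lam i r)) := by
      rw [← Matrix.diagonal_one, Matrix.diagonal_sub, ← Matrix.diagonal_smul]; rfl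
    rw [h2, Matrix.mul_smul, Matrix.smul_mul, Matrix.mul_sub, m.ncSteering_shift hshift,
      Matrix.sub_mul, Matrix.mul_one]
  rw [toComplex_mul, toComplex_K₂, toComplex_realSteering, sqrt_two_smul_Psi,
    ← Matrix.diagonal_mul_diagonal (fun i => Complex.I * (1 - m.lam i r))]
  set D := Matrix.diagonal fun i => (Real.sqrt 2 : ℂ) *
    Complex.exp (Complex.I * (m.rot i : ℂ)) with hD
  calc _ = (leftReal (m.Sub r))ᴴ * ((Complex.I • (m.ncJ₁ r - m.ncJ₂ r)) *
        (leftReal m.Sensor * (leftReal m.Sensor)ᴴ) * m.ncSteering) * D := by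
        simp only [Matrix.mul_assoc]
    _ = _ := by
        rw [leftReal_unitary' m.isReversal_sensor, Matrix.mul_one, h1]
        simp only [Matrix.mul_assoc]

theorem diagonal_mul_diagonal_inv {v : Fin d → ℂ} (hv : ∀ i, v i ≠ 0) :
    Matrix.diagonal v * Matrix.diagonal (fun i => (v i)⁻¹) = 1 := by
  rw [Matrix.diagonal_mul_diagonal, ← Matrix.diagonal_one]
  congr 1; ext i; exact mul_inv_cancel₀ (hv i)

theorem diagonal_inv_mul_diagonal {v : Fin d → ℂ} (hv : ∀ i, v i ≠ 0) :
    Matrix.diagonal (fun i => (v i)⁻¹) * Matrix.diagonal v = 1 :=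
  mul_eq_one_comm.mp (diagonal_mul_diagonal_inv hv)

/-- The transformed noise-free data follow a real shift-invariant model. -/
theorem isShiftModel_realData (hshift : m.ShiftInvariant)
    (hμ : ∀ i r, m.μ i r ∈ Set.Ioo (-Real.pi) Real.pi)
    (hdistinct : Function.Injective m.μ) (hrank : (augment (m.data 0)).rank = d)
    (hsel : ∀ r, (m.ncJ₁ r * m.ncSteering).rank = d) :
    IsShiftModel (realData (m.data 0)) m.realSteering m.K₁ m.K₂ m.omega := by
  obtain ⟨⟨L, hL⟩, X, hX⟩ := m.exists_left_inverse_ncSteering hrank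
  refine ⟨?_, ?_, fun r => ?_, fun r => ?_, m.omega_injective hμ hdistinct⟩
  · have h1 : toComplex m.S₀ * (X * m.Psi) = 1 := by
      have h2 : conj m.Psi * (m.symbols * X) * m.Psi = 1 := by
        rw [hX, Matrix.mul_one, conj_Psi_mul_Psi]
      rw [← h2, symbols]
      calc _ = (conj m.Psi * m.Psi) * toComplex m.S₀ * (X * m.Psi) := by
            rw [conj_Psi_mul_Psi, Matrix.one_mul]
        _ = _ := by simp only [Matrix.mul_assoc]; rfl
    obtain ⟨X', hX'⟩ := exists_right_inverse_of_toComplex h1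
    refine ⟨Matrix.fromCols m.S₀ 0, Matrix.fromRows X' 0, m.realData_zero, ?_⟩
    rw [Matrix.fromCols_mul_fromRows, hX', Matrix.mul_zero, add_zero]
  · have hv := fun i => sqrt_two_mul_exp_ne_zero (m.rot i)
    refine exists_left_inverse_of_toComplex (L := Matrix.diagonal (fun i => ((Real.sqrt 2 : ℂ) *
      Complex.exp (Complex.I * (m.rot i : ℂ)))⁻¹) * L * leftReal m.Sensor) ?_
    rw [toComplex_realSteering, sqrt_two_smul_Psi]
    calc _ = Matrix.diagonal (fun i => ((Real.sqrt 2 : ℂ) *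
          Complex.exp (Complex.I * (m.rot i : ℂ)))⁻¹) * (L * (leftReal m.Sensor *
          (leftReal m.Sensor)ᴴ) * m.ncSteering) * _ := by simp only [Matrix.mul_assoc]; rfl
      _ = 1 := by
        rw [leftReal_unitary' m.isReversal_sensor, Matrix.mul_one, hL, Matrix.mul_one]
        exact diagonal_inv_mul_diagonal hv
  · obtain ⟨L, hL⟩ := exists_left_inverse_of_rank (hsel r)
    have hv : ∀ i, (1 + m.lam i r) * ((Real.sqrt 2 : ℂ) *
        Complex.exp (Complex.I * (m.rot i : ℂ))) ≠ 0 := fun i =>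
      mul_ne_zero (m.one_add_lam_ne_zero hμ i r) (sqrt_two_mul_exp_ne_zero _)
    refine exists_left_inverse_of_toComplex (L := Matrix.diagonal (fun i => ((1 + m.lam i r) *
      ((Real.sqrt 2 : ℂ) * Complex.exp (Complex.I * (m.rot i : ℂ))))⁻¹) * L *
      leftReal (m.Sub r)) ?_
    rw [toComplex_K₁_mul m hshift]
    calc _ = Matrix.diagonal (fun i => ((1 + m.lam i r) * ((Real.sqrt 2 : ℂ) *
          Complex.exp (Complex.I * (m.rot i : ℂ))))⁻¹) * (L * (leftReal (m.Sub r) *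
          (leftReal (m.Sub r))ᴴ) * (m.ncJ₁ r * m.ncSteering)) * _ := by
          simp only [Matrix.mul_assoc]; rfl
      _ = 1 := by
        rw [leftReal_unitary' (m.isReversal_sub r), Matrix.mul_one, hL, Matrix.mul_one]
        exact diagonal_inv_mul_diagonal hv
  · apply toComplex_injective
    rw [toComplex_mul, toComplex_K₁_mul m hshift, toComplex_K₂_mul m hshift, toComplex_diagonal,
      Matrix.mul_assoc, Matrix.diagonal_mul_diagonal]
    congr 2
    ext i
    rw [← m.omega_mul hμ]
    ring

end Model

/-- The reversed product rule for pseudo inverses fails in general; here P B = 1 makes it valid. -/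
theorem IsPinv.mul_invertible {m n : Type*} [Fintype m] [Fintype n] [DecidableEq n]
    {B : Matrix m n ℂ} {D D' : Matrix n n ℂ} {P : Matrix n m ℂ} (h : IsPinv B P)
    (hPB : P * B = 1) (hD : D * D' = 1) : IsPinv (B * D) (D' * P) := by
  have hD' : D' * D = 1 := mul_eq_one_comm.mp hD
  have e1 : B * D * (D' * P) = B * P := by
    rw [Matrix.mul_assoc, ← Matrix.mul_assoc D, hD, Matrix.one_mul]
  have e2 : D' * P * (B * D) = 1 := by
    rw [Matrix.mul_assoc, ← Matrix.mul_assoc P, hPB, Matrix.one_mul, hD']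
  refine ⟨?_, ?_, ?_, ?_⟩
  · rw [Matrix.mul_assoc, e2, Matrix.mul_one]
  · rw [e2, Matrix.one_mul]
  · rw [e1, h.herm]
  · rw [e2, Matrix.conjTranspose_one]

/-! ### Equality of the first-order errors, and the estimators -/

namespace Model

variable {R d N : ℕ} (m : Model R d N)

/-- Insert ω = j(1-λ)/(1+λ) into j(𝒥₁ - 𝒥₂) - ω(𝒥₁ + 𝒥₂) and compare coefficients: -2j/(1+λ) for 𝒥₂
and 2jλ/(1+λ) for 𝒥₁. -/
theorem toComplex_selection_difference (hμ : ∀ i r, m.μ i r ∈ Set.Ioo (-Real.pi) Real.pi)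
    (i : Fin d) (r : Fin R) : toComplex (m.K₂ r - m.omega i r • m.K₁ r)
      = (-(2 * Complex.I * m.lam i r / (1 + m.lam i r))) • ((leftReal (m.Sub r))ᴴ *
        ((m.lam i r)⁻¹ • m.ncJ₂ r - m.ncJ₁ r) * leftReal m.Sensor) := by
  have h1 := m.one_add_lam_ne_zero hμ i r
  have h2 := m.lam_ne_zero i r
  have hom : (m.omega i r : ℂ) = Complex.I * (1 - m.lam i r) / (1 + m.lam i r) := by
    rw [eq_div_iff h1, m.omega_mul hμ]
  have key : Complex.I • (m.ncJ₁ r - m.ncJ₂ r) - (m.omega i r : ℂ) • (m.ncJ₁ r + m.ncJ₂ r)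
      = (-(2 * Complex.I * m.lam i r / (1 + m.lam i r))) •
        ((m.lam i r)⁻¹ • m.ncJ₂ r - m.ncJ₁ r) := by
    rw [hom]
    ext a b
    simp only [Matrix.sub_apply, Matrix.smul_apply, Matrix.add_apply, smul_eq_mul]
    field_simp
    ring
  rw [toComplex_sub, toComplex_smul, toComplex_K₁, toComplex_K₂]
  refine Eq.trans ?_ (congrArg (fun B => (leftReal (m.Sub r))ᴴ * B * leftReal m.Sensor) key |>.trans
    (by rw [Matrix.mul_smul, Matrix.smul_mul]))
  simp only [Matrix.mul_sub, Matrix.sub_mul, Matrix.mul_smul, Matrix.smul_mul, smul_sub]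

/-- The first-order errors of the two algorithms coincide. -/
theorem firstOrder_eq (hshift : m.ShiftInvariant)
    (hμ : ∀ i r, m.μ i r ∈ Set.Ioo (-Real.pi) Real.pi)
    (hdistinct : Function.Injective m.μ) (hrank : (augment (m.data 0)).rank = d)
    (hsel : ∀ r, (m.ncJ₁ r * m.ncSteering).rank = d) (D : m.StandardExpansion)
    (D' : m.UnitaryExpansion) (W : Matrix m.Sensor (Fin N) ℂ) (i : Fin d) (r : Fin R) :
    D'.firstOrder W i r = D.firstOrder W i r := by
  have hC := m.isShiftModel_fba hshift hμ hdistinct hrank hsel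
  have hR := m.isShiftModel_realData hshift hμ hdistinct hrank hsel
  have hs := m.isReversal_sensor
  have hN := isReversal_fin N
  obtain ⟨L, hL⟩ := hC.left_inv_sub r
  obtain ⟨Lr, hLr⟩ := hR.left_inv_sub r
  obtain ⟨Pa, hPa⟩ : ∃ Pa, IsPinv (m.ncJ₁ r * m.ncSteering) Pa :=
    ⟨_, isPinv_gram (isUnit_det_gram hL)⟩
  obtain ⟨Pr, hPr⟩ : ∃ Pr, IsPinv (m.K₁ r * m.realSteering) Pr :=
    ⟨_, isPinv_gram (isUnit_det_gram hLr)⟩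
  obtain ⟨Yp, hYp⟩ : ∃ Yp, IsPinv (fba (augment (m.data 0))) Yp := ⟨_, D.svd.isPinv⟩
  obtain ⟨Yr, hYr⟩ : ∃ Yr, IsPinv (realData (m.data 0)) Yr := ⟨_, D'.svd.isPinv⟩
  set Y := fba (augment (m.data 0)) with hY
  set M := (m.lam i r)⁻¹ • m.ncJ₂ r - m.ncJ₁ r with hM
  set Wt := fba (augment W) with hWt
  set Q := leftReal m.Sensor with hQ
  set Qs := leftReal (m.Sub r) with hQs
  set QN := leftReal (Fin N) with hQN
  have hQQ : Q * Qᴴ = 1 := leftReal_unitary' hs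
  have hQQ' : Qᴴ * Q = 1 := leftReal_unitary hs
  have hQsQs : Qs * Qsᴴ = 1 := leftReal_unitary' (m.isReversal_sub r)
  have hQNQN : QN * QNᴴ = 1 := leftReal_unitary' hN
  -- The choice-free form of the complex first-order term; the real one is reduced to it below.
  set z : ℂ := (Pa * M * (1 - Y * Yp) * Wt * Yp * m.ncSteering : Matrix (Fin d) (Fin d) ℂ) i i
    with hz
  have h1 : D.firstOrder W i r = z.im := by
    rw [StandardExpansion.firstOrder, hC.firstOrder_eq D.svd D.pinv D.isUnit D.eigen hYp hPa]
  have h2 : D'.firstOrder W i r = (Pr * (m.K₂ r - m.omega i r • m.K₁ r) *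
      (1 - realData (m.data 0) * Yr) * realData W * Yr * m.realSteering :
        Matrix (Fin d) (Fin d) ℝ) i i * (2 / (m.omega i r ^ 2 + 1)) := by
    rw [UnitaryExpansion.firstOrder, hR.firstOrder_eq D'.svd D'.pinv D'.isUnit D'.eigen hYr hPr]
  set v : Fin d → ℂ := fun i => (Real.sqrt 2 : ℂ) * Complex.exp (Complex.I * (m.rot i : ℂ)) with hv
  have hv0 : ∀ i, v i ≠ 0 := fun i => sqrt_two_mul_exp_ne_zero _
  have hu0 : ∀ i, (1 + m.lam i r) * v i ≠ 0 := fun i =>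
    mul_ne_zero (m.one_add_lam_ne_zero hμ i r) (hv0 i)
  have hPc : toComplex Pr = Matrix.diagonal (fun i => ((1 + m.lam i r) * v i)⁻¹) * Pa * Qs := by
    have e1 := hPr.toComplex
    rw [toComplex_K₁_mul m hshift] at e1
    have e2 := (hPa.mul_invertible (hPa.mul_eq_one hL)
      (diagonal_mul_diagonal_inv hu0)).unitary_conj hQsQs
        (V' := (1 : Matrix (Fin d) (Fin d) ℂ)) (by simp)
    rw [Matrix.mul_one, ← Matrix.mul_assoc, Matrix.conjTranspose_one, Matrix.one_mul] at e2
    exact e1.unique e2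
  have hYc : toComplex Yr = QNᴴ * Yp * Q := by
    have e1 := hYr.toComplex
    rw [toComplex_realData hs hN] at e1
    exact e1.unique (hYp.unitary_conj hQQ hQNQN)
  set κ : ℂ := -(2 * Complex.I * m.lam i r / (1 + m.lam i r)) with hκ
  have hprod : toComplex (Pr * (m.K₂ r - m.omega i r • m.K₁ r) *
      (1 - realData (m.data 0) * Yr) * realData W * Yr * m.realSteering)
      = κ • (Matrix.diagonal (fun i => ((1 + m.lam i r) * v i)⁻¹) *
        (Pa * M * (1 - Y * Yp) * Wt * Yp * m.ncSteering) * Matrix.diagonal v) := by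
    have e3 : toComplex (1 - realData (m.data 0) * Yr) = Qᴴ * (1 - Y * Yp) * Q := by
      rw [toComplex_sub, toComplex_one, toComplex_mul, toComplex_realData hs hN, hYc,
        Matrix.mul_sub, Matrix.sub_mul, Matrix.mul_one, hQQ']
      congr 1
      calc _ = Qᴴ * Y * (QN * QNᴴ) * Yp * Q := by simp only [Matrix.mul_assoc]; rfl
        _ = _ := by rw [hQNQN, Matrix.mul_one]; simp only [Matrix.mul_assoc]
    simp only [toComplex_mul]
    rw [e3, hPc, hYc, toComplex_realData hs hN, toComplex_realSteering, sqrt_two_smul_Psi,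
      m.toComplex_selection_difference hμ]
    simp only [Matrix.mul_smul, Matrix.smul_mul]
    congr 1
    -- Each adjacent pair of transforms collapses to the identity. Of the column scalings only the
    -- factor 1/(1+λ_i) survives on the diagonal.
    calc _ = Matrix.diagonal (fun i => ((1 + m.lam i r) * v i)⁻¹) * (Pa * (Qs * Qsᴴ) * M *
          (Q * Qᴴ) * (1 - Y * Yp) * (Q * Qᴴ) * Wt * (QN * QNᴴ) * Yp * (Q * Qᴴ) * m.ncSteering) *
          Matrix.diagonal v := by simp only [Matrix.mul_assoc]; rfl
      _ = _ := by rw [hQsQs, hQQ, hQNQN]; simp only [Matrix.mul_one]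
  have hentry : ((Pr * (m.K₂ r - m.omega i r • m.K₁ r) *
      (1 - realData (m.data 0) * Yr) * realData W * Yr * m.realSteering :
        Matrix (Fin d) (Fin d) ℝ) i i : ℂ) = κ * (((1 + m.lam i r) * v i)⁻¹ * z * v i) := by
    have := congrFun (congrFun hprod i) i
    rw [Matrix.smul_apply, Matrix.mul_diagonal, Matrix.diagonal_mul] at this
    exact this
  -- Since ω² + 1 = 4λ/(1+λ)², the product of -2jλ/(1+λ), 1/(1+λ) and 2/(ω²+1) is -j.
  have hfin : ((D'.firstOrder W i r : ℝ) : ℂ) = -(Complex.I * z) := by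
    have h3 := m.one_add_lam_ne_zero hμ i r
    have h4 := m.lam_ne_zero i r
    have h5 := hv0 i
    have hom : (m.omega i r : ℂ) = Complex.I * (1 - m.lam i r) / (1 + m.lam i r) := by
      rw [eq_div_iff h3, m.omega_mul hμ]
    have hom2 : (m.omega i r : ℂ) ^ 2 + 1 = 4 * m.lam i r / (1 + m.lam i r) ^ 2 := by
      rw [hom, div_pow, mul_pow, Complex.I_sq]
      field_simp
      ring
    rw [h2]
    push_cast
    rw [hentry, hom2, hκ]
    field_simp
    ring
  have h6 := congrArg Complex.re hfin
  rw [Complex.ofReal_re] at h6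
  rw [h6, h1]
  simp

/-! ### Size of the noise -/

theorem noiseSize_nonneg (W : Matrix m.Sensor (Fin N) ℂ) : 0 ≤ m.noiseSize W :=
  Real.sqrt_nonneg _

theorem norm_augment_le (W : Matrix m.Sensor (Fin N) ℂ) (s : m.Sensor ⊕ m.Sensor) (n : Fin N) :
    ‖augment W s n‖ ≤ m.noiseSize W := by
  refine Real.le_sqrt_of_sq_le ?_
  exact (Finset.single_le_sum (f := fun n => ‖augment W s n‖ ^ 2) (fun n _ => by positivity)
    (Finset.mem_univ n)).trans (Finset.single_le_sum (f := fun s => ∑ n, ‖augment W s n‖ ^ 2)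
    (fun s _ => by positivity) (Finset.mem_univ s))

theorem norm_fba_le (W : Matrix m.Sensor (Fin N) ℂ) (s : m.Sensor ⊕ m.Sensor)
    (n : Fin N ⊕ Fin N) : ‖fba (augment W) s n‖ ≤ 1 * m.noiseSize W := by
  rw [one_mul, fba_augment m.isReversal_sensor]
  rcases n with n | n
  · exact m.norm_augment_le W s n
  · rw [Matrix.fromCols_apply_inr, mul_exchange_apply (isReversal_fin N)]
    exact m.norm_augment_le W s _

theorem norm_realData_le (W : Matrix m.Sensor (Fin N) ℂ) (s : m.Sensor ⊕ m.Sensor)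
    (n : Fin N ⊕ Fin N) : ‖realData W s n‖ ≤ 2 * m.noiseSize W := by
  have h0 : ∀ (s : m.Sensor) (n : Fin N), ‖W s n‖ ≤ m.noiseSize W := fun s n =>
    m.norm_augment_le W (Sum.inl s) n
  have h1 := m.noiseSize_nonneg W
  rw [realData_eq m.isReversal_sensor (isReversal_fin N)]
  rcases s with s | s <;> rcases n with n | n
  · have := (Complex.abs_re_le_norm (W s n)).trans (h0 s n)
    simpa [abs_mul] using this
  · simpa using h1
  · have := (Complex.abs_im_le_norm (W s n)).trans (h0 s n)
    simpa [abs_mul] using this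
  · simpa using h1

theorem data_eq (W : Matrix m.Sensor (Fin N) ℂ) : m.data W = m.data 0 + W := by
  rw [data, data, add_zero]

/-! ### The estimators -/

theorem hasFirstOrderError_standard (hshift : m.ShiftInvariant)
    (hμ : ∀ i r, m.μ i r ∈ Set.Ioo (-Real.pi) Real.pi)
    (hdistinct : Function.Injective m.μ) (hrank : (augment (m.data 0)).rank = d)
    (hsel : ∀ r, (m.ncJ₁ r * m.ncSteering).rank = d) {c : ℝ} (hc : 1 ≤ c)
    (D : m.StandardExpansion) :
    m.HasFirstOrderError
      (fun W μh => m.IsStandardEstimate c (fba (augment (m.data W))) μh) D.firstOrder := by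
  have hC := m.isShiftModel_fba hshift hμ hdistinct hrank hsel
  obtain ⟨ε, hε, C, hmain⟩ := hC.estimator_expansion D.svd D.pinv D.isUnit D.eigen
    m.noiseSize_nonneg m.norm_fba_le (ψ := Complex.arg)
    (ψ' := fun i r => Complex.imCLM ∘L (((ContinuousLinearMap.mul ℂ ℂ)
      (m.lam i r)⁻¹).restrictScalars ℝ)) (fun i r => arg_isBigO (hμ i r)) hc
  have harg : ∀ i r, Complex.arg (m.lam i r) = m.μ i r := fun i r => by
    rw [lam, mul_comm, Complex.arg_exp_mul_I]
    exact (toIocMod_eq_self _).mpr ⟨(hμ i r).1, by linarith [(hμ i r).2]⟩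
  have hfirst : ∀ W i r, (Complex.imCLM ∘L (((ContinuousLinearMap.mul ℂ ℂ)
      (m.lam i r)⁻¹).restrictScalars ℝ)) ((D.Q⁻¹ * D.P r * (m.ncJ₂ r - m.lam i r • m.ncJ₁ r) *
        subspaceError D.Un D.σ D.Vs (fba (augment W)) * D.Q) i i) = D.firstOrder W i r := by
    intro W i r
    -- The factor 1/λ from the derivative of arg is the one inside the bracket of the first-order
    -- error.
    have h1 : (m.lam i r)⁻¹ • m.ncJ₂ r - m.ncJ₁ r
        = (m.lam i r)⁻¹ • (m.ncJ₂ r - m.lam i r • m.ncJ₁ r) := by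
      rw [smul_sub, smul_smul, inv_mul_cancel₀ (m.lam_ne_zero i r), one_smul]
    rw [StandardExpansion.firstOrder, h1]
    simp only [Matrix.mul_smul, Matrix.smul_mul, Matrix.smul_apply, smul_eq_mul]
    rfl
  refine ⟨ε, hε, C, fun W hW => ?_⟩
  have hY : fba (augment (m.data W)) = fba (augment (m.data 0)) + fba (augment W) := by
    rw [m.data_eq W, fba_augment_add m.isReversal_sensor]
  obtain ⟨⟨U, G, Q, hU, hG, hQ⟩, hall⟩ := hmain W hW
  refine ⟨⟨_, U, G, Q, hY ▸ hU, hG, hQ, fun i r => rfl⟩, ?_⟩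
  rintro μh ⟨U, G, Q, hU, hG, hQ, hμh⟩
  obtain ⟨τ, hτ⟩ := hall U G Q (hY ▸ hU) hG hQ
  refine ⟨τ, fun i r => ?_⟩
  have := hτ i r
  rwa [harg, hfirst, ← hμh] at this

theorem hasFirstOrderError_unitary (hshift : m.ShiftInvariant)
    (hμ : ∀ i r, m.μ i r ∈ Set.Ioo (-Real.pi) Real.pi)
    (hdistinct : Function.Injective m.μ) (hrank : (augment (m.data 0)).rank = d)
    (hsel : ∀ r, (m.ncJ₁ r * m.ncSteering).rank = d) {c : ℝ} (hc : 1 ≤ c)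
    (D : m.UnitaryExpansion) :
    m.HasFirstOrderError (fun W μh => m.IsUnitaryEstimate c (m.data W) μh) D.firstOrder := by
  have hC := m.isShiftModel_realData hshift hμ hdistinct hrank hsel
  obtain ⟨ε, hε, C, hmain⟩ := hC.estimator_expansion D.svd D.pinv D.isUnit D.eigen
    m.noiseSize_nonneg m.norm_realData_le (ψ := fun z => 2 * Real.arctan z)
    (ψ' := fun i r => (ContinuousLinearMap.mul ℝ ℝ) (2 / (m.omega i r ^ 2 + 1)))
    (fun i r => arctan_isBigO (m.omega i r)) hc
  have harg : ∀ i r, 2 * Real.arctan (m.omega i r) = m.μ i r := fun i r => by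
    rw [omega, Real.arctan_tan (by linarith [(hμ i r).1]) (by linarith [(hμ i r).2])]
    ring
  have hfirst : ∀ W i r, ((ContinuousLinearMap.mul ℝ ℝ) (2 / (m.omega i r ^ 2 + 1)))
      ((D.V⁻¹ * D.P r * (m.K₂ r - m.omega i r • m.K₁ r) *
        subspaceError D.En D.σ D.Ws (realData W) * D.V) i i) = D.firstOrder W i r := by
    intro W i r
    rw [UnitaryExpansion.firstOrder, mul_comm]
    rfl
  refine ⟨ε, hε, C, fun W hW => ?_⟩
  have hY : realData (m.data W) = realData (m.data 0) + realData W := by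
    rw [m.data_eq W, realData_add m.isReversal_sensor (isReversal_fin N)]
  obtain ⟨⟨U, G, Q, hU, hG, hQ⟩, hall⟩ := hmain W hW
  refine ⟨⟨_, U, G, Q, hY ▸ hU, hG, hQ, fun i r => rfl⟩, ?_⟩
  rintro μh ⟨U, G, Q, hU, hG, hQ, hμh⟩
  obtain ⟨τ, hτ⟩ := hall U G Q (hY ▸ hU) hG hQ
  refine ⟨τ, fun i r => ?_⟩
  have := hτ i r
  rwa [harg, hfirst, ← hμh] at this

theorem isStandardEstimate_fba_iff (c : ℝ) (X : Matrix m.Sensor (Fin N) ℂ)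
    (μh : Fin d → Fin R → ℝ) :
    m.IsStandardEstimate c (fba (augment X)) μh ↔ m.IsStandardEstimate c (augment X) μh := by
  simp only [IsStandardEstimate, isDominantLeft_fba_iff m.isReversal_sensor (isReversal_fin N)]

theorem nonempty_standardExpansion (hshift : m.ShiftInvariant)
    (hμ : ∀ i r, m.μ i r ∈ Set.Ioo (-Real.pi) Real.pi)
    (hdistinct : Function.Injective m.μ) (hrank : (augment (m.data 0)).rank = d)
    (hsel : ∀ r, (m.ncJ₁ r * m.ncSteering).rank = d) : Nonempty m.StandardExpansion := by
  have hC := m.isShiftModel_fba hshift hμ hdistinct hrank hsel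
  obtain ⟨p, Us, Un, σ, Vs, hsvd⟩ := hC.exists_isRankSVD
  choose P hP using hC.exists_isPinv hsvd
  obtain ⟨Q, hQ, heig⟩ := hC.exists_eigenvectors hsvd
  exact ⟨⟨p, Us, Un, σ, Vs, P, Q, hsvd, hP, hQ, fun r => heig r (P r) (hP r)⟩⟩

theorem nonempty_unitaryExpansion (hshift : m.ShiftInvariant)
    (hμ : ∀ i r, m.μ i r ∈ Set.Ioo (-Real.pi) Real.pi)
    (hdistinct : Function.Injective m.μ) (hrank : (augment (m.data 0)).rank = d)
    (hsel : ∀ r, (m.ncJ₁ r * m.ncSteering).rank = d) : Nonempty m.UnitaryExpansion := by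
  have hC := m.isShiftModel_realData hshift hμ hdistinct hrank hsel
  obtain ⟨p, Us, Un, σ, Vs, hsvd⟩ := hC.exists_isRankSVD
  choose P hP using hC.exists_isPinv hsvd
  obtain ⟨Q, hQ, heig⟩ := hC.exists_eigenvectors hsvd
  exact ⟨⟨p, Us, Un, σ, Vs, P, Q, hsvd, hP, hQ, fun r => heig r (P r) (hP r)⟩⟩

end Model

end NCEsprit

theorem theorem4 {R d N : ℕ} (m : NCEsprit.Model R d N)
    (hshift : m.ShiftInvariant)
    (hμ : ∀ i r, m.μ i r ∈ Set.Ioo (-Real.pi) Real.pi)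
    (hdistinct : Function.Injective m.μ)
    (hrank : (NCEsprit.augment (m.data 0)).rank = d)
    (hsel : ∀ r, (m.ncJ₁ r * m.ncSteering).rank = d)
    (c : ℝ) (hc : 1 ≤ c) :
    Nonempty m.StandardExpansion ∧ Nonempty m.UnitaryExpansion ∧
    ∀ (D : m.StandardExpansion) (D' : m.UnitaryExpansion),
      (∀ W i r, D'.firstOrder W i r = D.firstOrder W i r) ∧
      m.HasFirstOrderError
        (fun W μh => m.IsStandardEstimate c (NCEsprit.fba (NCEsprit.augment (m.data W))) μh)
        D.firstOrder ∧
      m.HasFirstOrderError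
        (fun W μh => m.IsUnitaryEstimate c (m.data W) μh)
        D'.firstOrder ∧
      m.HasFirstOrderError
        (fun W μh => m.IsStandardEstimate c (NCEsprit.augment (m.data W)) μh)
        D.firstOrder := by
  refine ⟨m.nonempty_standardExpansion hshift hμ hdistinct hrank hsel,
    m.nonempty_unitaryExpansion hshift hμ hdistinct hrank hsel, fun D D' =>
    ⟨m.firstOrder_eq hshift hμ hdistinct hrank hsel D D',
      m.hasFirstOrderError_standard hshift hμ hdistinct hrank hsel hc D,
      m.hasFirstOrderError_unitary hshift hμ hdistinct hrank hsel hc D', ?_⟩⟩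
  -- With and without averaging the estimator has the same set of outputs for each noise matrix, so
  -- the expansion carries over unchanged.
  have h := m.hasFirstOrderError_standard hshift hμ hdistinct hrank hsel hc D
  simpa only [m.isStandardEstimate_fba_iff] using h
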